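/- **Lemma (Spectral norm error w.r.t. $S$).** *Model.* Let $L^\star=U^\star\Sigma^\star V^{\star\top}\in\mathbb{R}^{n\times n}$ be a compact SVD of a rank-$r$ matrix ($r\ge1$), with largest and smallest nonzero singular values $\sigma_{\max},\sigma_{\min}$, $\kappa=\sigma_{\max}/\sigma_{\min}$, and $\mu$-incoherent: $\|U^\star\|_{2,\infty},\|V^\star\|_{2,\infty}\le\sqrt{\mu r/n}$ ($\|\cdot\|_{2,\infty}$ is the largest Euclidean row norm, $\|\cdot\|$ the spectral norm). Each entry $(i,j)$ belongs to the set $\Omega_{\mathsf{obs}}$ of observed entries with probability $p\in(0,1]$ and, if observed, to the set $\Omega^\star\subseteq\Omega_{\mathsf{obs}}$ of outliers with conditional probability $\rho_{\mathsf s}$, independently over entries. The outlier matrix $S^\star$ has support $\Omega^\star$; its magnitudes on $\Omega^\star$ are arbitrary positive numbers (possibly depending on the locations) and its signs are i.i.d. uniform on $\{\pm1\}$. The noise matrix $E$ has independent entries, symmetric about $0$, with $\|E_{ij}\|_{\psi_2}\le\sigma$, $\sigma>0$. The signs, the noise, and the pair (locations, magnitudes) are mutually independent. Let $M=L^\star+S^\star+E$,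 which is observed on $\Omega_{\mathsf{obs}}$, and let $\mathcal P_{\Omega_{\mathsf{obs}}}$ set the unobserved entries to $0$. *Algorithm.* Let $X^\star=U^\star\Sigma^{\star1/2}$, $Y^\star=V^\star\Sigma^{\star1/2}$ and $$f(X,Y;S)=\tfrac1{2p}\|\mathcal P_{\Omega_{\mathsf{obs}}}(XY^\top+S-M)\|_{\rm F}^2+\tfrac{\lambda}{2p}\|X\|_{\rm F}^2+\tfrac{\lambda}{2p}\|Y\|_{\rm F}^2 .$$ Start at $(X^0,Y^0,S^0)=(X^\star,Y^\star,S^\star)$ and, with a step size $\eta>0$, iterate $$X^{t+1}=X^t-\eta\nabla_Xf(X^t,Y^t;S^t),\quad Y^{t+1}=Y^t-\eta\nabla_Yf(X^t,Y^t;S^t),\quad S^{t+1}=\mathcal S_\tau\big[\mathcal P_{\Omega_{\mathsf{obs}}}(M-X^{t+1}Y^{t+1\top})\big],$$ where $\mathcal S_\tau$ is entrywise soft thresholding at level $\tau$. Write $F^t$, $F^\star$ for the $2n\times r$ matrices obtained by stacking $X^t$ on $Y^t$ and $X^\star$ on $Y^\star$, and let $H^t$ be a minimizer of $\|F^tR-F^\star\|_{\rm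 F}$ over orthogonal $R\in\mathbb{R}^{r\times r}$. *Claim.* There are universal constants $C_{\mathrm S}>0$ and $C_{\tau,0}>0$, and a universal implied constant in $O(n^{-100})$, such that for all $C_\tau\ge C_{\tau,0}$ and all $C_\lambda,C_{\mathrm{op}},C_\infty>0$ there is a constant $c>0$ with the following property. Set $\lambda=C_\lambda\sigma\sqrt{np}$ and $\tau=C_\tau\sigma\sqrt{\log n}$, and suppose that, for some $\rho_{\mathsf{aug}}\le1$ with $0\le\rho_{\mathsf s}\le\rho_{\mathsf{aug}}$, $$\kappa^4\mu^2r^2n\log n\le c\,n^2p,\qquad \frac{\sigma}{\sigma_{\min}}\sqrt{\frac np}\,\sqrt{\kappa^2\log n}\le c,\qquad \rho_{\mathsf{aug}}\sqrt{\kappa^5\mu r\log^2n}\le c,\qquad \mu nr\log^2n\le c\,n^2p\rho_{\mathsf{aug}} .$$ Then for every $t\ge0$, with probability at least $1-O(n^{-100})$ the following implication holds: if $$\|F^{t+1}H^{t+1}-F^\star\|\le C_{\mathrm{op}}\Big(\frac{\sigma}{\sigma_{\min}}\sqrt{\frac np}+\frac{\lambda}{p\sigma_{\min}}\Big)\|X^\star\|$$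 and $$\|F^{t+1}H^{t+1}-F^\star\|_{2,\infty}\le C_\infty\kappa\Big(\frac{\sigma}{\sigma_{\min}}\sqrt{\frac{n\log n}p}+\frac{\lambda}{p\sigma_{\min}}\Big)\|F^\star\|_{2,\infty},$$ then $$\|S^{t+1}-S^\star\|\le C_{\mathrm S}\,\sigma\sqrt{np}.$$ -/

import Mathlib

open MeasureTheory ProbabilityTheory

noncomputable section

namespace RobustPCA

/-! Matrix norms -/

open scoped Matrix.Norms.L2Operator in
/-- The spectral norm (largest singular value) of a real matrix. -/
def specNorm {m k : Type*} [Fintype m] [Fintype k] [DecidableEq k] (A : Matrix m k ℝ) : ℝ := ‖A‖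

/-- The Frobenius norm. -/
def frobNorm {m k : Type*} [Fintype m] [Fintype k] (A : Matrix m k ℝ) : ℝ :=
  √(∑ i, ∑ j, A i j ^ 2)

/-- The `ℓ_{2,∞}` norm: the largest Euclidean norm of a row. -/
def twoInfNorm {m k : Type*} [Fintype m] [Fintype k] (A : Matrix m k ℝ) : ℝ :=
  ⨆ i, √(∑ j, A i j ^ 2)

/-! The ground truth low-rank matrix -/

/-- `U diag(s) Vᵀ` is a compact singular value decomposition of `L`, with exactly `r` (positive)
singular values; in particular `L` has rank `r`. -/
structure IsCompactSVD {n r : ℕ} (L : Matrix (Fin n) (Fin n) ℝ) (U : Matrix (Fin n) (Fin r) ℝ)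
    (s : Fin r → ℝ) (V : Matrix (Fin n) (Fin r) ℝ) : Prop where
  orthU : U.transpose * U = 1
  orthV : V.transpose * V = 1
  pos : ∀ k, 0 < s k
  eq : L = U * Matrix.diagonal s * V.transpose

/-- Largest singular value. -/
def sigMax {r : ℕ} (s : Fin r → ℝ) : ℝ := ⨆ k, s k

/-- Smallest nonzero singular value. -/
def sigMin {r : ℕ} (s : Fin r → ℝ) : ℝ := ⨅ k, s k

/-- Condition number. -/
def condNum {r : ℕ} (s : Fin r → ℝ) : ℝ := sigMax s / sigMin s

/-- `μ`-incoherence of the singular subspaces. -/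
def Incoherent {n r : ℕ} (U V : Matrix (Fin n) (Fin r) ℝ) (μ : ℝ) : Prop :=
  twoInfNorm U ≤ √(μ * r / n) ∧ twoInfNorm V ≤ √(μ * r / n)

/-- The balanced low-rank factor `U Σ^{1/2}`. -/
def balancedFactor {n r : ℕ} (U : Matrix (Fin n) (Fin r) ℝ) (s : Fin r → ℝ) :
    Matrix (Fin n) (Fin r) ℝ :=
  U * Matrix.diagonal (fun k => √(s k))

/-! The random observation model -/

/-- The sub-Gaussian (`ψ₂`) norm of `X` is at most `σ`, where
`‖X‖_{ψ₂} = inf {t > 0 : 𝔼 exp (X² / t²) ≤ 2}` (for `σ > 0`; the infimum is attained). -/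
def SubGaussianNormLE {Ω : Type*} [MeasurableSpace Ω] (P : Measure Ω) (X : Ω → ℝ) (σ : ℝ) : Prop :=
  ∫⁻ ω, ENNReal.ofReal (Real.exp (X ω ^ 2 / σ ^ 2)) ∂P ≤ 2

/-- The outlier matrix with support `out`, signs `sgn` and magnitudes `mag`. -/
def outlierMatrix {n : ℕ} (out : Fin n → Fin n → Bool) (sgn mag : Fin n → Fin n → ℝ) :
    Matrix (Fin n) (Fin n) ℝ :=
  Matrix.of fun i j => if out i j = true then sgn i j * mag i j else 0

/-- The random data. `obs ω i j = true` means that the entry `(i, j)` is observed and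
`out ω i j = true` that it carries an outlier. The magnitudes of the outliers are arbitrary
positive numbers, and may depend on the locations. -/
structure IsModel {n : ℕ} {Ω : Type*} [MeasurableSpace Ω] (P : Measure Ω) (p ρs σ : ℝ)
    (obs out : Ω → Fin n → Fin n → Bool) (sgn mag noise : Ω → Fin n → Fin n → ℝ) : Prop where
  measurable_obs : Measurable obs
  measurable_out : Measurable out
  measurable_sgn : Measurable sgn
  measurable_mag : Measurable mag
  measurable_noise : Measurable noise
  /-- Outliers only occur at observed entries. -/
  out_subset_obs : ∀ ω i j, out ω i j = true → obs ω i j = true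
  /-- Each entry is observed with probability `p`. -/
  prob_obs : ∀ i j, P {ω | obs ω i j = true} = ENNReal.ofReal p
  /-- Each observed entry is corrupted with (conditional) probability `ρs`. -/
  prob_out : ∀ i j, P {ω | out ω i j = true} = ENNReal.ofReal (p * ρs)
  /-- Sampling and corruption are independent across entries. -/
  indep_loc : iIndepFun (fun (e : Fin n × Fin n) ω => (obs ω e.1 e.2, out ω e.1 e.2)) P
  mag_pos : ∀ ω i j, 0 < mag ω i j
  /-- The signs are independent and uniform on `{1, -1}`. -/
  sgn_val : ∀ ω i j, sgn ω i j = 1 ∨ sgn ω i j = -1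
  prob_sgn : ∀ i j, P {ω | sgn ω i j = 1} = 1 / 2
  indep_sgn : iIndepFun (fun (e : Fin n × Fin n) ω => sgn ω e.1 e.2) P
  /-- The noise entries are independent, symmetric about zero and sub-Gaussian. -/
  noise_symm : ∀ i j, P.map (fun ω => noise ω i j) = P.map (fun ω => - noise ω i j)
  noise_subG : ∀ i j, SubGaussianNormLE P (fun ω => noise ω i j) σ
  indep_noise : iIndepFun (fun (e : Fin n × Fin n) ω => noise ω e.1 e.2) P
  /-- Signs, noise, and (locations, magnitudes) are independent of each other. -/
  indep_sgn_noise : IndepFun sgn noise P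
  indep_loc_mag : IndepFun (fun ω => (obs ω, out ω, mag ω)) (fun ω => (sgn ω, noise ω)) P

/-! The nonconvex algorithm -/

/-- Projection onto the matrices supported on the observed entries. -/
def proj {n : ℕ} (obs : Fin n → Fin n → Bool) (A : Matrix (Fin n) (Fin n) ℝ) :
    Matrix (Fin n) (Fin n) ℝ :=
  Matrix.of fun i j => if obs i j = true then A i j else 0

/-- Entrywise soft thresholding at level `τ`. -/
def softThreshold {n : ℕ} (τ : ℝ) (A : Matrix (Fin n) (Fin n) ℝ) : Matrix (Fin n) (Fin n) ℝ :=
  Matrix.of fun i j => Real.sign (A i j) * max (|A i j| - τ) 0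

/-- The smooth part `f(X, Y; S)` of the loss. -/
def loss {n r : ℕ} (obs : Fin n → Fin n → Bool) (M : Matrix (Fin n) (Fin n) ℝ) (p lam : ℝ)
    (X Y : Matrix (Fin n) (Fin r) ℝ) (S : Matrix (Fin n) (Fin n) ℝ) : ℝ :=
  1 / (2 * p) * frobNorm (proj obs (X * Y.transpose + S - M)) ^ 2
    + lam / (2 * p) * frobNorm X ^ 2 + lam / (2 * p) * frobNorm Y ^ 2

/-- The gradient (matrix of partial derivatives) at `X` of a function of a matrix. -/
def matGrad {n r : ℕ} (g : Matrix (Fin n) (Fin r) ℝ → ℝ) (X : Matrix (Fin n) (Fin r) ℝ) :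
    Matrix (Fin n) (Fin r) ℝ :=
  Matrix.of fun i k => deriv (fun h : ℝ => g (X + Matrix.single i k h)) 0

/-- The iterates `(X^t, Y^t, S^t)`: gradient steps in `(X, Y)` with step size `η`, followed by exact
minimization in `S`, i.e. soft thresholding of the observed residual. -/
def iterates {n r : ℕ} (obs : Fin n → Fin n → Bool) (M : Matrix (Fin n) (Fin n) ℝ)
    (p lam τ η : ℝ) (X₀ Y₀ : Matrix (Fin n) (Fin r) ℝ) (S₀ : Matrix (Fin n) (Fin n) ℝ) :
    ℕ → Matrix (Fin n) (Fin r) ℝ × Matrix (Fin n) (Fin r) ℝ × Matrix (Fin n) (Fin n) ℝ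
  | 0 => (X₀, Y₀, S₀)
  | t + 1 =>
    let X := (iterates obs M p lam τ η X₀ Y₀ S₀ t).1
    let Y := (iterates obs M p lam τ η X₀ Y₀ S₀ t).2.1
    let S := (iterates obs M p lam τ η X₀ Y₀ S₀ t).2.2
    let X' := X - η • matGrad (fun Z => loss obs M p lam Z Y S) X
    let Y' := Y - η • matGrad (fun Z => loss obs M p lam X Z S) Y
    (X', Y', softThreshold τ (proj obs (M - X' * Y'.transpose)))

/-- `H` is a minimizer of `‖F R - F⋆‖_F` over the orthogonal matrices `R`. -/
def IsBestRotation {m : Type*} [Fintype m] {r : ℕ} (F Fs : Matrix m (Fin r) ℝ)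
    (H : Matrix (Fin r) (Fin r) ℝ) : Prop :=
  H ∈ Matrix.orthogonalGroup (Fin r) ℝ ∧
    ∀ R ∈ Matrix.orthogonalGroup (Fin r) ℝ, frobNorm (F * H - Fs) ≤ frobNorm (F * R - Fs)

end RobustPCA

end

/-!
Write `Xₕ = Xs + A` and `Yₕ = Ys + B` for the rotated iterate at step `t + 1`. The residual fed to
the soft threshold is `S + E + D` on the observed entries, where `D = Xs Ysᵀ - Xₕ Yₕᵀ = -(A Yₕᵀ +
Xs Bᵀ)`. On the event that all noise entries are at most `11 σ √(log n)`, the row-wise hypothesis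
keeps `E + D` below the level `τ` off the outliers, so that the error `T = S^{t+1} - S⋆` is
supported on the outliers. There soft thresholding is `1`-Lipschitz, hence `|T - G| ≤ |D|`
entrywise, where `G` is the error that soft thresholding would make with `D = 0` and truncated noise
(`abs_shrink_residual_sub_outErr_le`). The iterate depends on the data, but `G` does not depend on
it, and `T - G` is bounded uniformly over all low-rank errors with small norms; this replaces any
decoupling of the iterate from the outlier pattern.

*The matrix `G`.* Its entries are bounded by a multiple of `σ √(log n)` and vanish off a Bernoulli
pattern of probability `p ρs`. Negating the sign and the noise of one entry negates that entry of
`G` and preserves the joint law, so mixed moments of odd degree in some entry vanish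
(`integral_outErr_monomial_eq_zero`). Therefore `𝔼 tr (G Gᵀ)ᵏ` is bounded by a sum over closed
walks that traverse each edge an even number of times, with a factor `q` for each distinct edge. A
connected graph has at most one more vertex than edges, so this factor may be charged to the
vertices instead, and the walks can be relabelled inside a complete bipartite graph whose sides
have only about `n q + k` vertices (`sum_evenWalk_le`). The number of walks there is the expected
trace of a power of a dense sign matrix, whose norm is controlled by a net argument
(`signExp_specNorm_pow_le`). Taking `k` of order `n p ρ_aug`, which exceeds `log n`, gives `‖G‖ ≲ σ
√(log n) √(n p ρ_aug)`, and `ρ_aug log n` is small.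

*The matrix `T - G`.* Its bilinear form at `u, v` is at most the sum of `|u_i| |v_j| |D_ij|` over
the outliers. The mean of the mask contributes `p ρs √n` times a spectral norm times a row norm
(`mean_pairing_le`). The fluctuation is bounded by the supremum over Frobenius balls of a centred
Bernoulli process indexed by `|P Qᵀ|` (`absPairing`). Symmetrization and contraction remove the
absolute value (`bern_le_sign`), and duality of the spectral and nuclear norms turns the supremum
into the norm of a sparse sign matrix (`bern_absPairing_pow_le`), to which the same walk count
applies. The resulting factor `√(n p ρ_aug)` is multiplied by a product of row norms, which
incoherence and the sample size bound by a small multiple of `σ`.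
-/

set_option linter.unusedSectionVars false

namespace RobustPCA

/-! ### Row norms and the spectral norm as a bilinear form bound -/

section RowNorms

variable {m k l : Type*} [Fintype m] [Fintype k] [Fintype l]

lemma frobNorm_nonneg (A : Matrix m k ℝ) : 0 ≤ frobNorm A := Real.sqrt_nonneg _

lemma frobNorm_sq (A : Matrix m k ℝ) : frobNorm A ^ 2 = ∑ i, ∑ j, A i j ^ 2 :=
  Real.sq_sqrt (Finset.sum_nonneg fun _ _ => Finset.sum_nonneg fun _ _ => sq_nonneg _)

lemma sqrt_row_le_twoInfNorm (A : Matrix m k ℝ) (i : m) :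
    √(∑ j, A i j ^ 2) ≤ twoInfNorm A :=
  le_ciSup (f := fun i => √(∑ j, A i j ^ 2)) (Set.finite_range _).bddAbove i

lemma twoInfNorm_nonneg (A : Matrix m k ℝ) : 0 ≤ twoInfNorm A :=
  Real.iSup_nonneg fun _ => Real.sqrt_nonneg _

lemma twoInfNorm_le {A : Matrix m k ℝ} {C : ℝ} (hC : 0 ≤ C) (h : ∀ i, √(∑ j, A i j ^ 2) ≤ C) :
    twoInfNorm A ≤ C :=
  Real.iSup_le h hC

lemma twoInfNorm_add_le (A B : Matrix m k ℝ) :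
    twoInfNorm (A + B) ≤ twoInfNorm A + twoInfNorm B := by
  refine twoInfNorm_le (add_nonneg (twoInfNorm_nonneg _) (twoInfNorm_nonneg _)) fun i => ?_
  refine le_trans ?_ (add_le_add (sqrt_row_le_twoInfNorm A i) (sqrt_row_le_twoInfNorm B i))
  have := norm_add_le (WithLp.toLp 2 (A i) : EuclideanSpace ℝ k) (WithLp.toLp 2 (B i))
  simpa [EuclideanSpace.norm_eq] using this

lemma abs_sum_mul_le_twoInfNorm {m' : Type*} [Fintype m'] (A : Matrix m k ℝ) (B : Matrix m' k ℝ)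
    (i : m) (j : m') : |∑ x, A i x * B j x| ≤ twoInfNorm A * twoInfNorm B := by
  have h1 : |∑ x, A i x * B j x| ≤ √(∑ x, A i x ^ 2) * √(∑ x, B j x ^ 2) := by
    rw [← Real.sqrt_mul (Finset.sum_nonneg fun _ _ => sq_nonneg _)]
    exact Real.abs_le_sqrt (Finset.sum_mul_sq_le_sq_mul_sq _ _ _)
  exact h1.trans (mul_le_mul (sqrt_row_le_twoInfNorm A i) (sqrt_row_le_twoInfNorm B j)
    (Real.sqrt_nonneg _) (twoInfNorm_nonneg _))

lemma twoInfNorm_fromRows_left {m' : Type*} [Fintype m'] (A : Matrix m k ℝ) (B : Matrix m' k ℝ) :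
    twoInfNorm A ≤ twoInfNorm (Matrix.fromRows A B) :=
  twoInfNorm_le (twoInfNorm_nonneg _) fun i =>
    sqrt_row_le_twoInfNorm (Matrix.fromRows A B) (Sum.inl i)

lemma twoInfNorm_fromRows_right {m' : Type*} [Fintype m'] (A : Matrix m k ℝ) (B : Matrix m' k ℝ) :
    twoInfNorm B ≤ twoInfNorm (Matrix.fromRows A B) :=
  twoInfNorm_le (twoInfNorm_nonneg _) fun i =>
    sqrt_row_le_twoInfNorm (Matrix.fromRows A B) (Sum.inr i)

lemma twoInfNorm_fromRows_le {m' : Type*} [Fintype m'] {A : Matrix m k ℝ} {B : Matrix m' k ℝ}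
    {C : ℝ} (hA : twoInfNorm A ≤ C) (hB : twoInfNorm B ≤ C) :
    twoInfNorm (Matrix.fromRows A B) ≤ C := by
  refine twoInfNorm_le ((twoInfNorm_nonneg _).trans hA) fun i => ?_
  cases i with
  | inl i => exact (sqrt_row_le_twoInfNorm A i).trans hA
  | inr i => exact (sqrt_row_le_twoInfNorm B i).trans hB

end RowNorms

section SpectralNorm

variable {m k l : Type*} [Fintype m] [Fintype k] [Fintype l] [DecidableEq k] [DecidableEq l]

open scoped Matrix.Norms.L2Operator in
lemma specNorm_nonneg (A : Matrix m k ℝ) : 0 ≤ specNorm A := norm_nonneg _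

open scoped Matrix.Norms.L2Operator in
lemma specNorm_add_le (A B : Matrix m k ℝ) : specNorm (A + B) ≤ specNorm A + specNorm B :=
  norm_add_le _ _

open scoped Matrix.Norms.L2Operator in
lemma specNorm_mul_le (A : Matrix m k ℝ) (B : Matrix k l ℝ) :
    specNorm (A * B) ≤ specNorm A * specNorm B :=
  Matrix.l2_opNorm_mul _ _

open scoped Matrix.Norms.L2Operator in
lemma specNorm_transpose [DecidableEq m] (A : Matrix m k ℝ) :
    specNorm A.transpose = specNorm A := by
  have := Matrix.l2_opNorm_conjTranspose (𝕜 := ℝ) A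
  rwa [Matrix.conjTranspose_eq_transpose_of_trivial] at this

open scoped Matrix.Norms.L2Operator in
lemma specNorm_transpose_mul_self (A : Matrix m k ℝ) :
    specNorm (A.transpose * A) = specNorm A ^ 2 := by
  have := Matrix.l2_opNorm_conjTranspose_mul_self (𝕜 := ℝ) A
  rw [Matrix.conjTranspose_eq_transpose_of_trivial] at this
  rw [sq]; exact this

open scoped Matrix.Norms.L2Operator in
lemma sum_mulVec_sq_le (A : Matrix m k ℝ) (v : k → ℝ) :
    ∑ i, (A.mulVec v) i ^ 2 ≤ specNorm A ^ 2 * ∑ j, v j ^ 2 := by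
  have h := Matrix.l2_opNorm_mulVec (𝕜 := ℝ) A (WithLp.toLp 2 v)
  have h2 := pow_le_pow_left₀ (norm_nonneg _) h 2
  rw [mul_pow, EuclideanSpace.norm_sq_eq, EuclideanSpace.norm_sq_eq] at h2
  simpa [specNorm] using h2

/-- Cauchy–Schwarz for the bilinear form of a matrix. -/
lemma dotProduct_mulVec_le (A : Matrix m k ℝ) (u : m → ℝ) (v : k → ℝ) :
    u ⬝ᵥ A.mulVec v ≤ specNorm A * (√(∑ i, u i ^ 2) * √(∑ j, v j ^ 2)) := by
  have h1 : u ⬝ᵥ A.mulVec v ≤ √(∑ i, u i ^ 2) * √(∑ i, (A.mulVec v) i ^ 2) :=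
    Real.sum_mul_le_sqrt_mul_sqrt _ _ _
  have h2 : √(∑ i, (A.mulVec v) i ^ 2) ≤ specNorm A * √(∑ j, v j ^ 2) := by
    refine Real.sqrt_le_iff.2 ⟨mul_nonneg (specNorm_nonneg _) (Real.sqrt_nonneg _), ?_⟩
    rw [mul_pow, Real.sq_sqrt (Finset.sum_nonneg fun _ _ => sq_nonneg _)]
    exact sum_mulVec_sq_le A v
  calc _ ≤ _ := h1
    _ ≤ √(∑ i, u i ^ 2) * (specNorm A * √(∑ j, v j ^ 2)) := by gcongr
    _ = _ := by ring

open scoped Matrix.Norms.L2Operator in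
lemma specNorm_le_of_mulVec {A : Matrix m k ℝ} {C : ℝ} (hC : 0 ≤ C)
    (h : ∀ v : k → ℝ, ∑ i, (A.mulVec v) i ^ 2 ≤ C ^ 2 * ∑ j, v j ^ 2) : specNorm A ≤ C := by
  unfold specNorm
  rw [Matrix.l2_opNorm_def]
  refine ContinuousLinearMap.opNorm_le_bound _ hC fun x => ?_
  have h1 := h x.ofLp
  refine le_of_sq_le_sq ?_ (by positivity)
  rw [mul_pow, EuclideanSpace.norm_sq_eq, EuclideanSpace.norm_sq_eq]
  simpa using h1

lemma specNorm_le_of_bilin {A : Matrix m k ℝ} {C : ℝ} (hC : 0 ≤ C)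
    (h : ∀ (u : m → ℝ) (v : k → ℝ), ∑ i, u i ^ 2 ≤ 1 → ∑ j, v j ^ 2 ≤ 1 →
      u ⬝ᵥ A.mulVec v ≤ C) : specNorm A ≤ C := by
  refine specNorm_le_of_mulVec hC fun v => ?_
  set a := √(∑ i, (A.mulVec v) i ^ 2) with ha
  set b := √(∑ j, v j ^ 2) with hb
  have ha2 : a ^ 2 = ∑ i, (A.mulVec v) i ^ 2 :=
    Real.sq_sqrt (Finset.sum_nonneg fun _ _ => sq_nonneg _)
  have hb2 : b ^ 2 = ∑ j, v j ^ 2 := Real.sq_sqrt (Finset.sum_nonneg fun _ _ => sq_nonneg _)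
  have ha0 : 0 ≤ a := Real.sqrt_nonneg _
  have hb0 : 0 ≤ b := Real.sqrt_nonneg _
  rw [← ha2, ← hb2, ← mul_pow]
  refine pow_le_pow_left₀ ha0 ?_ 2
  rcases ha0.eq_or_lt with h0 | h0
  · rw [← h0]; positivity
  rcases hb0.eq_or_lt with h0' | h0'
  · exfalso
    have : ∑ i, (A.mulVec v) i ^ 2 ≤ specNorm A ^ 2 * ∑ j, v j ^ 2 := sum_mulVec_sq_le A v
    rw [← ha2, ← hb2, ← h0'] at this
    nlinarith
  have := h (fun i => A.mulVec v i / a) (fun j => v j / b) ?_ ?_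
  · have e : (fun i => A.mulVec v i / a) ⬝ᵥ A.mulVec (fun j => v j / b) = a / b := by
      have e1 : (fun j => v j / b) = b⁻¹ • v := by ext j; simp [div_eq_inv_mul]
      have e2 : (fun i => A.mulVec v i / a) = a⁻¹ • A.mulVec v := by
        ext j; simp [div_eq_inv_mul]
      rw [e1, e2, Matrix.mulVec_smul, smul_dotProduct, dotProduct_smul]
      have : A.mulVec v ⬝ᵥ A.mulVec v = a ^ 2 := by rw [ha2]; simp [dotProduct, sq]
      rw [this]; simp; field_simp
    rw [e, div_le_iff₀ h0'] at this
    exact this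
  · simp only [div_pow]; rw [← Finset.sum_div, ← ha2]; exact div_self_le_one _
  · simp only [div_pow]; rw [← Finset.sum_div, ← hb2]; exact div_self_le_one _

/-- A matrix of positive norm attains its spectral norm up to any factor less than one. -/
lemma exists_unit_bilin {A : Matrix m k ℝ} {t : ℝ} (ht : 0 ≤ t) (h : t < specNorm A) :
    ∃ (u : m → ℝ) (v : k → ℝ), ∑ i, u i ^ 2 ≤ 1 ∧ ∑ j, v j ^ 2 ≤ 1 ∧
      t < u ⬝ᵥ A.mulVec v := by
  by_contra! hcon
  exact absurd (specNorm_le_of_bilin ht hcon) (not_le.2 h)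

lemma specNorm_le_frobNorm (A : Matrix m k ℝ) : specNorm A ≤ frobNorm A := by
  refine specNorm_le_of_mulVec (Real.sqrt_nonneg _) fun v => ?_
  rw [frobNorm_sq, Finset.sum_mul]
  refine Finset.sum_le_sum fun i _ => ?_
  exact Finset.sum_mul_sq_le_sq_mul_sq _ _ _

lemma abs_apply_le_specNorm (A : Matrix m k ℝ) (i : m) (j : k) : |A i j| ≤ specNorm A := by
  have h := sum_mulVec_sq_le A (Pi.single j 1)
  have h1 : ∑ x, (Pi.single j (1 : ℝ) : k → ℝ) x ^ 2 = 1 := by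
    simp [Pi.single_apply]
  rw [h1, mul_one] at h
  refine abs_le_of_sq_le_sq ?_ (specNorm_nonneg _)
  refine le_trans ?_ h
  have := Finset.single_le_sum (f := fun i => (A.mulVec (Pi.single j 1)) i ^ 2)
    (fun i _ => sq_nonneg _) (Finset.mem_univ i)
  simpa using this

lemma specNorm_fromRows_right {m' : Type*} [Fintype m'] (A : Matrix m k ℝ) (B : Matrix m' k ℝ) :
    specNorm B ≤ specNorm (Matrix.fromRows A B) := by
  refine specNorm_le_of_mulVec (specNorm_nonneg _) fun v => ?_
  refine le_trans ?_ (sum_mulVec_sq_le (Matrix.fromRows A B) v)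
  rw [Fintype.sum_sum_type, Matrix.fromRows_mulVec]
  exact le_add_of_nonneg_left (Finset.sum_nonneg fun _ _ => sq_nonneg _)

/-- Pairing with `P Qᵀ` is bounded by the spectral norm times the nuclear norm of `P Qᵀ`, which is
at most `‖P‖_F ‖Q‖_F`. -/
lemma sum_mul_inner_le (W : Matrix m k ℝ) (P : Matrix m l ℝ) (Q : Matrix k l ℝ) :
    ∑ i, ∑ j, W i j * ∑ x, P i x * Q j x ≤ specNorm W * (frobNorm P * frobNorm Q) := by
  have e : ∑ i, ∑ j, W i j * ∑ x, P i x * Q j x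
      = ∑ x, (fun i => P i x) ⬝ᵥ W.mulVec (fun j => Q j x) := by
    simp only [dotProduct, Matrix.mulVec, Finset.mul_sum]
    rw [Finset.sum_comm]
    rw [Finset.sum_comm (s := (Finset.univ : Finset l))]
    rw [Finset.sum_comm]
    refine Finset.sum_congr rfl fun i _ => ?_
    rw [Finset.sum_comm]
    refine Finset.sum_congr rfl fun x _ => Finset.sum_congr rfl fun y _ => ?_
    ring
  rw [e]
  calc _ ≤ ∑ x, specNorm W * (√(∑ i, P i x ^ 2) * √(∑ j, Q j x ^ 2)) :=
        Finset.sum_le_sum fun x _ => dotProduct_mulVec_le _ _ _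
    _ = specNorm W * ∑ x, √(∑ i, P i x ^ 2) * √(∑ j, Q j x ^ 2) := by rw [Finset.mul_sum]
    _ ≤ _ := by
        refine mul_le_mul_of_nonneg_left ?_ (specNorm_nonneg _)
        refine (Real.sum_mul_le_sqrt_mul_sqrt _ _ _).trans (le_of_eq ?_)
        have h (x : l) : √(∑ i, P i x ^ 2) ^ 2 = ∑ i, P i x ^ 2 :=
          Real.sq_sqrt (Finset.sum_nonneg fun _ _ => sq_nonneg _)
        have h' (x : l) : √(∑ i, Q i x ^ 2) ^ 2 = ∑ i, Q i x ^ 2 :=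
          Real.sq_sqrt (Finset.sum_nonneg fun _ _ => sq_nonneg _)
        rw [Finset.sum_congr rfl fun x _ => h x, Finset.sum_congr rfl fun x _ => h' x]
        rw [Finset.sum_comm, Finset.sum_comm (s := (Finset.univ : Finset l))]
        rfl

end SpectralNorm

/-! ### Closed walks and traces of powers -/

section Walks

variable {α β : Type*} [Fintype α] [DecidableEq α] [Fintype β] [DecidableEq β]

/-- Entries of a power as sums over walks. The walk is recorded by its first `k + 1` vertices; its
endpoint `b` is kept separate. -/
lemma pow_succ_apply_eq_sum (A : Matrix α α ℝ) (k : ℕ) (a b : α) :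
    (A ^ (k + 1)) a b = ∑ i : Fin (k + 1) → α, if i 0 = a then
      (∏ l : Fin k, A (i l.castSucc) (i l.succ)) * A (i (Fin.last k)) b else 0 := by
  induction k generalizing a b with
  | zero =>
    rw [← (Equiv.funUnique (Fin 1) α).symm.sum_comp]
    simp
  | succ k ih =>
    rw [pow_succ', Matrix.mul_apply]
    simp_rw [ih, Finset.mul_sum]
    rw [Finset.sum_comm, ← (Fin.consEquiv fun _ : Fin (k + 1 + 1) => α).sum_comp,
      Fintype.sum_prod_type]
    simp only [Fin.consEquiv_apply, Fin.cons_zero]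
    rw [Finset.sum_comm (γ := α)]
    refine Finset.sum_congr rfl fun i _ => ?_
    simp [Fin.prod_univ_succ, mul_assoc, Fin.cons, ← Fin.succ_last]

lemma trace_pow_succ (A : Matrix α α ℝ) (k : ℕ) :
    (A ^ (k + 1)).trace = ∑ i : Fin (k + 1) → α, ∏ l, A (i l) (i (l + 1)) := by
  simp only [Matrix.trace, Matrix.diag_apply, pow_succ_apply_eq_sum]
  rw [Finset.sum_comm]
  refine Finset.sum_congr rfl fun i _ => ?_
  rw [Finset.sum_ite_eq, if_pos (Finset.mem_univ _), Fin.prod_univ_castSucc]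
  simp

/-- The `2(k+1)` edges traversed by the closed walk `i 0, j 0, i 1, j 1, …, i k, j k, i 0` in the
complete bipartite graph with sides `α` and `β`. -/
def walkEdge {k : ℕ} (i : Fin (k + 1) → α) (j : Fin (k + 1) → β) (x : Fin (k + 1) × Bool) : α × β :=
  (if x.2 then i (x.1 + 1) else i x.1, j x.1)

lemma trace_mul_transpose_pow_succ (G : Matrix α β ℝ) (k : ℕ) :
    ((G * G.transpose) ^ (k + 1)).trace = ∑ i : Fin (k + 1) → α, ∑ j : Fin (k + 1) → β,
      ∏ x, G (walkEdge i j x).1 (walkEdge i j x).2 := by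
  rw [trace_pow_succ]
  refine Finset.sum_congr rfl fun i _ => ?_
  simp only [Matrix.mul_apply, Matrix.transpose_apply]
  rw [Finset.prod_univ_sum, Fintype.piFinset_univ]
  refine Finset.sum_congr rfl fun j _ => ?_
  rw [Fintype.prod_prod_type]
  refine Finset.prod_congr rfl fun l _ => ?_
  simp [walkEdge, mul_comm]

/-- Along a walk, every new vertex comes with a new edge. -/
lemma card_vertices_le_card_edges {V E : Type*} [DecidableEq V] [DecidableEq E] (v : ℕ → V)
    (e : ℕ → E) (h : ∀ s t, e s = e t → v (s + 1) = v t ∨ v (s + 1) = v (t + 1)) (L : ℕ) :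
    ((Finset.range (L + 1)).image v).card ≤ ((Finset.range L).image e).card + 1 := by
  induction L with
  | zero => simp
  | succ L ih =>
    rw [Finset.range_add_one (n := L + 1), Finset.image_insert,
      Finset.range_add_one (n := L), Finset.image_insert (s := Finset.range L) (f := e)]
    by_cases hv : v (L + 1) ∈ (Finset.range (L + 1)).image v
    · rw [← Finset.range_add_one, Finset.insert_eq_of_mem hv]
      exact ih.trans (Nat.add_le_add_right
        (Finset.card_le_card (Finset.subset_insert _ _)) 1)
    · have he : e L ∉ (Finset.range L).image e := by
        intro hmem
        obtain ⟨t, ht, hte⟩ := Finset.mem_image.1 hmem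
        rw [Finset.mem_range] at ht
        apply hv
        rcases h L t hte.symm with h1 | h1
        · exact Finset.mem_image.2 ⟨t, Finset.mem_range.2 (by omega), h1.symm⟩
        · exact Finset.mem_image.2 ⟨t + 1, Finset.mem_range.2 (by omega), h1.symm⟩
      rw [← Finset.range_add_one, Finset.card_insert_of_notMem hv, Finset.card_insert_of_notMem he]
      omega

/-- A walk is connected, so it visits at most one more vertex than it has distinct edges. -/
lemma card_image_add_card_image_le {k : ℕ} (i : Fin (k + 1) → α) (j : Fin (k + 1) → β) :
    (Finset.univ.image i).card + (Finset.univ.image j).card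
      ≤ (Finset.univ.image (walkEdge i j)).card + 1 := by
  -- the vertices and edges of the walk, listed in order of traversal
  let v : ℕ → α ⊕ β := fun t =>
    if t % 2 = 0 then Sum.inl (i (Fin.ofNat (k + 1) (t / 2)))
    else Sum.inr (j (Fin.ofNat (k + 1) (t / 2)))
  let e : ℕ → α × β := fun t =>
    if t % 2 = 0 then (i (Fin.ofNat (k + 1) (t / 2)), j (Fin.ofNat (k + 1) (t / 2)))
    else (i (Fin.ofNat (k + 1) (t / 2 + 1)), j (Fin.ofNat (k + 1) (t / 2)))
  have hve : ∀ t, (v t = Sum.inl (e t).1 ∧ v (t + 1) = Sum.inr (e t).2) ∨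
      (v t = Sum.inr (e t).2 ∧ v (t + 1) = Sum.inl (e t).1) := by
    intro t
    rcases Nat.mod_two_eq_zero_or_one t with ht | ht
    · left
      have h1 : (t + 1) % 2 = 1 := by omega
      have h2 : (t + 1) / 2 = t / 2 := by omega
      simp [v, e, ht, h1, h2]
    · right
      have h1 : (t + 1) % 2 = 0 := by omega
      have h2 : (t + 1) / 2 = t / 2 + 1 := by omega
      simp [v, e, ht, h1, h2]
  have key := card_vertices_le_card_edges v e (fun s t hst => by
    rcases hve s with h1 | h1 <;> rcases hve t with h2 | h2 <;> rw [hst] at h1 <;>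
      simp [h1, h2]) (2 * k + 1)
  have hV : (Finset.univ.image i).disjSum (Finset.univ.image j)
      ⊆ (Finset.range (2 * k + 1 + 1)).image v := by
    intro x hx
    rw [Finset.mem_disjSum] at hx
    rcases hx with ⟨a, ha, rfl⟩ | ⟨b, hb, rfl⟩
    · obtain ⟨l, -, rfl⟩ := Finset.mem_image.1 ha
      refine Finset.mem_image.2 ⟨2 * l.1, Finset.mem_range.2 (by omega), ?_⟩
      simp [v]
    · obtain ⟨l, -, rfl⟩ := Finset.mem_image.1 hb
      refine Finset.mem_image.2 ⟨2 * l.1 + 1, Finset.mem_range.2 (by omega), ?_⟩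
      have h2 : (2 * l.1 + 1) / 2 = l.1 := by omega
      simp [v, h2]
  have hE : (Finset.range (2 * k + 1)).image e ⊆ Finset.univ.image (walkEdge i j) := by
    intro x hx
    obtain ⟨t, ht, rfl⟩ := Finset.mem_image.1 hx
    rw [Finset.mem_range] at ht
    rcases Nat.mod_two_eq_zero_or_one t with h | h
    · exact Finset.mem_image.2 ⟨(Fin.ofNat (k + 1) (t / 2), false), Finset.mem_univ _, by
        simp [e, h, walkEdge]⟩
    · refine Finset.mem_image.2 ⟨(Fin.ofNat (k + 1) (t / 2), true), Finset.mem_univ _, ?_⟩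
      have : Fin.ofNat (k + 1) (t / 2) + 1 = Fin.ofNat (k + 1) (t / 2 + 1) := by
        ext; simp [Fin.ofNat, Fin.val_add]
      simp only [e, h, walkEdge, this]
      simp
  have h1 := Finset.card_le_card hV
  have h2 := Finset.card_le_card hE
  rw [Finset.card_disjSum] at h1
  omega

/-- The functions `w` and `w'` identify the same pairs of points. -/
def SameKernel {ι : Type*} (w : ι → α) (w' : ι → β) : Prop :=
  ∀ x y, w x = w y ↔ w' x = w' y

section SameKernel

variable {ι : Type*} [Fintype ι] [DecidableEq ι]

lemma SameKernel.card_image_eq {w : ι → α} {w' : ι → β} (h : SameKernel w w') :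
    (Finset.univ.image w).card = (Finset.univ.image w').card := by
  classical
  -- the common number of classes of the kernel
  let f : Finset.univ.image w → Finset.univ.image w' := fun y =>
    ⟨w' (Finset.mem_image.1 y.2).choose, Finset.mem_image_of_mem _ (Finset.mem_univ _)⟩
  have hf : ∀ x, f ⟨w x, Finset.mem_image_of_mem _ (Finset.mem_univ _)⟩
      = ⟨w' x, Finset.mem_image_of_mem _ (Finset.mem_univ _)⟩ := fun x => by
    apply Subtype.ext
    refine (h _ _).1 ?_
    exact (Finset.mem_image.1 (Finset.mem_image_of_mem w (Finset.mem_univ x))).choose_spec.2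
  have hb : Function.Bijective f := by
    constructor
    · rintro ⟨y, hy⟩ ⟨z, hz⟩ hyz
      obtain ⟨a, -, rfl⟩ := Finset.mem_image.1 hy
      obtain ⟨b, -, rfl⟩ := Finset.mem_image.1 hz
      rw [hf, hf] at hyz
      exact Subtype.ext ((h _ _).2 (congrArg Subtype.val hyz))
    · rintro ⟨y, hy⟩
      obtain ⟨a, -, rfl⟩ := Finset.mem_image.1 hy
      exact ⟨_, hf a⟩
  have := Fintype.card_of_bijective hb
  rwa [Fintype.card_coe, Fintype.card_coe] at this

open Classical in
/-- A function with a prescribed kernel is determined by its values on the classes. -/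
lemma card_sameKernel_le (w' : ι → β) :
    (Finset.univ.filter fun w : ι → α => SameKernel w w').card
      ≤ Fintype.card α ^ (Finset.univ.image w').card := by
  have hex : ∀ y : Finset.univ.image w', ∃ x, w' x = y.1 := fun y => by
    obtain ⟨x, -, hx⟩ := Finset.mem_image.1 y.2
    exact ⟨x, hx⟩
  choose s hs using hex
  let f : {w : ι → α // SameKernel w w'} → (Finset.univ.image w' → α) := fun w y => w.1 (s y)
  have hf : Function.Injective f := by
    rintro ⟨w, hw⟩ ⟨z, hz⟩ hwz
    apply Subtype.ext
    funext x
    have h1 := congrFun hwz ⟨w' x, Finset.mem_image_of_mem _ (Finset.mem_univ _)⟩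
    have h2 := hs ⟨w' x, Finset.mem_image_of_mem _ (Finset.mem_univ _)⟩
    have h3 : w _ = w x := (hw _ _).2 h2
    have h4 : z _ = z x := (hz _ _).2 h2
    simp only [f] at h1
    exact (h3.symm.trans h1).trans h4
  have := Fintype.card_le_of_injective f hf
  rwa [Fintype.card_subtype, Fintype.card_fun, Fintype.card_coe] at this

open Classical in
/-- Injective labellings of the classes give functions with a prescribed kernel. -/
lemma le_card_sameKernel (w : ι → α) :
    (Fintype.card β - Fintype.card ι) ^ (Finset.univ.image w).card
      ≤ (Finset.univ.filter fun w' : ι → β => SameKernel w w').card := by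
  let f : (Finset.univ.image w ↪ β) → {w' : ι → β // SameKernel w w'} := fun φ =>
    ⟨fun x => φ ⟨w x, Finset.mem_image_of_mem _ (Finset.mem_univ _)⟩, fun x y => by
      simp [φ.injective.eq_iff]⟩
  have hf : Function.Injective f := by
    intro φ ψ h
    ext ⟨y, hy⟩
    obtain ⟨x, -, rfl⟩ := Finset.mem_image.1 hy
    exact congrFun (congrArg Subtype.val h) x
  have := Fintype.card_le_of_injective f hf
  rw [Fintype.card_subtype, Fintype.card_embedding_eq, Fintype.card_coe] at this
  refine le_trans ?_ this
  refine le_trans ?_ (Nat.pow_sub_le_descFactorial _ _)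
  have h1 : (Finset.univ.image w).card ≤ Fintype.card ι := Finset.card_image_le
  exact Nat.pow_le_pow_left (by omega) _

/-- Transfer of sums over functions into `α` to sums over functions into a smaller set `β`: when
each value costs a factor `q` and `|α| q ≤ |β| - |ι|`, every kernel has at least as many
representatives in `β` as it has weighted representatives in `α`. -/
lemma sum_kernel_transfer {q : ℝ} (hq : 0 ≤ q) (hβ : Fintype.card ι < Fintype.card β)
    (hαβ : Fintype.card α * q ≤ (Fintype.card β : ℝ) - Fintype.card ι)
    (F : (ι → α) → ℝ) (F' : (ι → β) → ℝ) (hF' : ∀ w', 0 ≤ F' w')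
    (hFF : ∀ w w', SameKernel w w' → F w = F' w') :
    ∑ w, F w * q ^ (Finset.univ.image w).card ≤ ∑ w', F' w' := by
  classical
  set N : ℝ := (Fintype.card β : ℝ) - Fintype.card ι with hN
  have hN0 : 0 < N := by
    have : (Fintype.card ι : ℝ) < Fintype.card β := by exact_mod_cast hβ
    linarith
  have hNc : N = ((Fintype.card β - Fintype.card ι : ℕ) : ℝ) := by
    rw [Nat.cast_sub hβ.le]
  have hlow : ∀ w : ι → α, N ^ (Finset.univ.image w).card
      ≤ ((Finset.univ.filter fun w' : ι → β => SameKernel w w').card : ℝ) := fun w => by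
    rw [hNc]; exact_mod_cast le_card_sameKernel (β := β) w
  have hup : ∀ w' : ι → β, ((Finset.univ.filter fun w : ι → α => SameKernel w w').card : ℝ)
      ≤ (Fintype.card α : ℝ) ^ (Finset.univ.image w').card := fun w' => by
    exact_mod_cast card_sameKernel_le (α := α) w'
  have hF : ∀ w, 0 ≤ F w := fun w => by
    have h1 : 0 < (Finset.univ.filter fun w' : ι → β => SameKernel w w').card := by
      have := hlow w
      have h2 : 0 < N ^ (Finset.univ.image w).card := by positivity
      exact_mod_cast h2.trans_le this
    obtain ⟨w', hw'⟩ := Finset.card_pos.1 h1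
    rw [hFF w w' (Finset.mem_filter.1 hw').2]
    exact hF' w'
  calc ∑ w, F w * q ^ (Finset.univ.image w).card
      ≤ ∑ w, ∑ w' : ι → β, if SameKernel w w' then
          F' w' * (q / N) ^ (Finset.univ.image w').card else 0 := by
        refine Finset.sum_le_sum fun w _ => ?_
        rw [← Finset.sum_filter]
        have : ∀ w' ∈ Finset.univ.filter fun w' : ι → β => SameKernel w w',
            F' w' * (q / N) ^ (Finset.univ.image w').card
              = F w * (q / N) ^ (Finset.univ.image w).card := fun w' hw' => by
          have h := (Finset.mem_filter.1 hw').2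
          rw [hFF w w' h, h.card_image_eq]
        rw [Finset.sum_congr rfl this, Finset.sum_const, nsmul_eq_mul]
        have h1 : q ^ (Finset.univ.image w).card
            = N ^ (Finset.univ.image w).card * (q / N) ^ (Finset.univ.image w).card := by
          rw [← mul_pow, mul_div_cancel₀ _ hN0.ne']
        rw [h1]
        have h2 := mul_le_mul_of_nonneg_right (hlow w)
          (mul_nonneg (hF w) (pow_nonneg (div_nonneg hq hN0.le) (Finset.univ.image w).card))
        linarith
    _ = ∑ w' : ι → β, ∑ w : ι → α, if SameKernel w w' then
          F' w' * (q / N) ^ (Finset.univ.image w').card else 0 := Finset.sum_comm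
    _ ≤ ∑ w', F' w' := by
        refine Finset.sum_le_sum fun w' _ => ?_
        rw [← Finset.sum_filter, Finset.sum_const, nsmul_eq_mul]
        have h1 : (Fintype.card α : ℝ) ^ (Finset.univ.image w').card
            * (q / N) ^ (Finset.univ.image w').card ≤ 1 := by
          rw [← mul_pow]
          refine pow_le_one₀ (by positivity) ?_
          rw [← mul_div_assoc, div_le_one hN0]
          exact hαβ
        have h2 := mul_le_mul_of_nonneg_right (hup w')
          (mul_nonneg (hF' w') (pow_nonneg (div_nonneg hq hN0.le) (Finset.univ.image w').card))
        have h3 := mul_le_mul_of_nonneg_left h1 (hF' w')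
        linarith

end SameKernel

/-- Every edge is traversed an even number of times. -/
def EvenWalk {k : ℕ} (i : Fin (k + 1) → α) (j : Fin (k + 1) → β) : Prop :=
  ∀ e, Even (Finset.univ.filter fun x => walkEdge i j x = e).card

instance {k : ℕ} (i : Fin (k + 1) → α) (j : Fin (k + 1) → β) : Decidable (EvenWalk i j) :=
  inferInstanceAs (Decidable (∀ e, Even (Finset.univ.filter fun x => walkEdge i j x = e).card))

lemma evenWalk_of_sameKernel {α' β' : Type*} [DecidableEq α'] [DecidableEq β'] {k : ℕ}
    {i : Fin (k + 1) → α} {j : Fin (k + 1) → β} {i' : Fin (k + 1) → α'} {j' : Fin (k + 1) → β'}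
    (hi : SameKernel i i') (hj : SameKernel j j') (hE : EvenWalk i j) : EvenWalk i' j' := by
  have h : ∀ x y, walkEdge i j x = walkEdge i j y ↔ walkEdge i' j' x = walkEdge i' j' y := by
    rintro ⟨l, a⟩ ⟨l', b⟩
    have h1 := hj l l'
    have h2 := hi (if a then l + 1 else l) (if b then l' + 1 else l')
    simp only [walkEdge, Prod.mk.injEq, ← apply_ite i, ← apply_ite i'] at *
    rw [h1, h2]
  intro e
  by_cases he : ∃ y, walkEdge i' j' y = e
  · obtain ⟨y, rfl⟩ := he
    have := hE (walkEdge i j y)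
    simpa only [h] using this
  · push Not at he
    simp [he]

lemma SameKernel.symm {ι : Type*} {w : ι → α} {w' : ι → β} (h : SameKernel w w') :
    SameKernel w' w := fun x y => (h x y).symm

lemma SameKernel.refl {ι : Type*} (w : ι → α) : SameKernel w w := fun _ _ => Iff.rfl

/-- Comparison of the even closed walks in a large bipartite graph, each edge of which costs a
factor `q`, with the even closed walks in a complete bipartite graph of side slightly larger than
`|α| q`. The exponent of `q` is at least the number of vertices minus one, and the vertices on the
two sides are transferred one side after the other. -/
lemma sum_evenWalk_le {k m : ℕ} {q : ℝ} (hq : 0 < q) (hq1 : q ≤ 1) (hm : k + 1 < m)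
    (hα : Fintype.card α * q ≤ (m : ℝ) - (k + 1)) (hβ : Fintype.card β * q ≤ (m : ℝ) - (k + 1)) :
    ∑ i : Fin (k + 1) → α, ∑ j : Fin (k + 1) → β,
        (if EvenWalk i j then q ^ (Finset.univ.image (walkEdge i j)).card else 0)
      ≤ q⁻¹ * ∑ i : Fin (k + 1) → Fin m, ∑ j : Fin (k + 1) → Fin m,
        if EvenWalk i j then (1 : ℝ) else 0 := by
  have hnn : ∀ (p : Prop) [Decidable p], (0 : ℝ) ≤ if p then 1 else 0 := fun p _ => by
    split_ifs <;> norm_num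
  have step1 : ∀ (i : Fin (k + 1) → α) (j : Fin (k + 1) → β),
      (if EvenWalk i j then q ^ (Finset.univ.image (walkEdge i j)).card else 0)
        ≤ q⁻¹ * (((if EvenWalk i j then 1 else 0) * q ^ (Finset.univ.image i).card)
          * q ^ (Finset.univ.image j).card) := by
    intro i j
    split_ifs
    · rw [inv_mul_eq_div, le_div_iff₀ hq, ← pow_succ, one_mul, ← pow_add]
      exact pow_le_pow_of_le_one hq.le hq1 (card_image_add_card_image_le i j)
    · simp
  have step2 : ∀ j : Fin (k + 1) → β,
      ∑ i : Fin (k + 1) → α, (if EvenWalk i j then 1 else 0) * q ^ (Finset.univ.image i).card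
        ≤ ∑ i : Fin (k + 1) → Fin m, if EvenWalk i j then (1 : ℝ) else 0 := fun j =>
    sum_kernel_transfer hq.le (by simpa using hm) (by simpa using hα) _ _ (fun _ => hnn _)
      fun w w' h => by
        have : EvenWalk w j ↔ EvenWalk w' j :=
          ⟨evenWalk_of_sameKernel h (.refl j), evenWalk_of_sameKernel h.symm (.refl j)⟩
        simp only [this]
  have step3 : ∀ i : Fin (k + 1) → Fin m,
      ∑ j : Fin (k + 1) → β, (if EvenWalk i j then 1 else 0) * q ^ (Finset.univ.image j).card
        ≤ ∑ j : Fin (k + 1) → Fin m, if EvenWalk i j then (1 : ℝ) else 0 := fun i =>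
    sum_kernel_transfer hq.le (by simpa using hm) (by simpa using hβ) _ _ (fun _ => hnn _)
      fun w w' h => by
        have : EvenWalk i w ↔ EvenWalk i w' :=
          ⟨evenWalk_of_sameKernel (.refl i) h, evenWalk_of_sameKernel (.refl i) h.symm⟩
        simp only [this]
  calc _ ≤ ∑ i : Fin (k + 1) → α, ∑ j : Fin (k + 1) → β,
          q⁻¹ * (((if EvenWalk i j then 1 else 0) * q ^ (Finset.univ.image i).card)
          * q ^ (Finset.univ.image j).card) :=
        Finset.sum_le_sum fun i _ => Finset.sum_le_sum fun j _ => step1 i j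
    _ = q⁻¹ * ∑ j : Fin (k + 1) → β, (∑ i : Fin (k + 1) → α,
          (if EvenWalk i j then 1 else 0) * q ^ (Finset.univ.image i).card)
            * q ^ (Finset.univ.image j).card := by
        rw [Finset.sum_comm]
        simp only [Finset.sum_mul, Finset.mul_sum]
    _ ≤ q⁻¹ * ∑ j : Fin (k + 1) → β, (∑ i : Fin (k + 1) → Fin m,
          if EvenWalk i j then (1 : ℝ) else 0) * q ^ (Finset.univ.image j).card := by
        gcongr with j
        exact step2 j
    _ = q⁻¹ * ∑ i : Fin (k + 1) → Fin m, ∑ j : Fin (k + 1) → β,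
          (if EvenWalk i j then 1 else 0) * q ^ (Finset.univ.image j).card := by
        rw [Finset.sum_comm]
        simp only [Finset.sum_mul]
    _ ≤ _ := by
        gcongr with i
        exact step3 i

end Walks

/-! ### Spectral norms and traces of powers -/

section TracePower

variable {m l : Type*} [Fintype m] [Fintype l] [DecidableEq m] [DecidableEq l]

lemma frobNorm_sq_eq_trace (A : Matrix m l ℝ) : frobNorm A ^ 2 = (A * A.transpose).trace := by
  rw [frobNorm_sq]
  simp [Matrix.trace, Matrix.mul_apply, sq]

lemma specNorm_pow_le (A : Matrix m m ℝ) (k : ℕ) :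
    specNorm (A ^ (k + 1)) ≤ specNorm A ^ (k + 1) := by
  induction k with
  | zero => simp
  | succ k ih =>
    rw [pow_succ, pow_succ (specNorm A)]
    exact (specNorm_mul_le _ _).trans (mul_le_mul_of_nonneg_right ih (specNorm_nonneg _))

lemma specNorm_mul_transpose_self (A : Matrix m l ℝ) :
    specNorm (A * A.transpose) = specNorm A ^ 2 := by
  have := specNorm_transpose_mul_self A.transpose
  rwa [Matrix.transpose_transpose, specNorm_transpose] at this

/-- The norms of the powers of a symmetric matrix are log-convex, hence at least the powers of the
norm. -/
lemma pow_specNorm_le {A : Matrix m m ℝ} (hA : A.transpose = A) (k : ℕ) :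
    specNorm A ^ (k + 1) ≤ specNorm (A ^ (k + 1)) ∧
      specNorm A * specNorm (A ^ (k + 1)) ≤ specNorm (A ^ (k + 2)) := by
  have hsq : ∀ s, specNorm (A ^ (s + s)) = specNorm (A ^ s) ^ 2 := fun s => by
    rw [← specNorm_mul_transpose_self, Matrix.transpose_pow, hA, pow_add]
  induction k with
  | zero =>
    refine ⟨by simp, ?_⟩
    have := hsq 1
    simp only [pow_one, zero_add, one_add_one_eq_two] at *
    rw [this, sq]
  | succ k ih =>
    have h1 : specNorm A ^ (k + 2) ≤ specNorm (A ^ (k + 2)) := by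
      refine le_trans ?_ ih.2
      rw [pow_succ' _ (k + 1)]
      exact mul_le_mul_of_nonneg_left ih.1 (specNorm_nonneg _)
    refine ⟨h1, ?_⟩
    rcases (specNorm_nonneg A).eq_or_lt with h0 | h0
    · rw [← h0, zero_mul]; exact specNorm_nonneg _
    have hpos : 0 < specNorm (A ^ (k + 1)) := (pow_pos h0 _).trans_le ih.1
    have h2 : specNorm (A ^ (k + 2)) ^ 2 ≤ specNorm (A ^ (k + 3)) * specNorm (A ^ (k + 1)) := by
      rw [← hsq, show k + 2 + (k + 2) = (k + 3) + (k + 1) by ring, pow_add]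
      exact specNorm_mul_le _ _
    have h3 : specNorm A * specNorm (A ^ (k + 1)) * specNorm (A ^ (k + 2))
        ≤ specNorm (A ^ (k + 2)) ^ 2 := by
      rw [sq]; exact mul_le_mul_of_nonneg_right ih.2 (specNorm_nonneg _)
    refine le_of_mul_le_mul_right ?_ hpos
    linarith

lemma specNorm_pow_le_trace (G : Matrix m l ℝ) (k : ℕ) :
    specNorm G ^ (2 * (k + 1)) ≤ ((G * G.transpose) ^ (k + 1)).trace := by
  have hA : (G * G.transpose).transpose = G * G.transpose := by simp
  rw [pow_mul, ← specNorm_mul_transpose_self]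
  refine (pow_specNorm_le hA k).1.trans ?_
  -- the power is `C Cᵀ` with `C = (G Gᵀ)ˢ` or `C = (G Gᵀ)ˢ G`, according to the parity of `k + 1`
  rcases Nat.even_or_odd (k + 1) with ⟨s, hs⟩ | ⟨s, hs⟩
  · rw [hs, pow_add]
    nth_rewrite 2 [← hA]
    nth_rewrite 4 [← hA]
    rw [← Matrix.transpose_pow, specNorm_mul_transpose_self, ← frobNorm_sq_eq_trace]
    exact pow_le_pow_left₀ (specNorm_nonneg _) (specNorm_le_frobNorm _) 2
  · have e : (G * G.transpose) ^ (k + 1)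
        = ((G * G.transpose) ^ s * G) * ((G * G.transpose) ^ s * G).transpose := by
      rw [Matrix.transpose_mul, Matrix.transpose_pow, hA, hs, Matrix.mul_assoc,
        ← Matrix.mul_assoc G, ← pow_succ', ← pow_add]
      congr 1; ring
    rw [e, specNorm_mul_transpose_self, ← frobNorm_sq_eq_trace]
    exact pow_le_pow_left₀ (specNorm_nonneg _) (specNorm_le_frobNorm _) 2

lemma trace_pow_le_specNorm (G : Matrix m l ℝ) (k : ℕ) :
    ((G * G.transpose) ^ (k + 1)).trace ≤ Fintype.card m * specNorm G ^ (2 * (k + 1)) := by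
  rw [pow_mul, ← specNorm_mul_transpose_self]
  calc ((G * G.transpose) ^ (k + 1)).trace
      ≤ ∑ _i : m, specNorm (G * G.transpose) ^ (k + 1) :=
        Finset.sum_le_sum fun i _ => (le_abs_self _).trans
          ((abs_apply_le_specNorm _ i i).trans (specNorm_pow_le _ k))
    _ = _ := by simp

end TracePower

/-! ### Random matrices with independent sparse signs -/

section SignLaw

variable {E : Type*} [Fintype E] [DecidableEq E]

/-- The symmetric law on `{0, 1, -1}` giving mass `1 - θ` to `0`. -/
noncomputable def signLaw (θ : ℝ) (s : SignType) : ℝ := if s = 0 then 1 - θ else θ / 2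

/-- Expectation with respect to independent signs with law `signLaw θ`. -/
noncomputable def signExp (θ : ℝ) (f : (E → SignType) → ℝ) : ℝ :=
  ∑ z, (∏ e, signLaw θ (z e)) * f z

lemma sum_signType (f : SignType → ℝ) : ∑ s, f s = f 0 + f (-1) + f 1 := by
  rw [SignType.univ_eq]
  simp [Finset.sum_insert, add_assoc]

lemma signLaw_nonneg {θ : ℝ} (h0 : 0 ≤ θ) (h1 : θ ≤ 1) (s : SignType) : 0 ≤ signLaw θ s := by
  unfold signLaw; split_ifs <;> linarith

lemma signExp_mono {θ : ℝ} (h0 : 0 ≤ θ) (h1 : θ ≤ 1) {f g : (E → SignType) → ℝ}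
    (h : ∀ z, f z ≤ g z) : signExp θ f ≤ signExp θ g :=
  Finset.sum_le_sum fun z _ => mul_le_mul_of_nonneg_left (h z)
    (Finset.prod_nonneg fun _ _ => signLaw_nonneg h0 h1 _)

lemma signExp_sum {κ : Type*} (t : Finset κ) (θ : ℝ) (f : κ → (E → SignType) → ℝ) :
    signExp θ (fun z => ∑ a ∈ t, f a z) = ∑ a ∈ t, signExp θ (f a) := by
  simp only [signExp, Finset.mul_sum]
  exact Finset.sum_comm

lemma signExp_const_mul (c θ : ℝ) (f : (E → SignType) → ℝ) :
    signExp θ (fun z => c * f z) = c * signExp θ f := by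
  simp only [signExp, Finset.mul_sum]
  exact Finset.sum_congr rfl fun z _ => by ring

lemma signExp_add (θ : ℝ) (f g : (E → SignType) → ℝ) :
    signExp θ (fun z => f z + g z) = signExp θ f + signExp θ g := by
  simp only [signExp, ← Finset.sum_add_distrib]
  exact Finset.sum_congr rfl fun z _ => by ring

lemma signExp_prod (θ : ℝ) (f : E → SignType → ℝ) :
    signExp θ (fun z => ∏ e, f e (z e)) = ∏ e, ∑ s, signLaw θ s * f e s := by
  rw [Finset.prod_univ_sum, Fintype.piFinset_univ]
  exact Finset.sum_congr rfl fun z _ => by rw [Finset.prod_mul_distrib]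

/-- A monomial in independent symmetric signs has mean zero unless every exponent is even. -/
lemma signExp_monomial {ι : Type*} [Fintype ι] [DecidableEq ι] (θ : ℝ) (e : ι → E) :
    signExp θ (fun z => ∏ x, (z (e x) : ℝ))
      = if ∀ a, Even (Finset.univ.filter fun x => e x = a).card
        then θ ^ (Finset.univ.image e).card else 0 := by
  have h1 : ∀ z : E → SignType, ∏ x, (z (e x) : ℝ)
      = ∏ a, (z a : ℝ) ^ (Finset.univ.filter fun x => e x = a).card := fun z => by
    rw [← Finset.prod_fiberwise' Finset.univ e (fun a => (z a : ℝ))]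
    exact Finset.prod_congr rfl fun a _ => by rw [Finset.prod_const]
  simp_rw [h1]
  rw [signExp_prod θ fun a s => (s : ℝ) ^ (Finset.univ.filter fun x => e x = a).card]
  split_ifs with h
  · have h2 : ∀ a, ∑ s, signLaw θ s * (s : ℝ) ^ (Finset.univ.filter fun x => e x = a).card
        = if a ∈ Finset.univ.image e then θ else 1 := fun a => by
      rw [sum_signType]
      split_ifs with ha
      · have h0 : (Finset.univ.filter fun x => e x = a).card ≠ 0 := by
          obtain ⟨x, -, hx⟩ := Finset.mem_image.1 ha
          exact Finset.card_ne_zero_of_mem (Finset.mem_filter.2 ⟨Finset.mem_univ x, hx⟩)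
        simp [signLaw, (h a).neg_pow, h0]
      · have h0 : (Finset.univ.filter fun x => e x = a).card = 0 := by
          rw [Finset.card_eq_zero, Finset.filter_eq_empty_iff]
          intro x _ hx
          exact ha (hx ▸ Finset.mem_image_of_mem e (Finset.mem_univ x))
        simp [signLaw, h0]; ring
    rw [Finset.prod_congr rfl fun a _ => h2 a, Finset.prod_ite]
    simp
  · push Not at h
    obtain ⟨a, ha⟩ := h
    refine Finset.prod_eq_zero (Finset.mem_univ a) ?_
    rw [Nat.not_even_iff_odd] at ha
    rw [sum_signType]
    have h0 : (Finset.univ.filter fun x => e x = a).card ≠ 0 := ha.pos.ne'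
    simp [signLaw, ha.neg_pow, h0]

/-- The real matrix of an array of signs. -/
noncomputable def signMatrix {α β : Type*} (z : α × β → SignType) : Matrix α β ℝ :=
  Matrix.of fun i j => (z (i, j) : ℝ)

end SignLaw

/-! ### The norm of a dense sign matrix -/

section DenseSign

/-- Integer vectors of `ℓ₁` norm at most `3m`. After division by `2√m` they form a `1/4`-net of the
Euclidean unit ball of `ℝᵐ`. -/
noncomputable def intGrid (m : ℕ) : Finset (Fin m → ℤ) :=
  (Fintype.piFinset fun _ => Finset.Icc (-(3 * m : ℤ)) (3 * m)).filter
    fun z => ∑ i, |z i| ≤ 3 * m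

/-- The point of the net given by an integer vector. -/
noncomputable def gridPoint {m : ℕ} (z : Fin m → ℤ) (i : Fin m) : ℝ := z i / (2 * √m)

lemma sum_half_pow_natAbs_le (M : ℕ) :
    ∑ z ∈ Finset.Icc (-(M : ℤ)) M, (1 / 2 : ℝ) ^ z.natAbs ≤ 3 - 2 * (1 / 2) ^ M := by
  induction M with
  | zero => norm_num
  | succ M ih =>
    have h : Finset.Icc (-((M + 1 : ℕ) : ℤ)) ((M + 1 : ℕ) : ℤ)
        = insert (-((M : ℤ) + 1)) (insert ((M : ℤ) + 1) (Finset.Icc (-(M : ℤ)) M)) := by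
      ext x; simp only [Finset.mem_Icc, Finset.mem_insert]; push_cast; omega
    rw [h, Finset.sum_insert, Finset.sum_insert]
    · have h1 : (-((M : ℤ) + 1)).natAbs = M + 1 := by omega
      have h2 : ((M : ℤ) + 1).natAbs = M + 1 := by omega
      rw [h1, h2, pow_succ]
      linarith
    · simp
    · simp; omega

/-- On the grid `2^{3m} 2^{-‖z‖₁} ≥ 1`, and the sum of the left-hand side over all integer vectors
factorizes. -/
lemma card_intGrid_le (m : ℕ) : ((intGrid m).card : ℝ) ≤ 24 ^ m := by
  have h1 : ∀ z ∈ intGrid m, (1 : ℝ) ≤ 2 ^ (3 * m) * ∏ i, (1 / 2 : ℝ) ^ (z i).natAbs := by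
    intro z hz
    have h := (Finset.mem_filter.1 hz).2
    rw [Finset.prod_pow_eq_pow_sum]
    have h2 : ∑ i, (z i).natAbs ≤ 3 * m := by
      zify; exact h
    rw [one_div, inv_pow, ← div_eq_mul_inv, le_div_iff₀ (by positivity), one_mul]
    exact pow_le_pow_right₀ (by norm_num) h2
  calc ((intGrid m).card : ℝ) = ∑ z ∈ intGrid m, (1 : ℝ) := by simp
    _ ≤ ∑ z ∈ intGrid m, 2 ^ (3 * m) * ∏ i, (1 / 2 : ℝ) ^ (z i).natAbs := Finset.sum_le_sum h1
    _ ≤ ∑ z ∈ Fintype.piFinset fun _ : Fin m => Finset.Icc (-(3 * m : ℤ)) (3 * m),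
          2 ^ (3 * m) * ∏ i, (1 / 2 : ℝ) ^ (z i).natAbs :=
        Finset.sum_le_sum_of_subset_of_nonneg (Finset.filter_subset _ _) fun _ _ _ => by positivity
    _ = 2 ^ (3 * m) * ∏ _i : Fin m, ∑ z ∈ Finset.Icc (-(3 * m : ℤ)) (3 * m),
          (1 / 2 : ℝ) ^ z.natAbs := by
        rw [← Finset.mul_sum, Finset.prod_univ_sum]
    _ ≤ 2 ^ (3 * m) * ∏ _i : Fin m, 3 := by
        gcongr with i
        have h3 := sum_half_pow_natAbs_le (3 * m)
        have h4 : (0 : ℝ) < (1 / 2) ^ (3 * m) := by positivity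
        push_cast at h3
        linarith
    _ = 24 ^ m := by
        rw [pow_mul]; simp [← mul_pow]; norm_num

/-- Rounding each coordinate of `2√m u` to the nearest integer gives a near grid point; its `ℓ₁`
norm is at most `3m` because `2√m |u_i| ≤ m u_i² + 1`. -/
lemma exists_gridPoint_near {m : ℕ} (u : Fin m → ℝ) (hu : ∑ i, u i ^ 2 ≤ 1) :
    ∃ z ∈ intGrid m, ∑ i, (gridPoint z i - u i) ^ 2 ≤ 1 / 16 := by
  rcases Nat.eq_zero_or_pos m with rfl | hm
  · exact ⟨fun _ => 0,
      Finset.mem_filter.2 ⟨Fintype.mem_piFinset.2 fun i => i.elim0, by simp⟩, by simp⟩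
  have hm0 : (0 : ℝ) < m := by exact_mod_cast hm
  have hs : 0 < √(m : ℝ) := Real.sqrt_pos.2 hm0
  have hs2 : √(m : ℝ) ^ 2 = m := Real.sq_sqrt hm0.le
  have hr : ∀ i, |2 * √m * u i - (round (2 * √m * u i) : ℝ)| ≤ 1 / 2 := fun i => abs_sub_round _
  refine ⟨fun i => round (2 * √m * u i), ?_, ?_⟩
  · have hsum : ∑ i, |round (2 * √m * u i)| ≤ 3 * (m : ℤ) := by
      have h1 : ∀ i, ((|round (2 * √m * u i)| : ℤ) : ℝ) ≤ m * u i ^ 2 + 3 / 2 := by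
        intro i
        rw [Int.cast_abs]
        have h2 : |(round (2 * √m * u i) : ℝ)| ≤ |2 * √m * u i| + 1 / 2 := by
          have := abs_sub_abs_le_abs_sub (round (2 * √m * u i) : ℝ) (2 * √m * u i)
          rw [abs_sub_comm] at this
          linarith [hr i]
        have h3 : |2 * √m * u i| ≤ m * u i ^ 2 + 1 := by
          have h5 : (m : ℝ) * u i ^ 2 = (√m * u i) ^ 2 := by rw [mul_pow, hs2]
          rw [abs_le, h5]
          constructor <;> nlinarith [sq_nonneg (√m * u i - 1), sq_nonneg (√m * u i + 1)]
        linarith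
      have h4 : ((∑ i, |round (2 * √m * u i)| : ℤ) : ℝ) ≤ 3 * m := by
        rw [Int.cast_sum]
        refine (Finset.sum_le_sum fun i _ => h1 i).trans ?_
        rw [Finset.sum_add_distrib, ← Finset.mul_sum]
        simp only [Finset.sum_const, Finset.card_univ, Fintype.card_fin, nsmul_eq_mul]
        nlinarith
      exact_mod_cast h4
    refine Finset.mem_filter.2 ⟨Fintype.mem_piFinset.2 fun i => ?_, hsum⟩
    have := Finset.single_le_sum (f := fun i => |round (2 * √m * u i)|)
      (fun i _ => abs_nonneg _) (Finset.mem_univ i)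
    exact Finset.mem_Icc.2 (abs_le.1 (this.trans hsum))
  · have h1 : ∀ i, (gridPoint (fun i => round (2 * √m * u i)) i - u i) ^ 2 ≤ 1 / (16 * m) := by
      intro i
      have e : gridPoint (fun i => round (2 * √m * u i)) i - u i
          = -(2 * √m * u i - round (2 * √m * u i)) / (2 * √m) := by
        unfold gridPoint; field_simp; ring
      rw [e, div_pow, neg_sq, mul_pow, hs2, div_le_div_iff₀ (by positivity) (by positivity)]
      have := sq_le_sq' (by linarith [(abs_le.1 (hr i)).1]) (abs_le.1 (hr i)).2
      nlinarith
    refine (Finset.sum_le_sum fun i _ => h1 i).trans (le_of_eq ?_)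
    simp; field_simp

lemma sqrt_sum_sq_add_le {ι : Type*} [Fintype ι] (u v : ι → ℝ) :
    √(∑ i, (u i + v i) ^ 2) ≤ √(∑ i, u i ^ 2) + √(∑ i, v i ^ 2) := by
  have := norm_add_le (WithLp.toLp 2 u : EuclideanSpace ℝ ι) (WithLp.toLp 2 v)
  simpa [EuclideanSpace.norm_eq] using this

lemma sum_gridPoint_sq_le {m : ℕ} {u : Fin m → ℝ} {z : Fin m → ℤ} (hu : ∑ i, u i ^ 2 ≤ 1)
    (hz : ∑ i, (gridPoint z i - u i) ^ 2 ≤ 1 / 16) : √(∑ i, gridPoint z i ^ 2) ≤ 5 / 4 := by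
  have h := sqrt_sum_sq_add_le (fun i => gridPoint z i - u i) u
  simp only [sub_add_cancel] at h
  have h1 : √(∑ i, (gridPoint z i - u i) ^ 2) ≤ 1 / 4 := by
    rw [Real.sqrt_le_iff]; norm_num; norm_num at hz; exact hz
  have h2 : √(∑ i, u i ^ 2) ≤ 1 := Real.sqrt_le_one.2 hu
  linarith

/-- The pairs of net points detect the spectral norm up to a factor `3`. -/
lemma exists_gridPoint_specNorm_le {m : ℕ} (Y : Matrix (Fin m) (Fin m) ℝ) :
    ∃ x ∈ intGrid m, ∃ y ∈ intGrid m, √(∑ i, gridPoint x i ^ 2) ≤ 5 / 4 ∧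
      √(∑ i, gridPoint y i ^ 2) ≤ 5 / 4 ∧
      specNorm Y ≤ 3 * (gridPoint x ⬝ᵥ Y.mulVec (gridPoint y)) := by
  set N := specNorm Y with hN
  have hN0 : 0 ≤ N := specNorm_nonneg Y
  obtain ⟨u, v, hu, hv, huv⟩ : ∃ u v : Fin m → ℝ, ∑ i, u i ^ 2 ≤ 1 ∧ ∑ i, v i ^ 2 ≤ 1 ∧
      15 / 16 * N ≤ u ⬝ᵥ Y.mulVec v := by
    rcases hN0.eq_or_lt with h0 | h0
    · exact ⟨0, 0, by simp, by simp, by simp [← h0]⟩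
    · obtain ⟨u, v, hu, hv, h⟩ := exists_unit_bilin (A := Y) (t := 15 / 16 * N) (by positivity)
        (by linarith)
      exact ⟨u, v, hu, hv, h.le⟩
  obtain ⟨x, hx, hxu⟩ := exists_gridPoint_near u hu
  obtain ⟨y, hy, hyv⟩ := exists_gridPoint_near v hv
  refine ⟨x, hx, y, hy, sum_gridPoint_sq_le hu hxu, sum_gridPoint_sq_le hv hyv, ?_⟩
  have h14 : ∀ w : Fin m → ℝ, ∑ i, w i ^ 2 ≤ 1 / 16 → √(∑ i, w i ^ 2) ≤ 1 / 4 := fun w hw => by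
    rw [Real.sqrt_le_iff]; norm_num; norm_num at hw; exact hw
  have e : u ⬝ᵥ Y.mulVec v = gridPoint x ⬝ᵥ Y.mulVec (gridPoint y)
      + (u - gridPoint x) ⬝ᵥ Y.mulVec v + gridPoint x ⬝ᵥ Y.mulVec (v - gridPoint y) := by
    rw [Matrix.mulVec_sub, dotProduct_sub, sub_dotProduct]; ring
  have b1 : (u - gridPoint x) ⬝ᵥ Y.mulVec v ≤ N * (1 / 4 * 1) := by
    refine (dotProduct_mulVec_le Y _ _).trans ?_
    refine mul_le_mul_of_nonneg_left ?_ hN0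
    refine mul_le_mul (h14 _ ?_) (Real.sqrt_le_one.2 hv) (Real.sqrt_nonneg _) (by norm_num)
    refine le_trans (le_of_eq ?_) hxu
    exact Finset.sum_congr rfl fun i _ => by simp only [Pi.sub_apply]; ring
  have b2 : gridPoint x ⬝ᵥ Y.mulVec (v - gridPoint y) ≤ N * (5 / 4 * (1 / 4)) := by
    refine (dotProduct_mulVec_le Y _ _).trans ?_
    refine mul_le_mul_of_nonneg_left ?_ hN0
    refine mul_le_mul (sum_gridPoint_sq_le hu hxu) (h14 _ ?_) (Real.sqrt_nonneg _) (by norm_num)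
    refine le_trans (le_of_eq ?_) hyv
    exact Finset.sum_congr rfl fun i _ => by simp only [Pi.sub_apply]; ring
  linarith

/-- Sub-Gaussian moments of a Rademacher sum. -/
lemma signExp_one_pow_le {E : Type*} [Fintype E] [DecidableEq E] (a : E → ℝ) {V : ℝ}
    (hV : ∑ e, a e ^ 2 ≤ V) {K : ℕ} (hK : 0 < K) :
    signExp 1 (fun z => (∑ e, (z e : ℝ) * a e) ^ (2 * K))
      ≤ 2 * (2 * K) ^ K * Real.exp (K * V) := by
  set θ : ℝ := √(2 * K) with hθ
  have hK0 : (0 : ℝ) < K := by exact_mod_cast hK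
  have hθ2 : θ ^ 2 = 2 * K := Real.sq_sqrt (by positivity)
  have hmgf : ∀ b : ℝ, b ^ 2 = 2 * K →
      signExp 1 (fun z => Real.exp (b * ∑ e, (z e : ℝ) * a e)) ≤ Real.exp (K * V) := by
    intro b hb
    have h1 : ∀ z : E → SignType, Real.exp (b * ∑ e, (z e : ℝ) * a e)
        = ∏ e, Real.exp (b * ((z e : ℝ) * a e)) := fun z => by
      rw [Finset.mul_sum, Real.exp_sum]
    simp_rw [h1]
    rw [signExp_prod 1 fun e s => Real.exp (b * ((s : ℝ) * a e))]
    calc _ ≤ ∏ e, Real.exp ((b * a e) ^ 2 / 2) := by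
          refine Finset.prod_le_prod (fun e _ => Finset.sum_nonneg fun s _ =>
            mul_nonneg (signLaw_nonneg zero_le_one le_rfl s) (Real.exp_nonneg _)) fun e _ => ?_
          refine le_trans (le_of_eq ?_) (Real.cosh_le_exp_half_sq _)
          rw [sum_signType, Real.cosh_eq]
          simp [signLaw]; ring
      _ = Real.exp (K * ∑ e, a e ^ 2) := by
          rw [← Real.exp_sum]; congr 1
          rw [Finset.mul_sum]
          exact Finset.sum_congr rfl fun e _ => by rw [mul_pow, hb]; ring
      _ ≤ _ := by gcongr
  have hpow : ∀ S : ℝ, S ^ (2 * K) ≤ (2 * K) ^ K * (Real.exp (θ * S) + Real.exp (-θ * S)) := by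
    intro S
    have h1 : |θ * S| ^ (2 * K) / (2 * K).factorial ≤ Real.exp |θ * S| :=
      Real.pow_div_factorial_le_exp _ (abs_nonneg _) _
    have h2 : Real.exp |θ * S| ≤ Real.exp (θ * S) + Real.exp (-θ * S) := by
      rcases abs_choice (θ * S) with h | h <;> rw [h]
      · linarith [Real.exp_pos (-θ * S)]
      · rw [neg_mul]; linarith [Real.exp_pos (θ * S)]
    have h3 : ((2 * K).factorial : ℝ) ≤ (2 * K) ^ (2 * K) := by
      exact_mod_cast Nat.factorial_le_pow (2 * K)
    rw [div_le_iff₀ (by positivity), (even_two_mul K).pow_abs, mul_pow, pow_mul, hθ2] at h1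
    have h4 : (2 * (K : ℝ)) ^ (2 * K) = (2 * K) ^ K * (2 * K) ^ K := by rw [two_mul K, pow_add]
    have h5 : (0 : ℝ) < (2 * K) ^ K := by positivity
    refine le_of_mul_le_mul_left ?_ h5
    calc (2 * (K : ℝ)) ^ K * S ^ (2 * K) ≤ Real.exp |θ * S| * (2 * K).factorial := h1
      _ ≤ (Real.exp (θ * S) + Real.exp (-θ * S)) * (2 * K) ^ (2 * K) := by gcongr
      _ = _ := by rw [h4]; ring
  calc _ ≤ signExp 1 (fun z : E → SignType => (2 * K : ℝ) ^ K *
            (Real.exp (θ * ∑ e, (z e : ℝ) * a e) + Real.exp (-θ * ∑ e, (z e : ℝ) * a e))) :=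
        signExp_mono zero_le_one le_rfl fun z => hpow _
    _ ≤ (2 * K : ℝ) ^ K * (Real.exp (K * V) + Real.exp (K * V)) := by
        rw [signExp_const_mul, signExp_add]
        gcongr
        · exact hmgf θ hθ2
        · exact hmgf (-θ) (by rw [neg_sq, hθ2])
    _ = _ := by ring

/-- The moment of order `2K` of the norm of a dense sign matrix of side `2K`: the norm is detected
on a net of exponential size, and at each pair of net points the bilinear form is a Rademacher sum.
-/
lemma signExp_specNorm_pow_le {K : ℕ} (hK : 0 < K) :
    signExp 1 (fun z : Fin (2 * K) × Fin (2 * K) → SignType => specNorm (signMatrix z) ^ (2 * K))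
      ≤ (1e9 * K) ^ K := by
  set N := (intGrid (2 * K) ×ˢ intGrid (2 * K)).filter fun w =>
    √(∑ i, gridPoint w.1 i ^ 2) ≤ 5 / 4 ∧ √(∑ i, gridPoint w.2 i ^ 2) ≤ 5 / 4 with hN
  have hK0 : (0 : ℝ) < K := by exact_mod_cast hK
  have hbil : ∀ (z : Fin (2 * K) × Fin (2 * K) → SignType) (x y : Fin (2 * K) → ℝ),
      x ⬝ᵥ (signMatrix z).mulVec y = ∑ e, (z e : ℝ) * (x e.1 * y e.2) := fun z x y => by
    rw [Fintype.sum_prod_type]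
    simp only [dotProduct, Matrix.mulVec, Finset.mul_sum, signMatrix, Matrix.of_apply]
    exact Finset.sum_congr rfl fun i _ => Finset.sum_congr rfl fun j _ => by ring
  have h1 : ∀ z : Fin (2 * K) × Fin (2 * K) → SignType, specNorm (signMatrix z) ^ (2 * K)
      ≤ ∑ w ∈ N, 9 ^ K * (∑ e, (z e : ℝ) * (gridPoint w.1 e.1 * gridPoint w.2 e.2)) ^ (2 * K) := by
    intro z
    obtain ⟨x, hx, y, hy, hx1, hy1, h⟩ := exists_gridPoint_specNorm_le (signMatrix z)
    have hmem : (x, y) ∈ N := Finset.mem_filter.2 ⟨Finset.mem_product.2 ⟨hx, hy⟩, hx1, hy1⟩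
    refine le_trans ?_ (Finset.single_le_sum (f := fun w : (Fin (2 * K) → ℤ) × (Fin (2 * K) → ℤ) =>
      (9 : ℝ) ^ K * (∑ e, (z e : ℝ) * (gridPoint w.1 e.1 * gridPoint w.2 e.2)) ^ (2 * K))
      (fun w _ => mul_nonneg (by positivity) ((even_two_mul K).pow_nonneg _)) hmem)
    rw [← hbil]
    refine (pow_le_pow_left₀ (specNorm_nonneg _) h _).trans (le_of_eq ?_)
    rw [mul_pow, pow_mul 3]; norm_num
  refine (signExp_mono zero_le_one le_rfl h1).trans ?_
  rw [signExp_sum]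
  have h2 : ∀ w ∈ N, signExp 1 (fun z : Fin (2 * K) × Fin (2 * K) → SignType => 9 ^ K *
      (∑ e, (z e : ℝ) * (gridPoint w.1 e.1 * gridPoint w.2 e.2)) ^ (2 * K))
      ≤ 9 ^ K * (2 * (2 * K) ^ K * Real.exp (K * (5 / 2))) := by
    intro w hw
    obtain ⟨-, hx, hy⟩ := Finset.mem_filter.1 hw
    rw [signExp_const_mul]
    refine mul_le_mul_of_nonneg_left (signExp_one_pow_le _ ?_ hK) (by positivity)
    rw [Fintype.sum_prod_type]
    have e : ∑ i, ∑ j, (gridPoint w.1 i * gridPoint w.2 j) ^ 2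
        = (∑ i, gridPoint w.1 i ^ 2) * ∑ j, gridPoint w.2 j ^ 2 := by
      rw [Finset.sum_mul_sum]
      simp only [mul_pow]
    rw [e]
    rw [Real.sqrt_le_left (by norm_num)] at hx hy
    calc _ ≤ ((5 / 4 : ℝ) ^ 2) * (5 / 4) ^ 2 :=
          mul_le_mul hx hy (Finset.sum_nonneg fun _ _ => sq_nonneg _) (by norm_num)
      _ ≤ _ := by norm_num
  refine (Finset.sum_le_sum h2).trans ?_
  rw [Finset.sum_const, nsmul_eq_mul]
  have hcard : (N.card : ℝ) ≤ 331776 ^ K := by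
    have h3 : (N.card : ℝ) ≤ (24 ^ (2 * K)) * 24 ^ (2 * K) := by
      calc (N.card : ℝ) ≤ ((intGrid (2 * K) ×ˢ intGrid (2 * K)).card : ℝ) := by
            exact_mod_cast Finset.card_filter_le _ _
        _ ≤ _ := by
            rw [Finset.card_product]; push_cast
            exact mul_le_mul (card_intGrid_le _) (card_intGrid_le _) (by positivity) (by positivity)
    refine h3.trans (le_of_eq ?_)
    rw [← mul_pow, pow_mul]; norm_num
  have hexp : Real.exp (K * (5 / 2)) ≤ 27 ^ K := by
    rw [Real.exp_nat_mul]
    refine pow_le_pow_left₀ (Real.exp_nonneg _) ?_ _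
    calc Real.exp (5 / 2) ≤ Real.exp 3 := Real.exp_le_exp.2 (by norm_num)
      _ = Real.exp 1 ^ 3 := by rw [← Real.exp_nat_mul]; norm_num
      _ ≤ 3 ^ 3 := by
          gcongr
          exact Real.exp_one_lt_d9.le.trans (by norm_num)
      _ = 27 := by norm_num
  have h2K : (2 : ℝ) ≤ 2 ^ K := by
    calc (2 : ℝ) = 2 ^ 1 := by norm_num
      _ ≤ 2 ^ K := pow_le_pow_right₀ (by norm_num) hK
  calc (N.card : ℝ) * (9 ^ K * (2 * (2 * K) ^ K * Real.exp (K * (5 / 2))))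
      ≤ 331776 ^ K * (9 ^ K * (2 ^ K * (2 * K) ^ K * 27 ^ K)) := by gcongr
    _ = (331776 * 9 * 2 * 2 * 27 * K) ^ K := by simp only [mul_pow]; ring
    _ ≤ (1e9 * K) ^ K := by gcongr; norm_num

/-- Weighted count of even closed walks of length `2(k+1)`, in the regime where the walk is at least
as long as the expected number of edges at a vertex. The unweighted count in the complete bipartite
graph of side `2(k+1)` is the expected trace of a power of a dense sign matrix. -/
lemma sum_evenWalk_le_pow {α β : Type*} [Fintype α] [DecidableEq α] [Fintype β] [DecidableEq β]
    {k : ℕ} {q : ℝ} (hq : 0 < q) (hq1 : q ≤ 1)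
    (hα : Fintype.card α * q ≤ k + 1) (hβ : Fintype.card β * q ≤ k + 1) :
    ∑ i : Fin (k + 1) → α, ∑ j : Fin (k + 1) → β,
        (if EvenWalk i j then q ^ (Finset.univ.image (walkEdge i j)).card else 0)
      ≤ q⁻¹ * (4e9 * (k + 1)) ^ (k + 1) := by
  have h := sum_evenWalk_le (α := α) (β := β) (k := k) (m := 2 * (k + 1)) hq hq1 (by omega)
    (by push_cast; linarith) (by push_cast; linarith)
  refine h.trans ?_
  refine mul_le_mul_of_nonneg_left ?_ (inv_nonneg.2 hq.le)
  have e : ∑ i : Fin (k + 1) → Fin (2 * (k + 1)), ∑ j : Fin (k + 1) → Fin (2 * (k + 1)),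
        (if EvenWalk i j then (1 : ℝ) else 0)
      = signExp 1 (fun z : Fin (2 * (k + 1)) × Fin (2 * (k + 1)) → SignType =>
          ((signMatrix z * (signMatrix z).transpose) ^ (k + 1)).trace) := by
    simp_rw [trace_mul_transpose_pow_succ]
    rw [signExp_sum]
    refine Finset.sum_congr rfl fun i _ => ?_
    rw [signExp_sum]
    refine Finset.sum_congr rfl fun j _ => ?_
    have := signExp_monomial 1 (walkEdge i j)
    simp only [one_pow] at this
    exact this.symm
  rw [e]
  have h2 : ∀ z : Fin (2 * (k + 1)) × Fin (2 * (k + 1)) → SignType,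
      ((signMatrix z * (signMatrix z).transpose) ^ (k + 1)).trace
        ≤ (2 * (k + 1) : ℝ) * specNorm (signMatrix z) ^ (2 * (k + 1)) := fun z => by
    have := trace_pow_le_specNorm (signMatrix z) k
    simpa using this
  refine (signExp_mono zero_le_one le_rfl h2).trans ?_
  rw [signExp_const_mul]
  have h3 := signExp_specNorm_pow_le (Nat.succ_pos k)
  have h4 : (2 * (k + 1) : ℝ) ≤ 4 ^ (k + 1) := by
    have := one_add_mul_le_pow (a := (3 : ℝ)) (by norm_num) (k + 1)
    push_cast at this
    norm_num at this
    linarith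
  calc _ ≤ (4 : ℝ) ^ (k + 1) * (1e9 * ((k + 1 : ℕ) : ℝ)) ^ (k + 1) := by
        refine mul_le_mul h4 h3 ?_ (by positivity)
        exact Finset.sum_nonneg fun z _ => mul_nonneg
          (Finset.prod_nonneg fun _ _ => signLaw_nonneg zero_le_one le_rfl _)
          (pow_nonneg (specNorm_nonneg _) _)
    _ = _ := by rw [← mul_pow]; push_cast; congr 1; ring

end DenseSign

/-! ### Symmetrization and contraction for Bernoulli processes -/

section Contraction

/-- The Bernoulli weights with success probability `q`. -/
noncomputable def bernWeight (q : ℝ) (b : Bool) : ℝ := if b then q else 1 - q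

/-- The centred value of a Bernoulli variable. -/
noncomputable def bernVal (q : ℝ) (b : Bool) : ℝ := (if b then 1 else 0) - q

variable {T : Type*} [Nonempty T] {Φ : ℝ → ℝ}

lemma bddAbove_add_mul {c t : T → ℝ} {M : ℝ} (hc : ∀ τ, |c τ| ≤ M) (ht : ∀ τ, |t τ| ≤ M)
    (x : ℝ) : BddAbove (Set.range fun τ => c τ + x * t τ) := by
  refine ⟨M + |x| * M, ?_⟩
  rintro _ ⟨τ, rfl⟩
  have h1 := (le_abs_self _).trans (hc τ)
  have h2 : x * t τ ≤ |x| * M := (le_abs_self _).trans (by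
    rw [abs_mul]; exact mul_le_mul_of_nonneg_left (ht τ) (abs_nonneg _))
  simp only; linarith

/-- Contraction for one sign: `t ↦ |t|` may be replaced by `t`. -/
lemma contraction_step (hΦ : Monotone Φ) {c t : T → ℝ} {M : ℝ} (hc : ∀ τ, |c τ| ≤ M)
    (ht : ∀ τ, |t τ| ≤ M) (hcont : Continuous Φ) :
    Φ (⨆ τ, c τ + 1 * |t τ|) + Φ (⨆ τ, c τ + (-1) * |t τ|)
      ≤ Φ (⨆ τ, c τ + 1 * t τ) + Φ (⨆ τ, c τ + (-1) * t τ) := by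
  have hp := bddAbove_add_mul hc ht 1
  have hm := bddAbove_add_mul hc ht (-1)
  have key : ∀ τ₁ τ₂, Φ (c τ₁ + 1 * |t τ₁|) + Φ (c τ₂ + (-1) * |t τ₂|)
      ≤ Φ (⨆ τ, c τ + 1 * t τ) + Φ (⨆ τ, c τ + (-1) * t τ) := by
    intro τ₁ τ₂
    rcases le_total 0 (t τ₁) with h | h
    · refine add_le_add (hΦ ?_) (hΦ ?_)
      · rw [abs_of_nonneg h]; exact le_ciSup hp τ₁
      · refine le_trans ?_ (le_ciSup hm τ₂)
        have := le_abs_self (t τ₂)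
        linarith
    · rw [add_comm (Φ (⨆ τ, c τ + 1 * t τ))]
      refine add_le_add (hΦ ?_) (hΦ ?_)
      · rw [abs_of_nonpos h]
        refine le_trans (le_of_eq ?_) (le_ciSup hm τ₁)
        simp
      · refine le_trans ?_ (le_ciSup hp τ₂)
        have := neg_abs_le (t τ₂)
        linarith
  have habs : ∀ τ, |(fun τ => |t τ|) τ| ≤ M := fun τ => by simpa using ht τ
  -- pass to the suprema one after the other
  have hsup : ∀ (f : T → ℝ), BddAbove (Set.range f) → ∀ B, (∀ τ, Φ (f τ) ≤ B) →
      Φ (⨆ τ, f τ) ≤ B := by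
    intro f hf B hB
    rw [hΦ.map_ciSup_of_continuousAt hcont.continuousAt hf]
    exact ciSup_le hB
  have h1 : ∀ τ₂, Φ (⨆ τ, c τ + 1 * |t τ|) ≤ Φ (⨆ τ, c τ + 1 * t τ)
      + Φ (⨆ τ, c τ + (-1) * t τ) - Φ (c τ₂ + (-1) * |t τ₂|) := fun τ₂ =>
    hsup _ (bddAbove_add_mul hc habs 1) _ fun τ₁ => by linarith [key τ₁ τ₂]
  have h2 := hsup _ (bddAbove_add_mul hc habs (-1)) (Φ (⨆ τ, c τ + 1 * t τ)
      + Φ (⨆ τ, c τ + (-1) * t τ) - Φ (⨆ τ, c τ + 1 * |t τ|)) fun τ₂ => by linarith [h1 τ₂]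
  linarith

lemma ciSup_convex {c t : T → ℝ} {M : ℝ} (hc : ∀ τ, |c τ| ≤ M) (ht : ∀ τ, |t τ| ≤ M)
    {a b x y : ℝ} (ha : 0 ≤ a) (hb : 0 ≤ b) (hab : a + b = 1) :
    (⨆ τ, c τ + (a * x + b * y) * t τ)
      ≤ a * (⨆ τ, c τ + x * t τ) + b * (⨆ τ, c τ + y * t τ) := by
  refine ciSup_le fun τ => ?_
  have h1 := le_ciSup (bddAbove_add_mul hc ht x) τ
  have h2 := le_ciSup (bddAbove_add_mul hc ht y) τ
  have h3 := mul_le_mul_of_nonneg_left h1 ha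
  have h4 := mul_le_mul_of_nonneg_left h2 hb
  have e : c τ + (a * x + b * y) * t τ = a * (c τ + x * t τ) + b * (c τ + y * t τ) := by
    linear_combination (-c τ) * hab
  rw [e]; exact add_le_add h3 h4

/-- Replacement of one centred Bernoulli variable multiplying `|t|` by a sparse sign multiplying
`t`: symmetrization against an independent copy, then contraction. -/
lemma bern_le_sign_step (hΦ : Monotone Φ) (hconv : ConvexOn ℝ Set.univ Φ) (hcont : Continuous Φ)
    {c t : T → ℝ} {M : ℝ} (hc : ∀ τ, |c τ| ≤ M) (ht : ∀ τ, |t τ| ≤ M) {q : ℝ} (h0 : 0 ≤ q)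
    (h1 : q ≤ 1) :
    ∑ b, bernWeight q b * Φ (⨆ τ, c τ + bernVal q b * |t τ|)
      ≤ ∑ s, signLaw (2 * q * (1 - q)) s * Φ (⨆ τ, c τ + (s : ℝ) * t τ) := by
  have habs : ∀ τ, |(fun τ => |t τ|) τ| ≤ M := fun τ => by simpa using ht τ
  have hF : ∀ {a b x y : ℝ}, 0 ≤ a → 0 ≤ b → a + b = 1 →
      Φ (⨆ τ, c τ + (a * x + b * y) * |t τ|)
        ≤ a * Φ (⨆ τ, c τ + x * |t τ|) + b * Φ (⨆ τ, c τ + y * |t τ|) := by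
    intro a b x y ha hb hab
    exact (hΦ (ciSup_convex hc habs ha hb hab)).trans
      (hconv.2 (Set.mem_univ _) (Set.mem_univ _) ha hb hab)
  have e1 : Φ (⨆ τ, c τ + bernVal q true * |t τ|)
      ≤ q * Φ (⨆ τ, c τ) + (1 - q) * Φ (⨆ τ, c τ + 1 * |t τ|) := by
    have := hF (x := 0) (y := 1) h0 (sub_nonneg.2 h1) (by ring)
    rw [show q * 0 + (1 - q) * 1 = bernVal q true by simp [bernVal]] at this
    simpa only [zero_mul, add_zero] using this
  have e2 : Φ (⨆ τ, c τ + bernVal q false * |t τ|)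
      ≤ (1 - q) * Φ (⨆ τ, c τ) + q * Φ (⨆ τ, c τ + (-1) * |t τ|) := by
    have := hF (x := 0) (y := -1) (sub_nonneg.2 h1) h0 (by ring)
    rw [show (1 - q) * 0 + q * -1 = bernVal q false by simp [bernVal]] at this
    simpa only [zero_mul, add_zero] using this
  have e3 := contraction_step hΦ hc ht hcont
  have e1' := mul_le_mul_of_nonneg_left e1 h0
  have e2' := mul_le_mul_of_nonneg_left e2 (sub_nonneg.2 h1)
  have e3' := mul_le_mul_of_nonneg_left e3 (mul_nonneg h0 (sub_nonneg.2 h1))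
  have d1 : ((-1 : SignType) = 0) = False := by decide
  have d2 : ((1 : SignType) = 0) = False := by decide
  rw [Fintype.sum_bool, sum_signType]
  simp only [bernWeight, signLaw, if_true, Bool.false_eq_true, if_false, d1, d2,
    SignType.coe_zero, SignType.coe_neg, SignType.coe_one, zero_mul, add_zero]
  linarith

/-- Comparison of the supremum of a centred Bernoulli process indexed by `|t|` with the sign process
indexed by `t`, obtained by replacing the coordinates one at a time. -/
lemma bern_le_sign_fin (hΦ : Monotone Φ) (hconv : ConvexOn ℝ Set.univ Φ) (hcont : Continuous Φ)
    {q : ℝ} (h0 : 0 ≤ q) (h1 : q ≤ 1) {N : ℕ} :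
    ∀ {c : T → ℝ} {t : T → Fin N → ℝ} {M : ℝ}, (∀ τ, |c τ| ≤ M) → (∀ τ i, |t τ i| ≤ M) →
    ∑ z : Fin N → Bool, (∏ i, bernWeight q (z i)) * Φ (⨆ τ, c τ + ∑ i, bernVal q (z i) * |t τ i|)
      ≤ signExp (2 * q * (1 - q)) fun z : Fin N → SignType =>
          Φ (⨆ τ, c τ + ∑ i, (z i : ℝ) * t τ i) := by
  have hθ0 : 0 ≤ 2 * q * (1 - q) := mul_nonneg (by linarith) (by linarith)
  have hθ1 : 2 * q * (1 - q) ≤ 1 := by nlinarith [sq_nonneg (2 * q - 1)]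
  have hw : ∀ b, 0 ≤ bernWeight q b := fun b => by
    unfold bernWeight; split_ifs <;> linarith
  induction N with
  | zero =>
    intro c t M hc ht
    simp [signExp]
  | succ N ih =>
    intro c t M hc ht
    have hM : ∀ τ, 0 ≤ M := fun τ => (abs_nonneg _).trans (hc τ)
    have hv : ∀ b, |bernVal q b| ≤ 1 := fun b => by
      unfold bernVal; rw [abs_le]; split_ifs <;> constructor <;> linarith
    have hs : ∀ s : SignType, |(s : ℝ)| ≤ 1 := fun s => by cases s <;> simp
    calc _ = ∑ b, bernWeight q b * ∑ z : Fin N → Bool, (∏ i, bernWeight q (z i)) *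
          Φ (⨆ τ, (c τ + bernVal q b * |t τ 0|) + ∑ i, bernVal q (z i) * |t τ i.succ|) := by
          rw [← (Fin.consEquiv fun _ : Fin (N + 1) => Bool).sum_comp, Fintype.sum_prod_type]
          refine Finset.sum_congr rfl fun b _ => ?_
          rw [Finset.mul_sum]
          refine Finset.sum_congr rfl fun z _ => ?_
          simp [Fin.prod_univ_succ, Fin.sum_univ_succ, mul_assoc, add_assoc]
      _ ≤ ∑ b, bernWeight q b * signExp (2 * q * (1 - q)) fun z : Fin N → SignType =>
          Φ (⨆ τ, (c τ + bernVal q b * |t τ 0|) + ∑ i, (z i : ℝ) * t τ i.succ) := by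
          refine Finset.sum_le_sum fun b _ => mul_le_mul_of_nonneg_left
            (ih (M := M + M) (fun τ => ?_) fun τ i => ?_) (hw b)
          · refine (abs_add_le _ _).trans (add_le_add (hc τ) ?_)
            rw [abs_mul, abs_abs]
            exact (mul_le_of_le_one_left (abs_nonneg _) (hv b)).trans (ht τ 0)
          · linarith [ht τ i.succ, hM τ]
      _ = signExp (2 * q * (1 - q)) fun z : Fin N → SignType => ∑ b, bernWeight q b *
          Φ (⨆ τ, (c τ + ∑ i, (z i : ℝ) * t τ i.succ) + bernVal q b * |t τ 0|) := by
          rw [signExp_sum]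
          refine Finset.sum_congr rfl fun b _ => ?_
          rw [signExp_const_mul]
          simp only [add_right_comm]
      _ ≤ signExp (2 * q * (1 - q)) fun z : Fin N → SignType =>
          ∑ s, signLaw (2 * q * (1 - q)) s *
          Φ (⨆ τ, (c τ + ∑ i, (z i : ℝ) * t τ i.succ) + (s : ℝ) * t τ 0) := by
          refine signExp_mono hθ0 hθ1 fun z => ?_
          refine bern_le_sign_step (M := M + N * M) hΦ hconv hcont (fun τ => ?_) (fun τ => ?_) h0 h1
          · refine (abs_add_le _ _).trans (add_le_add (hc τ) ?_)
            refine (Finset.abs_sum_le_sum_abs _ _).trans ?_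
            refine (Finset.sum_le_sum (g := fun _ => M) fun i _ => ?_).trans (by simp)
            rw [abs_mul]
            exact (mul_le_of_le_one_left (abs_nonneg _) (hs _)).trans (ht τ i.succ)
          · have : 0 ≤ N * M := mul_nonneg (Nat.cast_nonneg _) (hM τ)
            linarith [ht τ 0]
      _ = _ := by
          rw [signExp_sum]
          unfold signExp
          rw [← (Fin.consEquiv fun _ : Fin (N + 1) => SignType).sum_comp, Fintype.sum_prod_type]
          refine Finset.sum_congr rfl fun s _ => ?_
          refine Finset.sum_congr rfl fun z _ => ?_
          simp only [Fin.consEquiv_apply, Fin.prod_univ_succ, Fin.sum_univ_succ, Fin.cons_zero,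
            Fin.cons_succ]
          rw [← mul_assoc, mul_comm (∏ i, signLaw _ (z i))]
          congr 3
          funext τ
          ring

lemma bern_le_sign {E : Type*} [Fintype E] [DecidableEq E] (hΦ : Monotone Φ)
    (hconv : ConvexOn ℝ Set.univ Φ) (hcont : Continuous Φ) {q : ℝ} (h0 : 0 ≤ q) (h1 : q ≤ 1)
    {t : T → E → ℝ} {M : ℝ} (ht : ∀ τ i, |t τ i| ≤ M) (hM : 0 ≤ M) :
    ∑ z : E → Bool, (∏ i, bernWeight q (z i)) * Φ (⨆ τ, ∑ i, bernVal q (z i) * |t τ i|)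
      ≤ signExp (2 * q * (1 - q)) fun z : E → SignType => Φ (⨆ τ, ∑ i, (z i : ℝ) * t τ i) := by
  have h := bern_le_sign_fin hΦ hconv hcont h0 h1 (c := fun _ : T => 0)
    (t := fun τ i => t τ ((Fintype.equivFin E).symm i)) (M := M) (by simpa using hM)
    (fun τ i => ht τ _)
  simp only [zero_add] at h
  unfold signExp at h ⊢
  rw [← ((Fintype.equivFin E).arrowCongr (Equiv.refl Bool)).sum_comp,
    ← ((Fintype.equivFin E).arrowCongr (Equiv.refl SignType)).sum_comp] at h
  simp only [Equiv.arrowCongr_apply, Equiv.coe_refl, Function.comp_apply, id_eq] at h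
  have r1 : ∀ f : E → ℝ, ∏ i, f ((Fintype.equivFin E).symm i) = ∏ i, f i := fun f =>
    (Fintype.equivFin E).symm.prod_comp f
  have r2 : ∀ f : E → ℝ, ∑ i, f ((Fintype.equivFin E).symm i) = ∑ i, f i := fun f =>
    (Fintype.equivFin E).symm.sum_comp f
  convert h using 4 with z _ z _
  · exact (r1 fun i => bernWeight q (z i)).symm
  · congr 1; funext τ; exact (r2 fun i => bernVal q (z i) * |t τ i|).symm
  · exact (r1 fun i => signLaw _ (z i)).symm
  · congr 1; funext τ; exact (r2 fun i => (z i : ℝ) * t τ i).symm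

end Contraction

/-! ### The weighted outlier pattern against low-rank matrices -/

section LowRank

variable {n r : ℕ}

/-- Pairs of matrices in the Frobenius unit ball. -/
def FrobBall (n r : ℕ) : Type :=
  {w : Matrix (Fin n) (Fin r) ℝ × Matrix (Fin n) (Fin r) ℝ // frobNorm w.1 ≤ 1 ∧ frobNorm w.2 ≤ 1}

lemma frobNorm_zero {m k : Type*} [Fintype m] [Fintype k] : frobNorm (0 : Matrix m k ℝ) = 0 := by
  simp [frobNorm]

instance : Nonempty (FrobBall n r) := ⟨⟨(0, 0), by simp [frobNorm_zero]⟩⟩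

/-- The entry `⟨P_i, Q_j⟩` of `P Qᵀ`. -/
def FrobBall.entry (τ : FrobBall n r) (e : Fin n × Fin n) : ℝ :=
  ∑ x, τ.1.1 e.1 x * τ.1.2 e.2 x

lemma sqrt_row_le_frobNorm {m k : Type*} [Fintype m] [Fintype k] (A : Matrix m k ℝ) (i : m) :
    √(∑ j, A i j ^ 2) ≤ frobNorm A :=
  Real.sqrt_le_sqrt (Finset.single_le_sum (f := fun i => ∑ j, A i j ^ 2)
    (fun _ _ => Finset.sum_nonneg fun _ _ => sq_nonneg _) (Finset.mem_univ i))

lemma FrobBall.abs_entry_le (τ : FrobBall n r) (e : Fin n × Fin n) : |τ.entry e| ≤ 1 := by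
  have h1 : |τ.entry e| ≤ √(∑ x, τ.1.1 e.1 x ^ 2) * √(∑ x, τ.1.2 e.2 x ^ 2) := by
    rw [← Real.sqrt_mul (Finset.sum_nonneg fun _ _ => sq_nonneg _)]
    exact Real.abs_le_sqrt (Finset.sum_mul_sq_le_sq_mul_sq _ _ _)
  refine h1.trans (mul_le_one₀ ((sqrt_row_le_frobNorm _ _).trans τ.2.1) (Real.sqrt_nonneg _)
    ((sqrt_row_le_frobNorm _ _).trans τ.2.2))

/-- The largest pairing of an array of weights with `|P Qᵀ|` over the Frobenius unit balls. -/
noncomputable def absPairing (n r : ℕ) (x : Fin n × Fin n → ℝ) : ℝ :=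
  ⨆ τ : FrobBall n r, ∑ e, x e * |τ.entry e|

lemma bddAbove_absPairing (x : Fin n × Fin n → ℝ) :
    BddAbove (Set.range fun τ : FrobBall n r => ∑ e, x e * |τ.entry e|) := by
  refine ⟨∑ e, |x e|, ?_⟩
  rintro _ ⟨τ, rfl⟩
  refine Finset.sum_le_sum fun e _ => (le_abs_self _).trans ?_
  rw [abs_mul, abs_abs]
  exact mul_le_of_le_one_right (abs_nonneg _) (τ.abs_entry_le e)

lemma absPairing_nonneg (x : Fin n × Fin n → ℝ) : 0 ≤ absPairing n r x := by
  refine le_trans (le_of_eq ?_)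
    (le_ciSup (bddAbove_absPairing x) (⟨(0, 0), by simp [frobNorm_zero]⟩ : FrobBall n r))
  simp [FrobBall.entry]

lemma frobNorm_smul {m k : Type*} [Fintype m] [Fintype k] (a : ℝ) (A : Matrix m k ℝ) :
    frobNorm (a • A) = |a| * frobNorm A := by
  unfold frobNorm
  rw [← Real.sqrt_sq_eq_abs, ← Real.sqrt_mul (sq_nonneg a), Finset.mul_sum]
  simp only [Finset.mul_sum, Matrix.smul_apply, smul_eq_mul, mul_pow]

lemma sum_mul_abs_inner_le (x : Fin n × Fin n → ℝ) {P Q : Matrix (Fin n) (Fin r) ℝ} {a b : ℝ}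
    (ha : 0 < a) (hb : 0 < b) (hP : frobNorm P ≤ a) (hQ : frobNorm Q ≤ b) :
    ∑ e : Fin n × Fin n, x e * |∑ k, P e.1 k * Q e.2 k| ≤ absPairing n r x * (a * b) := by
  have hscale : ∀ {c : ℝ} {R : Matrix (Fin n) (Fin r) ℝ}, 0 < c → frobNorm R ≤ c →
      frobNorm (c⁻¹ • R) ≤ 1 := fun {c R} hc hR => by
    rw [frobNorm_smul, abs_of_pos (inv_pos.2 hc), inv_mul_eq_div, div_le_one hc]
    exact hR
  have h := le_ciSup (bddAbove_absPairing x)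
    (⟨(a⁻¹ • P, b⁻¹ • Q), hscale ha hP, hscale hb hQ⟩ : FrobBall n r)
  rw [← div_le_iff₀ (by positivity), Finset.sum_div]
  refine le_trans (le_of_eq (Finset.sum_congr rfl fun e _ => ?_)) h
  have e1 : FrobBall.entry (⟨(a⁻¹ • P, b⁻¹ • Q), hscale ha hP, hscale hb hQ⟩ : FrobBall n r) e
      = (∑ k, P e.1 k * Q e.2 k) / (a * b) := by
    simp only [FrobBall.entry, Matrix.smul_apply, smul_eq_mul, Finset.sum_div]
    exact Finset.sum_congr rfl fun k _ => by field_simp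
  rw [e1, abs_div, abs_of_pos (mul_pos ha hb)]
  ring

lemma convexOn_max_pow (K : ℕ) : ConvexOn ℝ Set.univ fun x : ℝ => max x 0 ^ K := by
  have h : ConvexOn ℝ Set.univ fun x : ℝ => max x 0 :=
    (convexOn_id convex_univ).sup (convexOn_const 0 convex_univ)
  have h2 := ConvexOn.pow h (fun x _ => le_max_right _ _) K
  exact h2

/-- The centred Bernoulli array is paired with `|P Qᵀ|`; by contraction the absolute value may be
dropped, after which duality with the nuclear norm leaves the spectral norm of a sparse sign
matrix. -/
lemma bern_absPairing_pow_le {q : ℝ} (h0 : 0 ≤ q) (h1 : q ≤ 1) {K : ℕ} :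
    ∑ z : Fin n × Fin n → Bool, (∏ e, bernWeight q (z e)) *
        absPairing n r (fun e => bernVal q (z e)) ^ (2 * (K + 1))
      ≤ signExp (2 * q * (1 - q)) fun z : Fin n × Fin n → SignType =>
          specNorm (signMatrix z) ^ (2 * (K + 1)) := by
  obtain ⟨Φ, hmono, hconv, hcont, hΦ⟩ : ∃ Φ : ℝ → ℝ, Monotone Φ ∧ ConvexOn ℝ Set.univ Φ ∧
      Continuous Φ ∧ ∀ x, Φ x = max x 0 ^ (2 * (K + 1)) :=
    ⟨fun x => max x 0 ^ (2 * (K + 1)),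
      fun x y hxy => pow_le_pow_left₀ (le_max_right _ _) (max_le_max_right 0 hxy) _,
      convexOn_max_pow _, by fun_prop, fun x => rfl⟩
  have h := bern_le_sign (T := FrobBall n r) hmono hconv hcont h0 h1
    (t := fun τ e => τ.entry e) (M := 1) (fun τ e => τ.abs_entry_le e) zero_le_one
  refine le_trans (le_of_eq ?_) (h.trans ?_)
  · refine Finset.sum_congr rfl fun z _ => ?_
    have h2 := max_eq_left (absPairing_nonneg (r := r) fun e => bernVal q (z e))
    rw [hΦ]
    unfold absPairing at h2 ⊢
    rw [h2]
  · refine signExp_mono (mul_nonneg (by linarith) (by linarith))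
      (by nlinarith [sq_nonneg (2 * q - 1)]) fun z => ?_
    rw [hΦ]
    refine pow_le_pow_left₀ (le_max_right _ _) (max_le (ciSup_le fun τ => ?_) (specNorm_nonneg _)) _
    have h2 := sum_mul_inner_le (signMatrix z) τ.1.1 τ.1.2
    have h3 : ∑ e, (z e : ℝ) * τ.entry e
        = ∑ i, ∑ j, signMatrix z i j * ∑ x, τ.1.1 i x * τ.1.2 j x := by
      rw [Fintype.sum_prod_type]
      simp only [signMatrix, Matrix.of_apply, FrobBall.entry]
    rw [h3]
    refine h2.trans (mul_le_of_le_one_right (specNorm_nonneg _) ?_)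
    exact mul_le_one₀ τ.2.1 (frobNorm_nonneg _) τ.2.2

/-- Even moments of the norm of a sparse sign matrix. The density `θ` may be raised to `q`. -/
lemma signExp_specNorm_sparse_pow_le {θ q : ℝ} (hθ0 : 0 ≤ θ) (hθ : θ ≤ q) (hq : 0 < q)
    (hq1 : q ≤ 1) {K : ℕ} (hK : n * q ≤ K + 1) :
    signExp θ (fun z : Fin n × Fin n → SignType => specNorm (signMatrix z) ^ (2 * (K + 1)))
      ≤ q⁻¹ * (4e9 * (K + 1)) ^ (K + 1) := by
  refine le_trans ?_ (sum_evenWalk_le_pow (α := Fin n) (β := Fin n) hq hq1 (by simpa using hK)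
    (by simpa using hK))
  refine (signExp_mono hθ0 (hθ.trans hq1) fun z => specNorm_pow_le_trace (signMatrix z) K).trans ?_
  simp_rw [trace_mul_transpose_pow_succ]
  rw [signExp_sum]
  refine Finset.sum_le_sum fun i _ => ?_
  rw [signExp_sum]
  refine Finset.sum_le_sum fun j _ => ?_
  have := signExp_monomial θ (walkEdge i j)
  refine (le_of_eq this).trans ?_
  by_cases hE : EvenWalk i j
  · have hE' := hE
    unfold EvenWalk at hE'
    rw [if_pos hE', if_pos hE]
    exact pow_le_pow_left₀ hθ0 hθ _
  · have hE' := hE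
    unfold EvenWalk at hE'
    rw [if_neg hE', if_neg hE]

end LowRank

/-! ### Random matrices dominated by an independent Bernoulli pattern -/

section BernoulliPattern

variable {Ω : Type*} [MeasurableSpace Ω] {P : Measure Ω} [IsProbabilityMeasure P]
  {E : Type*} [Fintype E] [DecidableEq E] {B : E → Ω → Bool} {q : ℝ}

lemma measure_pattern_eq (hB : ∀ e, Measurable (B e)) (hind : iIndepFun B P)
    (hq0 : 0 ≤ q) (hq1 : q ≤ 1) (hprob : ∀ e, P {ω | B e ω = true} = ENNReal.ofReal q)
    (z : E → Bool) :
    P {ω | ∀ e, B e ω = z e} = ENNReal.ofReal (∏ e, bernWeight q (z e)) := by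
  have h1 := hind.measure_inter_preimage_eq_mul Finset.univ (sets := fun e => {z e})
    (fun e _ => measurableSet_singleton _)
  have h2 : ∀ e, P (B e ⁻¹' {z e}) = ENNReal.ofReal (bernWeight q (z e)) := by
    intro e
    cases hz : z e with
    | true =>
      simp only [bernWeight, if_true]
      exact hprob e
    | false =>
      have h3 : B e ⁻¹' {false} = {ω | B e ω = true}ᶜ := by
        ext ω; simp
      have h5 : MeasurableSet {ω | B e ω = true} := hB e (measurableSet_singleton true)
      rw [h3, prob_compl_eq_one_sub h5, hprob e]
      simp only [bernWeight, Bool.false_eq_true, if_false]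
      rw [ENNReal.ofReal_sub 1 hq0, ENNReal.ofReal_one]
  have h4 : {ω | ∀ e, B e ω = z e} = ⋂ e ∈ Finset.univ, B e ⁻¹' {z e} := by
    ext ω; simp
  rw [h4, h1, ENNReal.ofReal_prod_of_nonneg]
  · exact Finset.prod_congr rfl fun e _ => h2 e
  · intro e _
    unfold bernWeight; split_ifs <;> linarith

/-- Markov's inequality for a function of the pattern. -/
lemma measure_pattern_ge_le (hB : ∀ e, Measurable (B e)) (hind : iIndepFun B P)
    (hq0 : 0 ≤ q) (hq1 : q ≤ 1) (hprob : ∀ e, P {ω | B e ω = true} = ENNReal.ofReal q)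
    {f : (E → Bool) → ℝ} (hf : ∀ z, 0 ≤ f z) {A thr : ℝ} (hthr : 0 < thr)
    (hA : ∑ z : E → Bool, (∏ e, bernWeight q (z e)) * f z ≤ A) :
    P {ω | thr ≤ f fun e => B e ω} ≤ ENNReal.ofReal (A / thr) := by
  have hw : ∀ z : E → Bool, 0 ≤ ∏ e, bernWeight q (z e) := fun z =>
    Finset.prod_nonneg fun e _ => by unfold bernWeight; split_ifs <;> linarith
  set S := Finset.univ.filter fun z : E → Bool => thr ≤ f z with hS
  calc P {ω | thr ≤ f fun e => B e ω} ≤ P (⋃ z ∈ S, {ω | ∀ e, B e ω = z e}) := by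
        refine measure_mono fun ω hω => ?_
        refine Set.mem_iUnion₂.2 ⟨fun e => B e ω, Finset.mem_filter.2 ⟨Finset.mem_univ _, hω⟩, ?_⟩
        intro e; rfl
    _ ≤ ∑ z ∈ S, P {ω | ∀ e, B e ω = z e} := measure_biUnion_finset_le _ _
    _ = ENNReal.ofReal (∑ z ∈ S, ∏ e, bernWeight q (z e)) := by
        rw [ENNReal.ofReal_sum_of_nonneg fun z _ => hw z]
        exact Finset.sum_congr rfl fun z _ => measure_pattern_eq hB hind hq0 hq1 hprob z
    _ ≤ ENNReal.ofReal (A / thr) := by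
        refine ENNReal.ofReal_le_ofReal ?_
        rw [le_div_iff₀ hthr, Finset.sum_mul]
        refine le_trans ?_ hA
        refine le_trans (Finset.sum_le_sum fun z hz => ?_)
          (Finset.sum_le_sum_of_subset_of_nonneg (Finset.subset_univ S)
            fun z _ _ => mul_nonneg (hw z) (hf z))
        exact mul_le_mul_of_nonneg_left (Finset.mem_filter.1 hz).2 (hw z)

variable {n : ℕ} {B : Fin n × Fin n → Ω → Bool} {G : Ω → Matrix (Fin n) (Fin n) ℝ} {b : ℝ}

lemma integral_monomial_le {ι : Type*} [Fintype ι] [DecidableEq ι]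
    (hB : ∀ e, Measurable (B e)) (hind : iIndepFun B P) (hq0 : 0 ≤ q)
    (hprob : ∀ e, P {ω | B e ω = true} = ENNReal.ofReal q)
    (hG : ∀ i j, Measurable fun ω => G ω i j) (hb : 0 ≤ b)
    (hGb : ∀ ω i j, |G ω i j| ≤ if B (i, j) ω = true then b else 0) (e : ι → Fin n × Fin n) :
    Integrable (fun ω => ∏ x, G ω (e x).1 (e x).2) P ∧
    ∫ ω, ∏ x, G ω (e x).1 (e x).2 ∂P
      ≤ b ^ Fintype.card ι * q ^ (Finset.univ.image e).card := by
  have hmeas : Measurable fun ω => ∏ x, G ω (e x).1 (e x).2 :=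
    Finset.measurable_prod _ fun x _ => hG _ _
  set A : Set Ω := ⋂ a ∈ Finset.univ.image e, B a ⁻¹' {true} with hA
  have hAm : MeasurableSet A :=
    Finset.measurableSet_biInter _ fun a _ => hB a (measurableSet_singleton true)
  have hle : ∀ ω, |∏ x, G ω (e x).1 (e x).2| ≤ A.indicator (fun _ => b ^ Fintype.card ι) ω := by
    intro ω
    rw [Finset.abs_prod]
    by_cases hω : ω ∈ A
    · rw [Set.indicator_of_mem hω]
      refine (Finset.prod_le_prod (fun x _ => abs_nonneg _) (g := fun _ => b) fun x _ => ?_).trans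
        (by simp)
      refine (hGb ω _ _).trans ?_
      split_ifs
      · exact le_rfl
      · exact hb
    · rw [Set.indicator_of_notMem hω]
      have : ∃ x, B (e x) ω ≠ true := by
        by_contra! hcon
        refine hω (Set.mem_iInter₂.2 fun a ha => ?_)
        obtain ⟨x, -, rfl⟩ := Finset.mem_image.1 ha
        exact hcon x
      obtain ⟨x, hx⟩ := this
      refine le_of_eq (Finset.prod_eq_zero (Finset.mem_univ x) ?_)
      have := hGb ω (e x).1 (e x).2
      rw [if_neg hx] at this
      exact le_antisymm this (abs_nonneg _)
  have hint : Integrable (A.indicator fun _ => b ^ Fintype.card ι : Ω → ℝ) P :=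
    (integrable_const _).indicator hAm
  have hI : Integrable (fun ω => ∏ x, G ω (e x).1 (e x).2) P :=
    hint.mono' hmeas.aestronglyMeasurable (Filter.Eventually.of_forall fun ω => by
      rw [Real.norm_eq_abs]; exact hle ω)
  refine ⟨hI, (integral_mono hI hint fun ω => (le_abs_self _).trans (hle ω)).trans ?_⟩
  rw [integral_indicator hAm, integral_const, smul_eq_mul, mul_comm]
  have h1 := hind.measure_inter_preimage_eq_mul (Finset.univ.image e) (sets := fun _ => {true})
    (fun e _ => measurableSet_singleton _)
  have h2 : P A = ENNReal.ofReal q ^ (Finset.univ.image e).card := by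
    rw [hA, h1, ← Finset.prod_const]
    exact Finset.prod_congr rfl fun a _ => hprob a
  rw [measureReal_restrict_apply MeasurableSet.univ, Set.univ_inter, Measure.real, h2,
    ENNReal.toReal_pow, ENNReal.toReal_ofReal hq0]

/-- Tail bound for the spectral norm of a matrix that is supported on a sparse Bernoulli pattern and
all of whose odd mixed moments vanish. -/
lemma measure_specNorm_pow_ge_le (hB : ∀ e, Measurable (B e)) (hind : iIndepFun B P)
    (hq0 : 0 ≤ q) (hprob : ∀ e, P {ω | B e ω = true} = ENNReal.ofReal q)
    (hG : ∀ i j, Measurable fun ω => G ω i j) (hb : 0 ≤ b)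
    (hGb : ∀ ω i j, |G ω i j| ≤ if B (i, j) ω = true then b else 0)
    {K : ℕ} (hodd : ∀ e : Fin (K + 1) × Bool → Fin n × Fin n,
      (∃ a, Odd (Finset.univ.filter fun x => e x = a).card) →
        ∫ ω, ∏ x, G ω (e x).1 (e x).2 ∂P = 0)
    {q' : ℝ} (hqq : q ≤ q') (hq' : 0 < q') (hq1 : q' ≤ 1) (hK : n * q' ≤ K + 1)
    {thr : ℝ} (hthr : 0 < thr) :
    P {ω | thr ≤ specNorm (G ω) ^ (2 * (K + 1))}
      ≤ ENNReal.ofReal (b ^ (2 * (K + 1)) * (q'⁻¹ * (4e9 * (K + 1)) ^ (K + 1)) / thr) := by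
  set f : Ω → ℝ := fun ω => ((G ω * (G ω).transpose) ^ (K + 1)).trace with hf
  have hfnn : ∀ ω, specNorm (G ω) ^ (2 * (K + 1)) ≤ f ω := fun ω => specNorm_pow_le_trace _ _
  have hf0 : ∀ ω, 0 ≤ f ω := fun ω => le_trans (pow_nonneg (specNorm_nonneg _) _) (hfnn ω)
  have hfe : f = fun ω => ∑ i : Fin (K + 1) → Fin n, ∑ j : Fin (K + 1) → Fin n,
      ∏ x, G ω (walkEdge i j x).1 (walkEdge i j x).2 := by
    funext ω
    exact trace_mul_transpose_pow_succ (G ω) K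
  have hmono := fun i j : Fin (K + 1) → Fin n =>
    integral_monomial_le (P := P) hB hind hq0 hprob hG hb hGb (walkEdge i j)
  have hI : Integrable f P := by
    rw [hfe]
    exact integrable_finsetSum _ fun i _ => integrable_finsetSum _ fun j _ => (hmono i j).1
  have hint : ∫ ω, f ω ∂P ≤ b ^ (2 * (K + 1)) * (q'⁻¹ * (4e9 * (K + 1)) ^ (K + 1)) := by
    rw [hfe]
    rw [integral_finsetSum _ fun i _ => integrable_finsetSum _ fun j _ => (hmono i j).1]
    simp_rw [integral_finsetSum _ fun j _ => (hmono _ j).1]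
    refine le_trans ?_ (mul_le_mul_of_nonneg_left (sum_evenWalk_le_pow (α := Fin n) (β := Fin n)
      hq' hq1 (by simpa using hK) (by simpa using hK)) (pow_nonneg hb _))
    rw [Finset.mul_sum]
    refine Finset.sum_le_sum fun i _ => ?_
    rw [Finset.mul_sum]
    refine Finset.sum_le_sum fun j _ => ?_
    by_cases hE : EvenWalk i j
    · rw [if_pos hE]
      refine (hmono i j).2.trans ?_
      have : Fintype.card (Fin (K + 1) × Bool) = 2 * (K + 1) := by simp [mul_comm]
      rw [this]
      exact mul_le_mul_of_nonneg_left (pow_le_pow_left₀ hq0 hqq _) (pow_nonneg hb _)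
    · rw [if_neg hE, mul_zero]
      unfold EvenWalk at hE
      push Not at hE
      obtain ⟨a, ha⟩ := hE
      exact (hodd _ ⟨a, by simpa using ha⟩).le
  have hmk := mul_meas_ge_le_integral_of_nonneg (Filter.Eventually.of_forall hf0) hI thr
  have h1 : P.real {ω | thr ≤ f ω}
      ≤ b ^ (2 * (K + 1)) * (q'⁻¹ * (4e9 * (K + 1)) ^ (K + 1)) / thr := by
    rw [le_div_iff₀ hthr, mul_comm]
    exact hmk.trans hint
  calc P {ω | thr ≤ specNorm (G ω) ^ (2 * (K + 1))} ≤ P {ω | thr ≤ f ω} :=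
        measure_mono fun ω hω => le_trans hω (hfnn ω)
    _ = ENNReal.ofReal (P.real {ω | thr ≤ f ω}) := by
        rw [Measure.real, ENNReal.ofReal_toReal (measure_ne_top _ _)]
    _ ≤ _ := ENNReal.ofReal_le_ofReal h1

end BernoulliPattern

/-! ### Symmetry of the law of signs and noise -/

section Flip

variable {Ω : Type*} [MeasurableSpace Ω] {P : Measure Ω} [IsProbabilityMeasure P] {n : ℕ}

/-- Negation of a single entry. -/
def flipEntry (a : Fin n × Fin n) (x : Fin n → Fin n → ℝ) (i j : Fin n) : ℝ :=
  if (i, j) = a then -x i j else x i j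

lemma measurable_flipEntry (a : Fin n × Fin n) : Measurable (flipEntry a) := by
  refine measurable_pi_lambda _ fun i => measurable_pi_lambda _ fun j => ?_
  unfold flipEntry
  split_ifs <;> fun_prop

/-- Negating one entry preserves the law of an array with independent symmetric entries. -/
lemma measurePreserving_flipEntry {X : Ω → Fin n → Fin n → ℝ} (hX : Measurable X)
    (hind : iIndepFun (fun (e : Fin n × Fin n) ω => X ω e.1 e.2) P)
    (hsymm : ∀ i j, P.map (fun ω => X ω i j) = P.map (fun ω => -X ω i j)) (a : Fin n × Fin n) :
    MeasurePreserving (flipEntry a) (P.map X) (P.map X) := by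
  have hXe : ∀ e : Fin n × Fin n, Measurable fun ω => X ω e.1 e.2 := fun e => by fun_prop
  set Y : Ω → Fin n × Fin n → ℝ := fun ω e => X ω e.1 e.2 with hY
  have hYm : Measurable Y := measurable_pi_lambda _ hXe
  have hlaw : P.map Y = Measure.pi fun e : Fin n × Fin n => P.map fun ω => X ω e.1 e.2 :=
    (iIndepFun_iff_map_fun_eq_pi_map fun e => (hXe e).aemeasurable).1 hind
  have : ∀ e : Fin n × Fin n, IsProbabilityMeasure (P.map fun ω => X ω e.1 e.2) := fun e =>
    Measure.isProbabilityMeasure_map (hXe e).aemeasurable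
  have hpi : MeasurePreserving
      (fun (y : Fin n × Fin n → ℝ) e => (if e = a then Neg.neg else id) (y e))
      (P.map Y) (P.map Y) := by
    rw [hlaw]
    refine measurePreserving_pi _ _ (f := fun e => if e = a then Neg.neg else id) fun e => ?_
    split_ifs with h
    · refine ⟨measurable_neg, ?_⟩
      rw [Measure.map_map measurable_neg (hXe e)]
      exact (hsymm e.1 e.2).symm
    · exact MeasurePreserving.id _
  have hc : Measurable fun (y : Fin n × Fin n → ℝ) (i j : Fin n) => y (i, j) := by fun_prop
  refine ⟨measurable_flipEntry a, ?_⟩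
  have e1 : X = (fun (y : Fin n × Fin n → ℝ) (i j : Fin n) => y (i, j)) ∘ Y := rfl
  have e2 : flipEntry a ∘ (fun (y : Fin n × Fin n → ℝ) (i j : Fin n) => y (i, j))
      = (fun (y : Fin n × Fin n → ℝ) (i j : Fin n) => y (i, j)) ∘
        fun (y : Fin n × Fin n → ℝ) e => (if e = a then Neg.neg else id) (y e) := by
    funext y i j
    simp only [Function.comp_apply, flipEntry]
    split_ifs <;> rfl
  rw [e1, ← Measure.map_map hc hYm, Measure.map_map (measurable_flipEntry a) hc, e2,
    ← Measure.map_map hc hpi.measurable, hpi.map_eq]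

lemma map_eq_map_neg_of_sign {s : Ω → ℝ} (hs : Measurable s) (hval : ∀ ω, s ω = 1 ∨ s ω = -1)
    (hprob : P {ω | s ω = 1} = 1 / 2) : P.map s = P.map fun ω => -s ω := by
  have hm1 : MeasurableSet {ω | s ω = 1} := hs (measurableSet_singleton 1)
  have hneg : P {ω | s ω = -1} = 1 / 2 := by
    have : {ω | s ω = -1} = {ω | s ω = 1}ᶜ := by
      ext ω
      rcases hval ω with h | h <;> simp [h] <;> norm_num
    rw [this, prob_compl_eq_one_sub hm1, hprob]
    simp
  classical
  have key : ∀ A : Set ℝ, MeasurableSet A → ∀ s' : Ω → ℝ, (∀ ω, s' ω = 1 ∨ s' ω = -1) →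
      P {ω | s' ω = 1} = 1 / 2 → P {ω | s' ω = -1} = 1 / 2 →
      P (s' ⁻¹' A) = if (1 : ℝ) ∈ A then (if (-1 : ℝ) ∈ A then 1 else 1 / 2)
        else (if (-1 : ℝ) ∈ A then 1 / 2 else 0) := by
    intro A _ s' hv h1 h2
    split_ifs with ha hb hb
    · have : s' ⁻¹' A = Set.univ := by
        ext ω; rcases hv ω with h | h <;> simp [h, ha, hb]
      rw [this, measure_univ]
    · rw [← h1]; congr 1
      ext ω; rcases hv ω with h | h <;> simp [h, ha, hb]; norm_num
    · rw [← h2]; congr 1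
      ext ω; rcases hv ω with h | h <;> simp [h, ha, hb]; norm_num
    · have : s' ⁻¹' A = ∅ := by
        ext ω; rcases hv ω with h | h <;> simp [h, ha, hb]
      rw [this, measure_empty]
  refine Measure.ext fun A hA => ?_
  have hneg' : Measurable fun ω => -s ω := hs.neg
  rw [Measure.map_apply hs hA, Measure.map_apply hneg' hA, key A hA s hval hprob hneg]
  have e1 : {ω | -s ω = 1} = {ω | s ω = -1} := by
    ext ω; exact ⟨fun h => by simp at *; linarith, fun h => by simp at *; linarith⟩
  have e2 : {ω | -s ω = -1} = {ω | s ω = 1} := by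
    ext ω; simp
  refine (key A hA (fun ω => -s ω) (fun ω => ?_) ?_ ?_).symm
  · rcases hval ω with h | h <;> simp [h]
  · rw [e1, hneg]
  · rw [e2, hprob]

end Flip

/-! ### Scalar soft thresholding -/

/-- Soft thresholding of a real number. -/
noncomputable def shrink (τ x : ℝ) : ℝ := Real.sign x * max (|x| - τ) 0

lemma shrink_eq {τ : ℝ} (hτ : 0 ≤ τ) (x : ℝ) : shrink τ x = x - max (-τ) (min x τ) := by
  unfold shrink
  rcases lt_trichotomy x 0 with h | rfl | h
  · rw [Real.sign_of_neg h, abs_of_neg h, min_eq_left (h.le.trans hτ)]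
    rcases le_total (-x) τ with h1 | h1
    · rw [max_eq_right (by linarith), max_eq_right (by linarith)]; ring
    · rw [max_eq_left (by linarith), max_eq_left (by linarith)]; ring
  · simp [hτ]
  · rw [Real.sign_of_pos h, abs_of_pos h, max_eq_right (a := -τ)]
    · rcases le_total x τ with h1 | h1
      · rw [max_eq_right (by linarith), min_eq_left h1]; ring
      · rw [max_eq_left (by linarith), min_eq_right h1]; ring
    · exact le_min (by linarith) (by linarith)

lemma abs_shrink_sub_self_le {τ : ℝ} (hτ : 0 ≤ τ) (x : ℝ) : |shrink τ x - x| ≤ τ := by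
  rw [shrink_eq hτ, abs_le]
  have h1 : max (-τ) (min x τ) ≤ τ := max_le (by linarith) (min_le_right _ _)
  have h2 : -τ ≤ max (-τ) (min x τ) := le_max_left _ _
  constructor <;> linarith

lemma abs_shrink_sub_shrink_le {τ : ℝ} (hτ : 0 ≤ τ) (x y : ℝ) :
    |shrink τ x - shrink τ y| ≤ |x - y| := by
  wlog h : y ≤ x generalizing x y
  · rw [abs_sub_comm, abs_sub_comm x]
    exact this y x (le_of_not_ge h)
  rw [shrink_eq hτ, shrink_eq hτ, abs_of_nonneg (sub_nonneg.2 h)]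
  have h1 : max (-τ) (min y τ) ≤ max (-τ) (min x τ) := by gcongr
  have h2 : max (-τ) (min x τ) ≤ max (-τ) (min y τ) + (x - y) := by
    refine max_le (by linarith [le_max_left (-τ) (min y τ)]) ?_
    have h3 : min x τ ≤ min y τ + (x - y) := by
      rcases le_total y τ with h4 | h4
      · rw [min_eq_left h4]; linarith [min_le_left x τ]
      · rw [min_eq_right h4]; linarith [min_le_right x τ]
    linarith [le_max_right (-τ) (min y τ)]
  rw [abs_le]
  constructor <;> linarith

lemma shrink_eq_zero {τ x : ℝ} (h : |x| ≤ τ) : shrink τ x = 0 := by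
  unfold shrink
  rw [max_eq_right (by linarith), mul_zero]

lemma shrink_neg (τ x : ℝ) : shrink τ (-x) = -shrink τ x := by
  unfold shrink
  rw [Real.sign_neg, abs_neg, neg_mul]

lemma measurable_shrink {τ : ℝ} (hτ : 0 ≤ τ) : Measurable (shrink τ) := by
  have : shrink τ = fun x => x - max (-τ) (min x τ) := funext fun x => shrink_eq hτ x
  rw [this]; fun_prop

/-! ### The error at the outliers in the absence of a low-rank error -/

/-- The error of soft thresholding at an entry with outlier indicator `o`, sign `s`, magnitude `m`
and noise `x`, if the low-rank part is known exactly. Noise above the level `B` is cut off. -/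
noncomputable def outErr (τ B : ℝ) (o : Bool) (s m x : ℝ) : ℝ :=
  if o = true ∧ |x| ≤ B then shrink τ (s * m + x) - s * m else 0

lemma outErr_neg (τ B : ℝ) (o : Bool) (s m x : ℝ) :
    outErr τ B o (-s) m (-x) = -outErr τ B o s m x := by
  unfold outErr
  rw [abs_neg]
  split_ifs
  · rw [show -s * m + -x = -(s * m + x) by ring, shrink_neg]; ring
  · simp

lemma abs_outErr_le {τ B : ℝ} (hτ : 0 ≤ τ) (hB : 0 ≤ B) (o : Bool) (s m x : ℝ) :
    |outErr τ B o s m x| ≤ if o = true then τ + B else 0 := by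
  unfold outErr
  by_cases ho : o = true
  · rw [if_pos ho]
    split_ifs with h
    · have h1 := abs_shrink_sub_self_le hτ (s * m + x)
      have h2 : shrink τ (s * m + x) - s * m = (shrink τ (s * m + x) - (s * m + x)) + x := by ring
      rw [h2]
      exact (abs_add_le _ _).trans (add_le_add h1 h.2)
    · simp; positivity
  · simp [ho]

lemma measurable_outErr {τ B : ℝ} (hτ : 0 ≤ τ) {α : Type*} [MeasurableSpace α] {o : α → Bool}
    {s m x : α → ℝ} (ho : Measurable o) (hs : Measurable s) (hm : Measurable m)
    (hx : Measurable x) : Measurable fun a => outErr τ B (o a) (s a) (m a) (x a) := by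
  unfold outErr
  refine Measurable.ite ?_ ?_ measurable_const
  · exact (ho (measurableSet_singleton true)).inter
      (measurableSet_le (continuous_abs.measurable.comp hx) measurable_const)
  · exact ((measurable_shrink hτ).comp ((hs.mul hm).add hx)).sub (hs.mul hm)

section Model

variable {Ω : Type*} [MeasurableSpace Ω] {P : Measure Ω} [IsProbabilityMeasure P] {n : ℕ}
  {p ρs σ : ℝ} {obs out : Ω → Fin n → Fin n → Bool} {sgn mag noise : Ω → Fin n → Fin n → ℝ}

/-- Odd mixed moments of the error matrix vanish, since its law does not change when the sign and
the noise of one entry are both negated. -/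
lemma integral_outErr_monomial_eq_zero (hM : IsModel P p ρs σ obs out sgn mag noise) {τ : ℝ}
    (hτ : 0 ≤ τ) (B : ℝ) {ι : Type*} [Fintype ι] [DecidableEq ι] (e : ι → Fin n × Fin n)
    (hodd : ∃ a, Odd (Finset.univ.filter fun x => e x = a).card) :
    ∫ ω, ∏ x, outErr τ B (out ω (e x).1 (e x).2) (sgn ω (e x).1 (e x).2) (mag ω (e x).1 (e x).2)
      (noise ω (e x).1 (e x).2) ∂P = 0 := by
  obtain ⟨a, ha⟩ := hodd
  let loc : Ω → (Fin n → Fin n → Bool) × (Fin n → Fin n → Bool) × (Fin n → Fin n → ℝ) :=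
    fun ω => (obs ω, out ω, mag ω)
  let F : ((Fin n → Fin n → Bool) × (Fin n → Fin n → Bool) × (Fin n → Fin n → ℝ)) ×
      ((Fin n → Fin n → ℝ) × (Fin n → Fin n → ℝ)) → ℝ := fun y =>
    ∏ x, outErr τ B (y.1.2.1 (e x).1 (e x).2) (y.2.1 (e x).1 (e x).2) (y.1.2.2 (e x).1 (e x).2)
      (y.2.2 (e x).1 (e x).2)
  have hloc : Measurable loc :=
    hM.measurable_obs.prodMk (hM.measurable_out.prodMk hM.measurable_mag)
  have hsn : Measurable fun ω => (sgn ω, noise ω) := hM.measurable_sgn.prodMk hM.measurable_noise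
  have hF : Measurable F := by
    refine Finset.measurable_prod _ fun x _ => measurable_outErr hτ ?_ ?_ ?_ ?_ <;> fun_prop
  have hs : MeasurePreserving (flipEntry a) (P.map sgn) (P.map sgn) := by
    refine measurePreserving_flipEntry hM.measurable_sgn hM.indep_sgn (fun i j => ?_) a
    have : Measurable fun ω => sgn ω i j := by have := hM.measurable_sgn; fun_prop
    exact map_eq_map_neg_of_sign this (fun ω => hM.sgn_val ω i j) (hM.prob_sgn i j)
  have hn : MeasurePreserving (flipEntry a) (P.map noise) (P.map noise) :=
    measurePreserving_flipEntry hM.measurable_noise hM.indep_noise hM.noise_symm a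
  have i1 : IsProbabilityMeasure (P.map sgn) :=
    Measure.isProbabilityMeasure_map hM.measurable_sgn.aemeasurable
  have i2 : IsProbabilityMeasure (P.map noise) :=
    Measure.isProbabilityMeasure_map hM.measurable_noise.aemeasurable
  have i3 : IsProbabilityMeasure (P.map loc) :=
    Measure.isProbabilityMeasure_map hloc.aemeasurable
  have hlaw2 : P.map (fun ω => (sgn ω, noise ω)) = (P.map sgn).prod (P.map noise) :=
    (indepFun_iff_map_prod_eq_prod_map_map hM.measurable_sgn.aemeasurable
      hM.measurable_noise.aemeasurable).1 hM.indep_sgn_noise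
  have hlaw : P.map (fun ω => (loc ω, (sgn ω, noise ω)))
      = (P.map loc).prod ((P.map sgn).prod (P.map noise)) := by
    rw [← hlaw2]
    exact (indepFun_iff_map_prod_eq_prod_map_map hloc.aemeasurable hsn.aemeasurable).1
      hM.indep_loc_mag
  have hpres := (MeasurePreserving.id (P.map loc)).prod (hs.prod hn)
  have h1 : ∫ ω, F (loc ω, (sgn ω, noise ω)) ∂P
      = ∫ y, F y ∂((P.map loc).prod ((P.map sgn).prod (P.map noise))) := by
    rw [← hlaw, integral_map (hloc.prodMk hsn).aemeasurable hF.aestronglyMeasurable]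
  have h2 : ∫ y, F y ∂((P.map loc).prod ((P.map sgn).prod (P.map noise)))
      = -∫ y, F y ∂((P.map loc).prod ((P.map sgn).prod (P.map noise))) := by
    conv_lhs => rw [← hpres.map_eq]
    rw [integral_map hpres.measurable.aemeasurable hF.aestronglyMeasurable, ← integral_neg]
    congr 1
    funext y
    have h3 : ∀ x, outErr τ B (y.1.2.1 (e x).1 (e x).2) (flipEntry a y.2.1 (e x).1 (e x).2)
        (y.1.2.2 (e x).1 (e x).2) (flipEntry a y.2.2 (e x).1 (e x).2)
        = (if e x = a then -1 else 1) * outErr τ B (y.1.2.1 (e x).1 (e x).2)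
          (y.2.1 (e x).1 (e x).2) (y.1.2.2 (e x).1 (e x).2) (y.2.2 (e x).1 (e x).2) := by
      intro x
      unfold flipEntry
      by_cases h : e x = a
      · have h' : ((e x).1, (e x).2) = a := h
        rw [if_pos h', if_pos h', if_pos h, outErr_neg]; ring
      · have h' : ¬((e x).1, (e x).2) = a := h
        rw [if_neg h', if_neg h', if_neg h, one_mul]
    simp only [F, id_eq, Prod.map_fst, Prod.map_snd]
    rw [Finset.prod_congr rfl fun x _ => h3 x, Finset.prod_mul_distrib, Finset.prod_ite,
      Finset.prod_const, Finset.prod_const_one, ha.neg_one_pow]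
    ring
  have h4 : ∫ ω, F (loc ω, (sgn ω, noise ω)) ∂P = 0 := by rw [h1]; linarith
  exact h4

lemma IsModel.prob_noise_gt_le (hM : IsModel P p ρs σ obs out sgn mag noise) (hσ : 0 < σ)
    (hn : 1 ≤ n) :
    P {ω | ∃ i j, 11 * (σ * √(Real.log n)) < |noise ω i j|}
      ≤ ENNReal.ofReal (2 / (n : ℝ) ^ 100) := by
  have hn1 : (1 : ℝ) ≤ n := by exact_mod_cast hn
  have hn0 : (0 : ℝ) < n := by linarith
  have hl : 0 ≤ Real.log n := Real.log_nonneg hn1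
  -- the sub-Gaussian norm bounds `𝔼 exp (E² / σ²)` by `2`, and `11² = 121` leaves room for
  -- `n²` entries
  have hone : ∀ i j, P {ω | 11 * (σ * √(Real.log n)) < |noise ω i j|}
      ≤ ENNReal.ofReal (2 / (n : ℝ) ^ 121) := by
    intro i j
    have hm : Measurable fun ω => noise ω i j := by have := hM.measurable_noise; fun_prop
    have hmk := mul_meas_ge_le_lintegral (μ := P)
      (f := fun ω => ENNReal.ofReal (Real.exp (noise ω i j ^ 2 / σ ^ 2))) (by fun_prop)
      (ENNReal.ofReal ((n : ℝ) ^ 121))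
    have hsub : {ω | 11 * (σ * √(Real.log n)) < |noise ω i j|} ⊆
        {ω | ENNReal.ofReal ((n : ℝ) ^ 121)
          ≤ ENNReal.ofReal (Real.exp (noise ω i j ^ 2 / σ ^ 2))} := by
      intro ω hω
      refine ENNReal.ofReal_le_ofReal ?_
      have h1 : (n : ℝ) ^ 121 = Real.exp (121 * Real.log n) := by
        rw [mul_comm, Real.exp_mul, Real.exp_log hn0]; norm_cast
      rw [h1]
      refine Real.exp_le_exp.2 ?_
      rw [le_div_iff₀ (by positivity)]
      have h2 : 11 * (σ * √(Real.log n)) < |noise ω i j| := hω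
      have h3 := pow_le_pow_left₀ (by positivity) h2.le 2
      rw [sq_abs, mul_pow, mul_pow, Real.sq_sqrt hl] at h3
      linarith
    have h5 : ENNReal.ofReal ((n : ℝ) ^ 121) ≠ 0 := by
      rw [Ne, ENNReal.ofReal_eq_zero, not_le]; positivity
    refine (measure_mono hsub).trans ?_
    have h6 := hmk.trans (hM.noise_subG i j)
    rw [mul_comm, ← ENNReal.le_div_iff_mul_le (Or.inl h5) (Or.inl ENNReal.ofReal_ne_top)] at h6
    refine h6.trans (le_of_eq ?_)
    rw [ENNReal.ofReal_div_of_pos (by positivity)]; simp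
  have hset : {ω | ∃ i j, 11 * (σ * √(Real.log n)) < |noise ω i j|}
      = ⋃ e ∈ (Finset.univ : Finset (Fin n × Fin n)),
        {ω | 11 * (σ * √(Real.log n)) < |noise ω e.1 e.2|} := by
    ext ω; simp
  rw [hset]
  refine (measure_biUnion_finset_le _ _).trans ?_
  refine (Finset.sum_le_sum fun e _ => hone e.1 e.2).trans ?_
  rw [Finset.sum_const, nsmul_eq_mul]
  have hc : ((Finset.univ : Finset (Fin n × Fin n)).card : ENNReal)
      = ENNReal.ofReal ((n : ℝ) ^ 2) := by
    simp [sq]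
  rw [hc, ← ENNReal.ofReal_mul (by positivity)]
  refine ENNReal.ofReal_le_ofReal ?_
  rw [mul_div_assoc', div_le_div_iff₀ (by positivity) (by positivity)]
  calc (n : ℝ) ^ 2 * 2 * (n : ℝ) ^ 100 = 2 * (n : ℝ) ^ 102 := by ring
    _ ≤ 2 * (n : ℝ) ^ 121 := by gcongr; norm_num

end Model

/-! ### Masked low-rank matrices -/

section Masked

variable {n r : ℕ}

/-- The mean part of the masked form: Cauchy–Schwarz in each row, and `∑ |u_i| ≤ √n`. -/
lemma mean_pairing_le (A Y : Matrix (Fin n) (Fin r) ℝ) {u v : Fin n → ℝ} {a : ℝ}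
    (hA : twoInfNorm A ≤ a) (hu : ∑ i, u i ^ 2 ≤ 1) (hv : ∑ j, v j ^ 2 ≤ 1) :
    ∑ i, ∑ j, |u i| * |v j| * |∑ k, A i k * Y j k| ≤ √n * specNorm Y * a := by
  have ha : 0 ≤ a := (twoInfNorm_nonneg A).trans hA
  have hrow : ∀ i, ∑ j, |u i| * |v j| * |∑ k, A i k * Y j k| ≤ |u i| * (specNorm Y * a) := by
    intro i
    have h1 : ∑ j, |v j| * |∑ k, A i k * Y j k|
        ≤ √(∑ j, |v j| ^ 2) * √(∑ j, |∑ k, A i k * Y j k| ^ 2) :=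
      Real.sum_mul_le_sqrt_mul_sqrt _ _ _
    have h2 : √(∑ j, |v j| ^ 2) ≤ 1 := by
      simp only [sq_abs]; exact Real.sqrt_le_one.2 hv
    have h3 : √(∑ j, |∑ k, A i k * Y j k| ^ 2) ≤ specNorm Y * a := by
      refine Real.sqrt_le_iff.2 ⟨mul_nonneg (specNorm_nonneg _) ha, ?_⟩
      have h4 := sum_mulVec_sq_le Y (A i)
      have h5 : ∑ k, A i k ^ 2 ≤ a ^ 2 := by
        rw [← Real.sqrt_le_left ha]
        exact (sqrt_row_le_twoInfNorm A i).trans hA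
      rw [mul_pow]
      refine le_trans (le_of_eq ?_) (h4.trans (mul_le_mul_of_nonneg_left h5 (sq_nonneg _)))
      refine Finset.sum_congr rfl fun j _ => ?_
      rw [sq_abs]
      simp only [Matrix.mulVec, dotProduct, mul_comm]
    simp only [mul_assoc, ← Finset.mul_sum]
    refine mul_le_mul_of_nonneg_left (h1.trans ?_) (abs_nonneg _)
    calc _ ≤ 1 * (specNorm Y * a) := mul_le_mul h2 h3 (Real.sqrt_nonneg _) zero_le_one
      _ = _ := one_mul _
  refine (Finset.sum_le_sum fun i _ => hrow i).trans ?_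
  rw [← Finset.sum_mul, mul_assoc]
  refine mul_le_mul_of_nonneg_right ?_ (mul_nonneg (specNorm_nonneg _) ha)
  have h6 : ∑ i, |u i| * 1 ≤ √(∑ i, |u i| ^ 2) * √(∑ _i : Fin n, (1 : ℝ) ^ 2) :=
    Real.sum_mul_le_sqrt_mul_sqrt _ _ _
  have h7 : √(∑ i, |u i| ^ 2) ≤ 1 := by
    simp only [sq_abs]; exact Real.sqrt_le_one.2 hu
  simp only [mul_one, one_pow, Finset.sum_const, Finset.card_univ, Fintype.card_fin,
    nsmul_eq_mul] at h6
  exact h6.trans (mul_le_of_le_one_left (Real.sqrt_nonneg _) h7)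

/-- The bilinear form of `|A Yᵀ|` on a random set of entries: its mean plus a fluctuation that is
controlled by the supremum of the centred Bernoulli process. -/
lemma masked_pairing_le (z : Fin n × Fin n → Bool) (q : ℝ) (A Y : Matrix (Fin n) (Fin r) ℝ)
    {u v : Fin n → ℝ} {a y : ℝ} (ha : 0 < a) (hy : 0 < y) (hA : twoInfNorm A ≤ a)
    (hY : twoInfNorm Y ≤ y) (hu : ∑ i, u i ^ 2 ≤ 1) (hv : ∑ j, v j ^ 2 ≤ 1) :
    ∑ i, ∑ j, (if z (i, j) = true then |u i| * |v j| * |∑ k, A i k * Y j k| else 0)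
      ≤ q * (∑ i, ∑ j, |u i| * |v j| * |∑ k, A i k * Y j k|)
        + absPairing n r (fun e => bernVal q (z e)) * (a * y) := by
  have hfrob : ∀ {R : Matrix (Fin n) (Fin r) ℝ} {w : Fin n → ℝ} {c : ℝ}, 0 < c →
      twoInfNorm R ≤ c → ∑ i, w i ^ 2 ≤ 1 → frobNorm (Matrix.of fun i k => |w i| * R i k) ≤ c := by
    intro R w c hc hR hw
    refine Real.sqrt_le_iff.2 ⟨hc.le, ?_⟩
    simp only [Matrix.of_apply, mul_pow, ← Finset.mul_sum, sq_abs]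
    calc ∑ i, w i ^ 2 * ∑ k, R i k ^ 2 ≤ ∑ i, w i ^ 2 * c ^ 2 := by
          gcongr with i
          rw [← Real.sqrt_le_left hc.le]
          exact (sqrt_row_le_twoInfNorm R i).trans hR
      _ = (∑ i, w i ^ 2) * c ^ 2 := by rw [Finset.sum_mul]
      _ ≤ c ^ 2 := mul_le_of_le_one_left (sq_nonneg _) hw
  have h := sum_mul_abs_inner_le (fun e => bernVal q (z e)) ha hy (hfrob ha hA hu) (hfrob hy hY hv)
  have e1 : ∀ i j, |∑ k, (Matrix.of fun i k => |u i| * A i k) i k *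
      (Matrix.of fun i k => |v i| * Y i k) j k| = |u i| * |v j| * |∑ k, A i k * Y j k| := by
    intro i j
    have h1 : ∑ k, (Matrix.of fun i k => |u i| * A i k) i k *
        (Matrix.of fun i k => |v i| * Y i k) j k = |u i| * |v j| * ∑ k, A i k * Y j k := by
      rw [Finset.mul_sum]
      refine Finset.sum_congr rfl fun k _ => ?_
      simp only [Matrix.of_apply]; ring
    rw [h1, abs_mul, abs_of_nonneg (mul_nonneg (abs_nonneg _) (abs_nonneg _))]
  rw [Fintype.sum_prod_type] at h
  simp only [e1] at h
  refine le_trans (le_of_eq ?_) (add_le_add_right h _)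
  rw [Finset.mul_sum, ← Finset.sum_add_distrib]
  refine Finset.sum_congr rfl fun i _ => ?_
  rw [Finset.mul_sum, ← Finset.sum_add_distrib]
  refine Finset.sum_congr rfl fun j _ => ?_
  unfold bernVal
  split_ifs <;> ring

/-- The spectral norm of a matrix dominated, on a random set of entries, by a fixed matrix `G` plus
the entries of `X Yᵀ - (X + A) (Y + B)ᵀ`. -/
lemma specNorm_masked_le {z : Fin n × Fin n → Bool} {q : ℝ} (hq : 0 ≤ q)
    {X Y A B : Matrix (Fin n) (Fin r) ℝ} {T G : Matrix (Fin n) (Fin n) ℝ}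
    (hT : ∀ i j, |T i j - G i j| ≤ if z (i, j) = true then
      |∑ k, A i k * (Y + B) j k| + |∑ k, X i k * B j k| else 0)
    {a b x y : ℝ} (ha : 0 < a) (hb : 0 < b) (hx : 0 < x) (hy : 0 < y)
    (hA : twoInfNorm A ≤ a) (hB : twoInfNorm B ≤ b) (hX : twoInfNorm X ≤ x)
    (hY : twoInfNorm (Y + B) ≤ y) :
    specNorm T ≤ specNorm G + q * (√n * specNorm (Y + B) * a + √n * specNorm X * b)
      + absPairing n r (fun e => bernVal q (z e)) * (a * y + x * b) := by
  have hTG : T = G + (T - G) := by abel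
  rw [hTG]
  refine (specNorm_add_le _ _).trans ?_
  rw [add_assoc]
  refine add_le_add_right ?_ _
  have hψ := absPairing_nonneg (r := r) fun e => bernVal q (z e)
  refine specNorm_le_of_bilin ?_ fun u v hu hv => ?_
  · have := specNorm_nonneg (Y + B)
    have := specNorm_nonneg X
    positivity
  have h1 := masked_pairing_le z q A (Y + B) ha hy hA hY hu hv
  have h2 := masked_pairing_le z q X B hx hb hX hB hu hv
  have m1 := mul_le_mul_of_nonneg_left (mean_pairing_le A (Y + B) hA hu hv) hq
  have m2 : q * ∑ i, ∑ j, |u i| * |v j| * |∑ k, X i k * B j k| ≤ q * (√n * specNorm X * b) := by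
    refine mul_le_mul_of_nonneg_left (le_trans (le_of_eq ?_) (mean_pairing_le B X hB hv hu)) hq
    rw [Finset.sum_comm]
    refine Finset.sum_congr rfl fun j _ => Finset.sum_congr rfl fun i _ => ?_
    rw [mul_comm |u i|]
    simp only [mul_comm (X i _)]
  have h3 : u ⬝ᵥ (T - G).mulVec v
      ≤ ∑ i, ∑ j, (if z (i, j) = true then |u i| * |v j| * |∑ k, A i k * (Y + B) j k| else 0)
        + ∑ i, ∑ j, (if z (i, j) = true then |u i| * |v j| * |∑ k, X i k * B j k| else 0) := by
    simp only [dotProduct, Matrix.mulVec, Finset.mul_sum, ← Finset.sum_add_distrib]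
    refine Finset.sum_le_sum fun i _ => Finset.sum_le_sum fun j _ => ?_
    refine (le_abs_self _).trans ?_
    rw [abs_mul, abs_mul, Matrix.sub_apply]
    calc |u i| * (|T i j - G i j| * |v j|) = |u i| * |v j| * |T i j - G i j| := by ring
      _ ≤ |u i| * |v j| * (if z (i, j) = true then
            |∑ k, A i k * (Y + B) j k| + |∑ k, X i k * B j k| else 0) := by
          gcongr
          exact hT i j
      _ = _ := by split_ifs <;> ring
  linarith

end Masked

/-! ### The ground truth factors -/

section GroundTruth

variable {n r : ℕ} {L : Matrix (Fin n) (Fin n) ℝ} {U V : Matrix (Fin n) (Fin r) ℝ} {s : Fin r → ℝ}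

lemma le_sigMax (s : Fin r → ℝ) (k : Fin r) : s k ≤ sigMax s :=
  le_ciSup (Set.finite_range s).bddAbove k

lemma sigMin_le (s : Fin r → ℝ) (k : Fin r) : sigMin s ≤ s k :=
  ciInf_le (Set.finite_range s).bddBelow k

lemma sigMin_pos (hr : 0 < r) (hs : ∀ k, 0 < s k) : 0 < sigMin s := by
  have : Nonempty (Fin r) := ⟨⟨0, hr⟩⟩
  obtain ⟨k, hk⟩ := Set.Nonempty.csInf_mem (Set.range_nonempty s) (Set.finite_range s)
  have : sigMin s = s k := hk.symm
  rw [this]; exact hs k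

lemma sigMin_le_sigMax (hr : 0 < r) (s : Fin r → ℝ) : sigMin s ≤ sigMax s :=
  (sigMin_le s ⟨0, hr⟩).trans (le_sigMax s ⟨0, hr⟩)

lemma one_le_condNum (hr : 0 < r) (hs : ∀ k, 0 < s k) : 1 ≤ condNum s :=
  (one_le_div (sigMin_pos hr hs)).2 (sigMin_le_sigMax hr s)

lemma sum_sq_of_orth {U : Matrix (Fin n) (Fin r) ℝ} (hU : U.transpose * U = 1) :
    ∑ i, ∑ k, U i k ^ 2 = r := by
  have h : (U.transpose * U).trace = r := by rw [hU]; simp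
  rw [← h, Finset.sum_comm]
  simp [Matrix.trace, Matrix.mul_apply, sq]

/-- The incoherence parameter is at least one, because the squared row norms of `U` add up to `r`.
-/
lemma one_le_incoherence (hr : 0 < r) (hn : 0 < n) {μ : ℝ} (hU : U.transpose * U = 1)
    (h : twoInfNorm U ≤ √(μ * r / n)) : 1 ≤ μ := by
  have hr0 : (0 : ℝ) < r := by exact_mod_cast hr
  have hn0 : (0 : ℝ) < n := by exact_mod_cast hn
  have hrow : ∀ i, ∑ k, U i k ^ 2 ≤ max (μ * r / n) 0 := fun i => by
    have h1 := (sqrt_row_le_twoInfNorm U i).trans h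
    rcases le_total 0 (μ * r / n) with h2 | h2
    · rw [max_eq_left h2]
      exact (Real.sqrt_le_sqrt_iff h2).1 h1
    · rw [max_eq_right h2]
      rw [Real.sqrt_eq_zero_of_nonpos h2] at h1
      exact Real.sqrt_eq_zero'.1 (le_antisymm h1 (Real.sqrt_nonneg _))
  have hsum : (r : ℝ) ≤ n * max (μ * r / n) 0 := by
    refine (sum_sq_of_orth hU).symm.le.trans
      ((Finset.sum_le_sum fun i _ => hrow i).trans (le_of_eq ?_))
    simp
  rcases le_total 0 (μ * r / n) with h2 | h2
  · rw [max_eq_left h2, mul_div_cancel₀ _ hn0.ne'] at hsum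
    exact le_of_mul_le_mul_right (by linarith) hr0
  · rw [max_eq_right h2, mul_zero] at hsum
    linarith

lemma specNorm_le_one_of_orth {U : Matrix (Fin n) (Fin r) ℝ} (hU : U.transpose * U = 1) :
    specNorm U ≤ 1 := by
  refine specNorm_le_of_mulVec zero_le_one fun v => le_of_eq ?_
  have h : U.mulVec v ⬝ᵥ U.mulVec v = v ⬝ᵥ v := by
    rw [Matrix.dotProduct_mulVec, ← Matrix.mulVec_transpose, Matrix.mulVec_mulVec, hU,
      Matrix.one_mulVec]
  simpa [dotProduct, sq] using h

lemma specNorm_balancedFactor_le (hr : 0 < r) (hs : ∀ k, 0 < s k) (hU : U.transpose * U = 1) :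
    specNorm (balancedFactor U s) ≤ √(sigMax s) := by
  have hM : 0 ≤ sigMax s := (hs ⟨0, hr⟩).le.trans (le_sigMax s _)
  have hd : specNorm (Matrix.diagonal fun k => √(s k)) ≤ √(sigMax s) := by
    refine specNorm_le_of_mulVec (Real.sqrt_nonneg _) fun v => ?_
    rw [Real.sq_sqrt hM, Finset.mul_sum]
    refine Finset.sum_le_sum fun k _ => ?_
    rw [Matrix.mulVec_diagonal, mul_pow, Real.sq_sqrt (hs k).le]
    exact mul_le_mul_of_nonneg_right (le_sigMax s k) (sq_nonneg _)
  calc _ ≤ specNorm U * specNorm (Matrix.diagonal fun k => √(s k)) := specNorm_mul_le _ _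
    _ ≤ 1 * √(sigMax s) :=
        mul_le_mul (specNorm_le_one_of_orth hU) hd (specNorm_nonneg _) zero_le_one
    _ = _ := one_mul _

lemma twoInfNorm_balancedFactor_le (hr : 0 < r) (hs : ∀ k, 0 < s k) {c : ℝ}
    (hU : twoInfNorm U ≤ c) : twoInfNorm (balancedFactor U s) ≤ c * √(sigMax s) := by
  have hM : 0 ≤ sigMax s := (hs ⟨0, hr⟩).le.trans (le_sigMax s _)
  have hc : 0 ≤ c := (twoInfNorm_nonneg U).trans hU
  refine twoInfNorm_le (mul_nonneg hc (Real.sqrt_nonneg _)) fun i => ?_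
  have h1 : ∑ k, balancedFactor U s i k ^ 2 ≤ (∑ k, U i k ^ 2) * sigMax s := by
    rw [Finset.sum_mul]
    refine Finset.sum_le_sum fun k _ => ?_
    rw [balancedFactor, Matrix.mul_diagonal, mul_pow, Real.sq_sqrt (hs k).le]
    exact mul_le_mul_of_nonneg_left (le_sigMax s k) (sq_nonneg _)
  calc _ ≤ √((∑ k, U i k ^ 2) * sigMax s) := Real.sqrt_le_sqrt h1
    _ = √(∑ k, U i k ^ 2) * √(sigMax s) :=
        Real.sqrt_mul (Finset.sum_nonneg fun _ _ => sq_nonneg _) _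
    _ ≤ _ := mul_le_mul_of_nonneg_right ((sqrt_row_le_twoInfNorm U i).trans hU)
        (Real.sqrt_nonneg _)

lemma IsCompactSVD.eq_balanced (h : IsCompactSVD L U s V) :
    L = balancedFactor U s * (balancedFactor V s).transpose := by
  rw [h.eq, balancedFactor, balancedFactor, Matrix.transpose_mul, Matrix.diagonal_transpose,
    Matrix.mul_assoc, Matrix.mul_assoc, ← Matrix.mul_assoc (Matrix.diagonal _) (Matrix.diagonal _),
    Matrix.diagonal_mul_diagonal]
  congr 3
  funext k
  exact (Real.mul_self_sqrt (h.pos k).le).symm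

lemma mul_transpose_eq_of_orthogonal {X Y : Matrix (Fin n) (Fin r) ℝ}
    {H : Matrix (Fin r) (Fin r) ℝ} (hH : H ∈ Matrix.orthogonalGroup (Fin r) ℝ) :
    X * Y.transpose = (X * H) * (Y * H).transpose := by
  have h1 : H * H.transpose = 1 := (Matrix.mem_orthogonalGroup_iff (Fin r) ℝ).1 hH
  rw [Matrix.transpose_mul, Matrix.mul_assoc, ← Matrix.mul_assoc H, h1, Matrix.one_mul]

lemma fromRows_mul_sub {X Y X' Y' : Matrix (Fin n) (Fin r) ℝ} (H : Matrix (Fin r) (Fin r) ℝ) :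
    Matrix.fromRows X Y * H - Matrix.fromRows X' Y'
      = Matrix.fromRows (X * H - X') (Y * H - Y') := by
  rw [Matrix.fromRows_mul]
  ext i j
  cases i <;> rfl

end GroundTruth

/-! ### Entrywise analysis of the thresholding step -/

section Entrywise

/-- Off the outliers the residual is below the threshold; at an outlier, soft thresholding changes
by at most the change of its argument. -/
lemma abs_shrink_residual_sub_outErr_le {τ B : ℝ} {o b : Bool} {s m x d : ℝ}
    (hob : o = true → b = true)
    (hB : 0 ≤ B) (hx : |x| ≤ B) (hd : |d| ≤ τ - B) :
    |shrink τ (if b = true then (if o = true then s * m else 0) + x + d else 0)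
        - (if o = true then s * m else 0) - outErr τ B o s m x| ≤ if o = true then |d| else 0 := by
  have hτ : 0 ≤ τ := by linarith [abs_nonneg d]
  by_cases ho : o = true
  · rw [if_pos ho, if_pos ho, if_pos (hob ho), outErr, if_pos ⟨ho, hx⟩]
    have h := abs_shrink_sub_shrink_le hτ (s * m + x + d) (s * m + x)
    rw [show s * m + x + d - (s * m + x) = d by ring] at h
    refine le_trans (le_of_eq ?_) h
    congr 1; ring
  · have h0 : outErr τ B o s m x = 0 := by
      unfold outErr; rw [if_neg fun h => ho h.1]
    rw [if_neg ho, if_neg ho, h0]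
    have hz : shrink τ (if b = true then 0 + x + d else 0) = 0 := by
      refine shrink_eq_zero ?_
      split_ifs
      · rw [zero_add]
        exact (abs_add_le _ _).trans (by linarith)
      · simpa using hτ
    rw [hz]; simp

end Entrywise

/-! ### Parameter bounds -/

section Parameters

/-- Here `m` stands for `μ r`, and `δ` for `(σ / σ_min) √(n / p)`. -/
lemma parameter_bounds {n κ m l p ρ ρs σ δ M C c : ℝ} (hn : 0 < n) (hκ : 1 ≤ κ) (hm : 0 < m)
    (hl : 1 ≤ l) (hp : 0 < p) (hρs : 0 ≤ ρs) (hρ : ρs ≤ ρ) (hσ : 0 < σ) (hM : 0 < M)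
    (hC : 0 ≤ C) (hc : 0 ≤ c)
    (hδ : δ * M = κ * σ * √(n / p))
    (h1 : κ ^ 4 * m ^ 2 * l ≤ c * (n * p)) (h3 : ρ * √(κ ^ 5 * m * l ^ 2) ≤ c) :
    C * κ * δ * √l * (√(m / n) * √M) * (√(m / n) * √M) ≤ C * √c * σ ∧
    ρs * p * (√n * √M * (C * κ * δ * √l * (√(m / n) * √M))) ≤ C * c * (σ * √(n * p)) := by
  have hsn : 0 < √n := Real.sqrt_pos.2 hn
  have hsp : 0 < √p := Real.sqrt_pos.2 hp
  have hn2 : √n ^ 2 = n := Real.sq_sqrt hn.le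
  have hp2 : √p ^ 2 = p := Real.sq_sqrt hp.le
  have hM2 : √M ^ 2 = M := Real.sq_sqrt hM.le
  have hl2 : √l ^ 2 = l := Real.sq_sqrt (by linarith)
  have hm2 : √m ^ 2 = m := Real.sq_sqrt hm.le
  have hκ0 : 0 < κ := by linarith
  rw [Real.sqrt_div hm.le, Real.sqrt_mul hn.le]
  rw [Real.sqrt_div hn.le] at hδ
  constructor
  · have h4 : κ ^ 2 * m * √l ≤ √c * (√n * √p) := by
      rw [← Real.sqrt_mul hn.le, ← Real.sqrt_mul hc]
      refine Real.le_sqrt_of_sq_le ?_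
      rw [mul_pow, mul_pow, hl2]
      linarith
    have e : C * κ * δ * √l * (√m / √n * √M) * (√m / √n * √M)
        = C * σ * (κ ^ 2 * m * √l / (√n * √p)) := by
      calc _ = C * κ * √l * (√m ^ 2) / √n ^ 2 * (δ * √M ^ 2) := by field_simp
        _ = C * κ * √l * m / √n ^ 2 * (κ * σ * (√n / √p)) := by rw [hm2, hM2, hδ]
        _ = _ := by field_simp
    rw [e]
    have h5 : κ ^ 2 * m * √l / (√n * √p) ≤ √c := (div_le_iff₀ (by positivity)).2 h4
    calc C * σ * (κ ^ 2 * m * √l / (√n * √p)) ≤ C * σ * √c := by gcongr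
      _ = _ := by ring
  · have h4 : κ ^ 2 * √l * √m ≤ √(κ ^ 5 * m * l ^ 2) := by
      refine Real.le_sqrt_of_sq_le ?_
      rw [mul_pow, mul_pow, hl2, hm2]
      have h5 : (κ ^ 2) ^ 2 * l ≤ κ ^ 5 * l ^ 2 := by
        have h6 : (κ ^ 2) ^ 2 ≤ κ ^ 5 := by
          rw [← pow_mul]; exact pow_le_pow_right₀ hκ (by norm_num)
        have h7 : l ≤ l ^ 2 := by nlinarith
        exact mul_le_mul h6 h7 (by linarith) (by positivity)
      nlinarith
    have h5 : ρs * (κ ^ 2 * √l * √m) ≤ c :=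
      le_trans (mul_le_mul hρ h4 (by positivity) (hρs.trans hρ)) h3
    have e : ρs * p * (√n * √M * (C * κ * δ * √l * (√m / √n * √M)))
        = C * (ρs * (κ ^ 2 * √l * √m)) * (σ * (√n * √p)) := by
      calc _ = ρs * p * (C * κ * √l * √m) * (δ * √M ^ 2) := by field_simp
        _ = ρs * √p ^ 2 * (C * κ * √l * √m) * (κ * σ * (√n / √p)) := by rw [hM2, hδ, hp2]
        _ = _ := by field_simp
    rw [e]
    gcongr

/-- Choice of the small constant. -/
lemma exists_small_constant (C₁ C₂ C₃ C₄ : ℝ) (h1 : 0 ≤ C₁) (h2 : 0 ≤ C₂) (h3 : 0 ≤ C₃)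
    (h4 : 0 ≤ C₄) : ∃ c > (0 : ℝ), c ≤ 1 / 2 ∧ C₁ * c ≤ 1 / 12 ∧ C₂ * c ≤ 1 ∧
      C₁ * √c ≤ 1 / 4 ∧ 16 * C₁ ^ 2 * C₃ * c ≤ 1 / 16 ∧ 16 * C₄ * c ≤ 1 := by
  have hD : 0 < 2 + 12 * C₁ + C₂ + 16 * C₁ ^ 2 + 256 * C₁ ^ 2 * C₃ + 16 * C₄ := by positivity
  set D := 2 + 12 * C₁ + C₂ + 16 * C₁ ^ 2 + 256 * C₁ ^ 2 * C₃ + 16 * C₄ with hDdef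
  have a1 : 0 ≤ C₁ ^ 2 := sq_nonneg _
  have a2 : 0 ≤ C₁ ^ 2 * C₃ := mul_nonneg a1 h3
  have key : ∀ x : ℝ, x ≤ D → x * (1 / D) ≤ 1 := fun x hx => by
    rw [mul_one_div]; exact (div_le_one hD).2 hx
  refine ⟨1 / D, by positivity, ?_, ?_, ?_, ?_, ?_, ?_⟩
  · linarith [key 2 (by linarith)]
  · linarith [key (12 * C₁) (by linarith)]
  · exact key C₂ (by linarith)
  · have h5 := key (16 * C₁ ^ 2) (by linarith)
    have h6 : (C₁ * √(1 / D)) ^ 2 ≤ (1 / 4) ^ 2 := by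
      rw [mul_pow, Real.sq_sqrt (by positivity)]; linarith
    exact le_of_sq_le_sq h6 (by norm_num)
  · linarith [key (256 * C₁ ^ 2 * C₃) (by linarith)]
  · exact key (16 * C₄) (by linarith)

/-- With moments of order at least `log n`, a threshold `e¹⁰¹` times the moment bound yields the
probability `n⁻¹⁰⁰`; one factor `n` pays for `q⁻¹`. -/
lemma exp_tail_le {n D q : ℝ} {K : ℕ} (hn : 1 ≤ n) (hD : 0 < D) (hq : 0 < q) (hnq : 1 ≤ n * q)
    (hK : Real.log n ≤ K + 1) :
    q⁻¹ * D ^ (K + 1) / (Real.exp 101 * D) ^ (K + 1) ≤ 1 / n ^ 100 := by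
  have hn0 : 0 < n := by linarith
  have h1 : n ^ 101 ≤ Real.exp 101 ^ (K + 1) := by
    rw [← Real.exp_nat_mul]
    have : n ^ 101 = Real.exp (Real.log n * 101) := by
      rw [Real.exp_mul, Real.exp_log hn0]; norm_cast
    rw [this]
    refine Real.exp_le_exp.2 ?_
    push_cast
    linarith
  have h2 : q⁻¹ ≤ n := by
    rw [inv_le_comm₀ hq hn0, ← one_div, div_le_iff₀ hn0]; linarith
  rw [mul_pow, div_le_div_iff₀ (by positivity) (by positivity), one_mul]
  calc q⁻¹ * D ^ (K + 1) * n ^ 100 ≤ n * D ^ (K + 1) * n ^ 100 := by gcongr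
    _ = n ^ 101 * D ^ (K + 1) := by ring
    _ ≤ Real.exp 101 ^ (K + 1) * D ^ (K + 1) := by gcongr

end Parameters

/-! ### Tail bounds in the model -/

section Tails

variable {Ω : Type*} [MeasurableSpace Ω] {P : Measure Ω} [IsProbabilityMeasure P] {n : ℕ}
  {p ρs σ : ℝ} {obs out : Ω → Fin n → Fin n → Bool} {sgn mag noise : Ω → Fin n → Fin n → ℝ}

/-- The error matrix of soft thresholding at the outliers, if the low-rank part is known exactly. -/
noncomputable def outErrMatrix (τ B : ℝ) (out : Fin n → Fin n → Bool)
    (sgn mag noise : Fin n → Fin n → ℝ) : Matrix (Fin n) (Fin n) ℝ :=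
  Matrix.of fun i j => outErr τ B (out i j) (sgn i j) (mag i j) (noise i j)

lemma IsModel.measurable_out_apply (hM : IsModel P p ρs σ obs out sgn mag noise)
    (e : Fin n × Fin n) : Measurable fun ω => out ω e.1 e.2 := by
  have := hM.measurable_out
  fun_prop

lemma IsModel.indep_out (hM : IsModel P p ρs σ obs out sgn mag noise) :
    iIndepFun (fun (e : Fin n × Fin n) ω => out ω e.1 e.2) P :=
  hM.indep_loc.comp (fun _ => Prod.snd) fun _ => measurable_snd

lemma IsModel.prob_outErrMatrix_ge_le (hM : IsModel P p ρs σ obs out sgn mag noise) {τ B : ℝ}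
    (hτ : 0 ≤ τ) (hB : 0 < B) (hq0 : 0 ≤ p * ρs) {q : ℝ} (hq : p * ρs ≤ q) (hq' : 0 < q)
    (hq1 : q ≤ 1) (hn : 1 ≤ n) (hnq : 1 ≤ n * q) {K : ℕ} (hK : n * q ≤ K + 1)
    (hlog : Real.log n ≤ K + 1) :
    P {ω | Real.exp 101 * (4e9 * (τ + B) ^ 2 * (K + 1))
        ≤ specNorm (outErrMatrix τ B (out ω) (sgn ω) (mag ω) (noise ω)) ^ 2}
      ≤ ENNReal.ofReal (1 / (n : ℝ) ^ 100) := by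
  have hK0 : (0 : ℝ) < K + 1 := by positivity
  have hτB : 0 < τ + B := by linarith
  have hD : 0 < 4e9 * (τ + B) ^ 2 * ((K : ℝ) + 1) := by positivity
  have h := measure_specNorm_pow_ge_le (P := P) (B := fun e ω => out ω e.1 e.2)
    (G := fun ω => outErrMatrix τ B (out ω) (sgn ω) (mag ω) (noise ω)) (b := τ + B) (K := K)
    hM.measurable_out_apply hM.indep_out hq0 (fun e => hM.prob_out e.1 e.2)
    (fun i j => by
      have h1 := hM.measurable_out
      have h2 := hM.measurable_sgn
      have h3 := hM.measurable_mag
      have h4 := hM.measurable_noise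
      exact measurable_outErr hτ (by fun_prop) (by fun_prop) (by fun_prop) (by fun_prop))
    hτB.le (fun ω i j => abs_outErr_le hτ hB.le _ _ _ _)
    (fun e he => integral_outErr_monomial_eq_zero hM hτ B e he) hq hq' hq1 hK
    (thr := (Real.exp 101 * (4e9 * (τ + B) ^ 2 * (K + 1))) ^ (K + 1)) (by positivity)
  refine le_trans (measure_mono fun ω hω => ?_) (h.trans (ENNReal.ofReal_le_ofReal ?_))
  · have hω' : Real.exp 101 * (4e9 * (τ + B) ^ 2 * (K + 1))
        ≤ specNorm (outErrMatrix τ B (out ω) (sgn ω) (mag ω) (noise ω)) ^ 2 := hω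
    have := pow_le_pow_left₀ (by positivity) hω' (K + 1)
    rw [← pow_mul] at this
    exact this
  · refine le_trans (le_of_eq ?_) (exp_tail_le (K := K) (by exact_mod_cast hn) hD hq' hnq hlog)
    congr 1
    rw [pow_mul, mul_left_comm, ← mul_pow]
    congr 2; ring

lemma IsModel.prob_absPairing_ge_le (hM : IsModel P p ρs σ obs out sgn mag noise) (r : ℕ)
    (hq0 : 0 ≤ p * ρs) {q : ℝ} (hq : 2 * (p * ρs) ≤ q) (hq' : 0 < q)
    (hq1 : q ≤ 1) (hn : 1 ≤ n) (hnq : 1 ≤ n * q) {K : ℕ} (hK : n * q ≤ K + 1)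
    (hlog : Real.log n ≤ K + 1) :
    P {ω | Real.exp 101 * (4e9 * (K + 1))
        ≤ absPairing n r (fun e => bernVal (p * ρs) (out ω e.1 e.2)) ^ 2}
      ≤ ENNReal.ofReal (1 / (n : ℝ) ^ 100) := by
  have hθ : 2 * (p * ρs) * (1 - p * ρs) ≤ q :=
    (mul_le_of_le_one_right (by linarith) (by linarith)).trans hq
  have hp1 : p * ρs ≤ 1 := by linarith
  have hA := (bern_absPairing_pow_le (n := n) (r := r) hq0 hp1 (K := K)).trans
    (signExp_specNorm_sparse_pow_le (n := n) (mul_nonneg (by linarith) (by linarith)) hθ hq' hq1 hK)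
  have h := measure_pattern_ge_le (P := P) (B := fun (e : Fin n × Fin n) ω => out ω e.1 e.2)
    hM.measurable_out_apply hM.indep_out hq0 hp1 (fun e => hM.prob_out e.1 e.2)
    (f := fun z => absPairing n r (fun e => bernVal (p * ρs) (z e)) ^ (2 * (K + 1)))
    (fun z => pow_nonneg (absPairing_nonneg _) _)
    (thr := (Real.exp 101 * (4e9 * (K + 1))) ^ (K + 1)) (by positivity) hA
  refine le_trans (measure_mono fun ω hω => ?_) (h.trans (ENNReal.ofReal_le_ofReal ?_))
  · have hω' : Real.exp 101 * (4e9 * (K + 1))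
        ≤ absPairing n r (fun e => bernVal (p * ρs) (out ω e.1 e.2)) ^ 2 := hω
    have := pow_le_pow_left₀ (by positivity) hω' (K + 1)
    rw [← pow_mul] at this
    exact this
  · exact exp_tail_le (K := K) (by exact_mod_cast hn) (by positivity) hq' hnq hlog

end Tails

/-! ### The error bound -/

section ErrorBound

variable {n r : ℕ}

/-- Deterministic error bound: given control of the low-rank error, the thresholded matrix differs
from the outliers by the error for the exact low-rank part plus a masked low-rank perturbation. -/
lemma specNorm_thresholded_sub_le {obs out : Fin n → Fin n → Bool}
    {sgn mag noise : Fin n → Fin n → ℝ} {X Y A B : Matrix (Fin n) (Fin r) ℝ} {τ N q a z M : ℝ}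
    (hob : ∀ i j, out i j = true → obs i j = true) (hN : 0 ≤ N) (hnoise : ∀ i j, |noise i j| ≤ N)
    (hq : 0 ≤ q) (ha : 0 < a) (haz : a ≤ z)
    (hA : twoInfNorm A ≤ a) (hB : twoInfNorm B ≤ a) (hX : twoInfNorm X ≤ z)
    (hY : twoInfNorm Y ≤ z) (hΔ : 3 * (a * z) ≤ τ - N)
    (hXM : specNorm X ≤ M) (hYM : specNorm Y ≤ M) (hBM : specNorm B ≤ M) :
    specNorm (softThreshold τ (proj obs (X * Y.transpose + outlierMatrix out sgn mag
        + Matrix.of noise - (X + A) * (Y + B).transpose)) - outlierMatrix out sgn mag)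
      ≤ specNorm (outErrMatrix τ N out sgn mag noise) + 3 * (q * (√n * M * a))
        + absPairing n r (fun e => bernVal q (out e.1 e.2)) * (3 * (a * z)) := by
  have hz : 0 < z := ha.trans_le haz
  have hYB : twoInfNorm (Y + B) ≤ 2 * z := (twoInfNorm_add_le Y B).trans (by linarith)
  have hYBM : specNorm (Y + B) ≤ 2 * M := (specNorm_add_le Y B).trans (by linarith)
  set D : Fin n → Fin n → ℝ := fun i j => (X * Y.transpose) i j
    - ((X + A) * (Y + B).transpose) i j with hD
  have hDe : ∀ i j, D i j = -(∑ k, A i k * (Y + B) j k + ∑ k, X i k * B j k) := by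
    intro i j
    simp only [hD, Matrix.mul_apply, Matrix.transpose_apply, Matrix.add_apply]
    rw [← Finset.sum_sub_distrib, ← Finset.sum_add_distrib, ← Finset.sum_neg_distrib]
    exact Finset.sum_congr rfl fun k _ => by ring
  have hDabs : ∀ i j, |D i j| ≤ |∑ k, A i k * (Y + B) j k| + |∑ k, X i k * B j k| := by
    intro i j
    rw [hDe, abs_neg]
    exact abs_add_le _ _
  have hDle : ∀ i j, |D i j| ≤ τ - N := by
    intro i j
    refine (hDabs i j).trans (le_trans (add_le_add (abs_sum_mul_le_twoInfNorm A (Y + B) i j)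
      (abs_sum_mul_le_twoInfNorm X B i j)) (le_trans ?_ hΔ))
    have h1 : twoInfNorm A * twoInfNorm (Y + B) ≤ a * (2 * z) :=
      mul_le_mul hA hYB (twoInfNorm_nonneg _) ha.le
    have h2 : twoInfNorm X * twoInfNorm B ≤ z * a :=
      mul_le_mul hX hB (twoInfNorm_nonneg _) hz.le
    linarith
  refine (specNorm_masked_le (z := fun e => out e.1 e.2) (q := q) (X := X) (Y := Y) (A := A)
    (B := B) (G := outErrMatrix τ N out sgn mag noise) hq (fun i j => ?_) ha ha hz
    (by linarith : 0 < 2 * z) hA hB hX hYB).trans ?_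
  · have h := abs_shrink_residual_sub_outErr_le (τ := τ) (B := N) (o := out i j) (b := obs i j)
      (s := sgn i j) (m := mag i j) (x := noise i j) (d := D i j) (hob i j) hN (hnoise i j)
      (hDle i j)
    have e1 : (softThreshold τ (proj obs (X * Y.transpose + outlierMatrix out sgn mag
        + Matrix.of noise - (X + A) * (Y + B).transpose)) - outlierMatrix out sgn mag) i j
        = shrink τ (if obs i j = true then (if out i j = true then sgn i j * mag i j else 0)
          + noise i j + D i j else 0) - (if out i j = true then sgn i j * mag i j else 0) := by
      have e2 : (X * Y.transpose + outlierMatrix out sgn mag + Matrix.of noise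
          - (X + A) * (Y + B).transpose) i j
          = (if out i j = true then sgn i j * mag i j else 0) + noise i j + D i j := by
        simp only [hD, outlierMatrix, Matrix.sub_apply, Matrix.add_apply, Matrix.of_apply]
        ring
      rw [← e2]
      rfl
    rw [e1]
    refine h.trans ?_
    split_ifs
    · exact hDabs i j
    · exact le_rfl
  · have hψ := absPairing_nonneg (r := r) fun e : Fin n × Fin n => bernVal q (out e.1 e.2)
    have h1 : √n * specNorm (Y + B) * a + √n * specNorm X * a ≤ 3 * (√n * M * a) := by
      have h2 : √n * specNorm (Y + B) * a ≤ √n * (2 * M) * a := by gcongr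
      have h3 : √n * specNorm X * a ≤ √n * M * a := by gcongr
      linarith
    have h4 := mul_le_mul_of_nonneg_left h1 hq
    have h5 : a * (2 * z) + z * a = 3 * (a * z) := by ring
    rw [h5]
    linarith

end ErrorBound

end RobustPCA

set_option maxHeartbeats 2000000 in
theorem mainTheorem2 :
    -- `CS`, the implied constant `CP` of `O(n⁻¹⁰⁰)` and the threshold for `Cτ` are universal
    ∃ CS > (0 : ℝ), ∃ CP > (0 : ℝ), ∃ Cτ₀ > (0 : ℝ), ∀ Cτ ≥ Cτ₀,
    ∀ Clam > (0 : ℝ), ∀ Cop > (0 : ℝ), ∀ Cinf > (0 : ℝ),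
    -- `c` is the small constant in the relations `≪`
    ∃ c > (0 : ℝ),
    ∀ (n r : ℕ) (_ : 0 < r) (p ρs ρaug σ μ lam τ η : ℝ)
      (L : Matrix (Fin n) (Fin n) ℝ) (U V : Matrix (Fin n) (Fin r) ℝ) (s : Fin r → ℝ)
      (_ : RobustPCA.IsCompactSVD L U s V) (_ : RobustPCA.Incoherent U V μ)
      (_ : 0 < p) (_ : p ≤ 1) (_ : 0 ≤ ρs) (_ : ρs ≤ ρaug) (_ : ρaug ≤ 1) (_ : 0 < σ) (_ : 0 < η)
      (_ : lam = Clam * σ * √(n * p)) (_ : τ = Cτ * σ * √(Real.log n))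
      -- sample size
      (_ : RobustPCA.condNum s ^ 4 * μ ^ 2 * r ^ 2 * n * Real.log n ≤ c * (n ^ 2 * p))
      -- noise level
      (_ : σ / RobustPCA.sigMin s * √(n / p) * √(RobustPCA.condNum s ^ 2 * Real.log n) ≤ c)
      -- outlier fraction
      (_ : ρaug * √(RobustPCA.condNum s ^ 5 * μ * r * Real.log n ^ 2) ≤ c)
      (_ : μ * n * r * Real.log n ^ 2 ≤ c * (n ^ 2 * p * ρaug))
      (Ω : Type*) [MeasurableSpace Ω] (P : MeasureTheory.Measure Ω)
      [MeasureTheory.IsProbabilityMeasure P]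
      (obs out : Ω → Fin n → Fin n → Bool) (sgn mag noise : Ω → Fin n → Fin n → ℝ)
      (_ : RobustPCA.IsModel P p ρs σ obs out sgn mag noise) (t : ℕ),
      let Xs := RobustPCA.balancedFactor U s
      let Ys := RobustPCA.balancedFactor V s
      let Fs := Matrix.fromRows Xs Ys
      let Ss := fun ω => RobustPCA.outlierMatrix (out ω) (sgn ω) (mag ω)
      let M := fun ω => L + Ss ω + Matrix.of (noise ω)
      let it := fun ω => RobustPCA.iterates (obs ω) (M ω) p lam τ η Xs Ys (Ss ω) (t + 1)
      let F := fun ω => Matrix.fromRows (it ω).1 (it ω).2.1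
      -- the event that the hypotheses hold at iteration `t + 1`, but the conclusion fails
      P {ω | (∃ H, RobustPCA.IsBestRotation (F ω) Fs H ∧
            RobustPCA.specNorm (F ω * H - Fs)
              ≤ Cop * (σ / RobustPCA.sigMin s * √(n / p) + lam / (p * RobustPCA.sigMin s))
                * RobustPCA.specNorm Xs ∧
            RobustPCA.twoInfNorm (F ω * H - Fs)
              ≤ Cinf * RobustPCA.condNum s
                * (σ / RobustPCA.sigMin s * √(n * Real.log n / p)
                  + lam / (p * RobustPCA.sigMin s))
                * RobustPCA.twoInfNorm Fs) ∧
          ¬ RobustPCA.specNorm ((it ω).2.2 - Ss ω) ≤ CS * σ * √(n * p)}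
        ≤ ENNReal.ofReal (CP / (n : ℝ) ^ 100) := by
  -- the factor `2¹⁰⁰` makes the probability bound trivial for `n ≤ 2`; the threshold `τ` has to
  -- exceed the noise level `11 σ √(log n)` by the low-rank error, which is at most `σ √(log n)`
  refine ⟨1, one_pos, 4 * 2 ^ 100, by positivity, 12, by norm_num, ?_⟩
  intro Cτ hCτ Clam hClam Cop hCop Cinf hCinf
  -- `C₃` bounds the fluctuation over the outlier pattern, `C₄` the error matrix at the outliers
  set C₃ : ℝ := Real.exp 101 * 16e9 with hC₃
  set C₄ : ℝ := Real.exp 101 * 16e9 * (Cτ + 11) ^ 2 with hC₄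
  set C₁ : ℝ := Cinf * (1 + Clam) with hC₁
  have hC₁0 : 0 < C₁ := by positivity
  have hC₃0 : 0 < C₃ := by positivity
  obtain ⟨c, hc, hc2, hcC1, hcC2, hcC1', hcC3, hcC4⟩ := RobustPCA.exists_small_constant (3 * C₁)
    (Cop * (1 + Clam)) C₃ C₄ (by positivity) (by positivity) (by positivity) (by positivity)
  refine ⟨c, hc, ?_⟩
  intro n r hr p ρs ρ σ μ lam τ η L U V s hSVD hinc hp hp1 hρs hρs' hρ1 hσ hη hlam hτ h1 h2 h3 h4
    Ω _ P _ obs out sgn mag noise hM t Xs Ys Fs Ss M it F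
  have hn : 0 < n := by
    rcases Nat.eq_zero_or_pos n with rfl | h
    · have h := RobustPCA.sum_sq_of_orth hSVD.orthU
      have : (r : ℝ) = 0 := by simpa using h.symm
      exact absurd (by exact_mod_cast this) hr.ne'
    · exact h
  have hn0 : (0 : ℝ) < n := by exact_mod_cast hn
  -- for `n ≤ 2` the probability bound is trivial
  rcases Nat.lt_or_ge n 3 with hn3 | hn3
  · refine prob_le_one.trans ?_
    rw [← ENNReal.ofReal_one]
    refine ENNReal.ofReal_le_ofReal ?_
    rw [le_div_iff₀ (by positivity), one_mul]
    have : (n : ℝ) ≤ 2 := by exact_mod_cast Nat.lt_succ_iff.1 hn3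
    calc (n : ℝ) ^ 100 ≤ 2 ^ 100 := by gcongr
      _ ≤ 4 * 2 ^ 100 := by norm_num
  set l := Real.log n with hldef
  have hl : 1 ≤ l := by
    rw [hldef, Real.le_log_iff_exp_le hn0]
    have : (3 : ℝ) ≤ n := by exact_mod_cast hn3
    linarith [Real.exp_one_lt_d9]
  have hsl : 1 ≤ √l := Real.one_le_sqrt.2 hl
  set κ := RobustPCA.condNum s with hκdef
  have hκ : 1 ≤ κ := RobustPCA.one_le_condNum hr hSVD.pos
  have hμ : 1 ≤ μ := RobustPCA.one_le_incoherence hr hn hSVD.orthU hinc.1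
  have hr1 : (1 : ℝ) ≤ r := by exact_mod_cast hr
  set m := μ * r with hm
  have hm1 : 1 ≤ m := one_le_mul_of_one_le_of_one_le hμ hr1
  have hmin : 0 < RobustPCA.sigMin s := RobustPCA.sigMin_pos hr hSVD.pos
  set sM := RobustPCA.sigMax s with hsM
  have hsM0 : 0 < sM := hmin.trans_le (RobustPCA.sigMin_le_sigMax hr s)
  set δ := σ / RobustPCA.sigMin s * √(n / p) with hδdef
  have hnp : 0 < (n : ℝ) / p := by positivity
  have hδ0 : 0 < δ := mul_pos (div_pos hσ hmin) (Real.sqrt_pos.2 hnp)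
  have hN0 : 0 < (n : ℝ) * p := by positivity
  -- the assumptions in terms of `m = μ r` and `δ`
  have h1' : κ ^ 4 * m ^ 2 * l ≤ c * (n * p) := by
    refine le_of_mul_le_mul_right ?_ hn0
    calc κ ^ 4 * m ^ 2 * l * n = κ ^ 4 * μ ^ 2 * r ^ 2 * n * l := by rw [hm]; ring
      _ ≤ _ := h1
      _ = _ := by ring
  have h2' : δ * (κ * √l) ≤ c := by
    rwa [Real.sqrt_mul (sq_nonneg κ), Real.sqrt_sq (by linarith)] at h2
  have h3' : ρ * √(κ ^ 5 * m * l ^ 2) ≤ c := by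
    rwa [mul_assoc (κ ^ 5) μ] at h3
  have h4' : m * l ^ 2 ≤ c * (n * p * ρ) := by
    refine le_of_mul_le_mul_right ?_ hn0
    calc m * l ^ 2 * n = μ * n * r * l ^ 2 := by rw [hm]; ring
      _ ≤ _ := h4
      _ = _ := by ring
  have hδM : δ * sM = κ * σ * √(n / p) := by
    rw [hδdef, hκdef, RobustPCA.condNum]; field_simp; rfl
  have hlamδ : lam / (p * RobustPCA.sigMin s) = Clam * δ := by
    have h5 : √(n * p) = p * √(n / p) := by
      rw [show (n : ℝ) * p = p ^ 2 * (n / p) by field_simp, Real.sqrt_mul (sq_nonneg p),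
        Real.sqrt_sq hp.le]
    rw [hlam, h5, hδdef]; field_simp
  have hδl : σ / RobustPCA.sigMin s * √(n * l / p) = δ * √l := by
    rw [hδdef, mul_div_right_comm, Real.sqrt_mul hnp.le]; ring
  have hlN : l ^ 2 ≤ c * (n * p * ρ) :=
    (le_mul_of_one_le_left (sq_nonneg l) hm1).trans h4'
  have hρ0 : 0 < ρ := by
    by_contra hcon
    have h5 : c * (n * p * ρ) ≤ 0 := mul_nonpos_of_nonneg_of_nonpos hc.le
      (mul_nonpos_of_nonneg_of_nonpos hN0.le (not_lt.1 hcon))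
    have h6 : 0 < l ^ 2 := by positivity
    linarith only [h5, h6, hlN]
  have hρl : ρ * l ≤ c := by
    refine le_trans (mul_le_mul_of_nonneg_left ?_ hρ0.le) h3'
    refine Real.le_sqrt_of_sq_le (le_mul_of_one_le_left (sq_nonneg l) ?_)
    exact one_le_mul_of_one_le_of_one_le (one_le_pow₀ hκ) hm1
  have hlN' : l ≤ n * p * ρ := by
    have h5 : l ≤ l ^ 2 := le_self_pow₀ hl two_ne_zero
    have h6 : c * (n * p * ρ) ≤ 1 * (n * p * ρ) :=
      mul_le_mul_of_nonneg_right (by linarith only [hc2]) (mul_pos hN0 hρ0).le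
    linarith only [h5, h6, hlN]
  -- the order `2(K + 1)` of the moments: at least `log n`, and comparable to `n q`
  set q : ℝ := 2 * (p * ρ) with hq
  have hq0 : 0 < q := by positivity
  have hq1 : q ≤ 1 := by
    have h5 : p * ρ ≤ ρ := mul_le_of_le_one_left hρ0.le hp1
    have h6 : ρ ≤ ρ * l := le_mul_of_one_le_right hρ0.le hl
    linarith only [h5, h6, hρl, hc2, hq]
  have hnq : n * q = 2 * (n * p * ρ) := by rw [hq]; ring
  obtain ⟨K, hK1, hK2⟩ : ∃ K : ℕ, n * q ≤ K + 1 ∧ (K : ℝ) + 1 ≤ 4 * (n * p * ρ) := by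
    refine ⟨⌈n * q⌉₊ - 1, ?_⟩
    have hpos : 0 < ⌈n * q⌉₊ := Nat.ceil_pos.2 (by positivity)
    have e : ((⌈n * q⌉₊ - 1 : ℕ) : ℝ) + 1 = ⌈n * q⌉₊ := by
      rw [Nat.cast_sub hpos]; simp
    rw [e]
    refine ⟨Nat.le_ceil _, ?_⟩
    have := Nat.ceil_lt_add_one (a := n * q) (by positivity)
    linarith
  have hlK : l ≤ K + 1 := by linarith
  have hτ0 : 0 ≤ τ := by rw [hτ]; have : 0 < Cτ := by linarith
                         positivity
  have hpρ : p * ρs ≤ p * ρ := mul_le_mul_of_nonneg_left hρs' hp.le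
  have hpρ0 : 0 ≤ p * ρs := mul_nonneg hp.le hρs
  have b1 := hM.prob_noise_gt_le hσ hn
  have b2 := hM.prob_outErrMatrix_ge_le (B := 11 * (σ * √l)) hτ0 (by positivity) hpρ0
    (by linarith : p * ρs ≤ q) hq0 hq1 hn (by linarith) hK1 hlK
  have b3 := hM.prob_absPairing_ge_le r hpρ0 (by linarith : 2 * (p * ρs) ≤ q) hq0 hq1 hn
    (by linarith) hK1 hlK
  have hsplit : ENNReal.ofReal (2 / (n : ℝ) ^ 100) + ENNReal.ofReal (1 / (n : ℝ) ^ 100)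
      + ENNReal.ofReal (1 / (n : ℝ) ^ 100) ≤ ENNReal.ofReal (4 * 2 ^ 100 / (n : ℝ) ^ 100) := by
    rw [← ENNReal.ofReal_add (by positivity) (by positivity),
      ← ENNReal.ofReal_add (by positivity) (by positivity)]
    refine ENNReal.ofReal_le_ofReal ?_
    rw [← add_div, ← add_div]
    gcongr
    norm_num
  refine le_trans ?_ ((add_le_add (add_le_add b1 b2) b3).trans hsplit)
  refine le_trans (measure_mono ?_) (measure_union_le _ _ |>.trans
    (add_le_add_left (measure_union_le _ _) _))
  rintro ω ⟨⟨H, ⟨hH, -⟩, hop, hinf⟩, hbad⟩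
  by_contra hgood
  simp only [Set.mem_union, Set.mem_ofPred_eq, not_or, not_exists, not_lt, not_le] at hgood
  obtain ⟨⟨g1, g2⟩, g3⟩ := hgood
  apply hbad
  -- the low-rank error
  set A := (it ω).1 * H - Xs with hA
  set B := (it ω).2.1 * H - Ys with hB
  have hF : F ω * H - Fs = Matrix.fromRows A B := RobustPCA.fromRows_mul_sub H
  set z := √(m / n) * √sM with hz
  have hz0 : 0 < z := mul_pos (Real.sqrt_pos.2 (by positivity)) (Real.sqrt_pos.2 hsM0)
  have hXz : RobustPCA.twoInfNorm Xs ≤ z :=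
    RobustPCA.twoInfNorm_balancedFactor_le hr hSVD.pos hinc.1
  have hYz : RobustPCA.twoInfNorm Ys ≤ z :=
    RobustPCA.twoInfNorm_balancedFactor_le hr hSVD.pos hinc.2
  have hXM := RobustPCA.specNorm_balancedFactor_le hr hSVD.pos hSVD.orthU
  have hYM := RobustPCA.specNorm_balancedFactor_le hr hSVD.pos hSVD.orthV
  set a := C₁ * κ * δ * √l * z with ha
  have ha0 : 0 < a := by positivity
  have haz : a ≤ z := by
    have : C₁ * κ * δ * √l ≤ 1 := by
      calc C₁ * κ * δ * √l = C₁ * (δ * (κ * √l)) := by ring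
        _ ≤ C₁ * c := by gcongr
        _ ≤ 1 := by linarith
    exact mul_le_of_le_one_left hz0.le this
  have hABa : RobustPCA.twoInfNorm (Matrix.fromRows A B) ≤ a := by
    rw [hF, hlamδ, hδl] at hinf
    refine hinf.trans ?_
    have h5 : δ * √l + Clam * δ ≤ (1 + Clam) * (δ * √l) := by
      have : Clam * δ ≤ Clam * (δ * √l) := by
        gcongr
        exact le_mul_of_one_le_right hδ0.le hsl
      linarith
    calc _ ≤ Cinf * κ * ((1 + Clam) * (δ * √l)) * z := by
          gcongr
          · exact RobustPCA.twoInfNorm_nonneg _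
          · exact RobustPCA.twoInfNorm_fromRows_le hXz hYz
      _ = a := by rw [ha, hC₁]; ring
  have hABM : RobustPCA.specNorm (Matrix.fromRows A B) ≤ √sM := by
    rw [hF, hlamδ] at hop
    refine hop.trans ?_
    have h5 : δ ≤ c := le_trans (le_mul_of_one_le_right hδ0.le
      (one_le_mul_of_one_le_of_one_le hκ hsl)) h2'
    have h6 : Cop * (δ + Clam * δ) ≤ 1 := by
      calc Cop * (δ + Clam * δ) = Cop * (1 + Clam) * δ := by ring
        _ ≤ Cop * (1 + Clam) * c := by gcongr
        _ ≤ 1 := hcC2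
    calc _ ≤ 1 * √sM := by
          gcongr
          exact RobustPCA.specNorm_nonneg _
      _ = _ := one_mul _
  obtain ⟨hb1, hb2⟩ := RobustPCA.parameter_bounds (C := C₁) hn0 hκ (by linarith : 0 < m) hl hp hρs
    hρs' hσ hsM0 hC₁0.le hc.le hδM h1' h3'
  have hΔ : 3 * (a * z) ≤ 3 * C₁ * √c * σ := by
    calc 3 * (a * z) ≤ 3 * (C₁ * √c * σ) := by gcongr
      _ = _ := by ring
  have hΔσ : 3 * (a * z) ≤ σ * √l := by
    calc 3 * (a * z) ≤ 3 * C₁ * √c * σ := hΔ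
      _ ≤ 1 * σ := by gcongr; linarith
      _ ≤ σ * √l := by rw [one_mul]; exact le_mul_of_one_le_right hσ.le hsl
  have hmain := RobustPCA.specNorm_thresholded_sub_le (obs := obs ω) (out := out ω) (sgn := sgn ω)
    (mag := mag ω) (noise := noise ω) (X := Xs) (Y := Ys) (A := A) (B := B) (τ := τ)
    (N := 11 * (σ * √l)) (q := p * ρs) (a := a) (z := z) (M := √sM) (hM.out_subset_obs ω)
    (by positivity) g1 hpρ0 ha0 haz ((RobustPCA.twoInfNorm_fromRows_left A B).trans hABa)
    ((RobustPCA.twoInfNorm_fromRows_right A B).trans hABa) hXz hYz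
    (by
      have : 12 * (σ * √l) ≤ τ := by
        rw [hτ, mul_assoc]; gcongr
      linarith)
    hXM hYM ((RobustPCA.specNorm_fromRows_right A B).trans hABM)
  have hit : (it ω).2.2 = RobustPCA.softThreshold τ (RobustPCA.proj (obs ω)
      (Xs * Ys.transpose + Ss ω + Matrix.of (noise ω) - (Xs + A) * (Ys + B).transpose)) := by
    have e1 : (Xs + A) * (Ys + B).transpose = (it ω).1 * (it ω).2.1.transpose := by
      rw [hA, hB, add_sub_cancel, add_sub_cancel, ← RobustPCA.mul_transpose_eq_of_orthogonal hH]
    rw [e1, ← hSVD.eq_balanced]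
    rfl
  rw [hit]
  refine hmain.trans ?_
  -- the three contributions
  have hsN : √(n * p) ^ 2 = n * p := Real.sq_sqrt hN0.le
  have t1 : RobustPCA.specNorm (RobustPCA.outErrMatrix τ (11 * (σ * √l)) (out ω) (sgn ω) (mag ω)
      (noise ω)) ≤ 1 / 4 * (σ * √(n * p)) := by
    refine le_of_sq_le_sq (g2.le.trans ?_) (by positivity)
    have e : τ + 11 * (σ * √l) = (Cτ + 11) * σ * √l := by rw [hτ]; ring
    rw [e, mul_pow ((Cτ + 11) * σ), Real.sq_sqrt (by linarith), mul_pow (1 / 4 : ℝ), mul_pow σ, hsN]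
    calc Real.exp 101 * (4e9 * (((Cτ + 11) * σ) ^ 2 * l) * (K + 1))
        ≤ Real.exp 101 * (4e9 * (((Cτ + 11) * σ) ^ 2 * l) * (4 * (n * p * ρ))) := by gcongr
      _ = C₄ * (ρ * l) * (σ ^ 2 * (n * p)) := by rw [hC₄]; ring
      _ ≤ C₄ * c * (σ ^ 2 * (n * p)) := by gcongr
      _ ≤ (1 / 4) ^ 2 * (σ ^ 2 * (n * p)) := by gcongr; linarith
  have t2 : 3 * (p * ρs * (√n * √sM * a)) ≤ 1 / 4 * (σ * √(n * p)) := by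
    calc 3 * (p * ρs * (√n * √sM * a)) = 3 * (ρs * p * (√n * √sM * a)) := by ring
      _ ≤ 3 * (C₁ * c * (σ * √(n * p))) := by gcongr
      _ = 3 * C₁ * c * (σ * √(n * p)) := by ring
      _ ≤ 1 / 4 * (σ * √(n * p)) := by gcongr; linarith
  have t3 : RobustPCA.absPairing n r (fun e => RobustPCA.bernVal (p * ρs) (out ω e.1 e.2))
      * (3 * (a * z)) ≤ 1 / 4 * (σ * √(n * p)) := by
    have hψ0 := RobustPCA.absPairing_nonneg (n := n) (r := r)
      fun e => RobustPCA.bernVal (p * ρs) (out ω e.1 e.2)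
    refine (mul_le_mul_of_nonneg_left hΔ hψ0).trans ?_
    refine le_of_sq_le_sq ?_ (by positivity)
    rw [mul_pow, mul_pow (3 * C₁ * √c), mul_pow (3 * C₁), Real.sq_sqrt hc.le, mul_pow (1 / 4 : ℝ),
      mul_pow σ, hsN]
    have h5 : Real.exp 101 * (4e9 * ((K : ℝ) + 1)) ≤ C₃ * (n * p) := by
      calc Real.exp 101 * (4e9 * ((K : ℝ) + 1)) ≤ Real.exp 101 * (4e9 * (4 * (n * p * ρ))) := by
            gcongr
        _ = C₃ * (n * p) * ρ := by rw [hC₃]; ring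
        _ ≤ C₃ * (n * p) := mul_le_of_le_one_right (by positivity) hρ1
    calc _ ≤ C₃ * (n * p) * ((3 * C₁) ^ 2 * c * σ ^ 2) := by
          gcongr
          exact g3.le.trans h5
      _ = (3 * C₁) ^ 2 * C₃ * c * (σ ^ 2 * (n * p)) := by ring
      _ ≤ (1 / 4) ^ 2 * (σ ^ 2 * (n * p)) := by
          gcongr
          have : 0 ≤ (3 * C₁) ^ 2 * C₃ * c := by positivity
          linarith
  have hfin : 0 ≤ σ * √(n * p) := by positivity
  linarith
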